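/- **Setting.** An omega graph is a reflexive globular set (cells of every dimension $n\ge 0$ with domain, codomain and identity maps). An omega magma is an omega graph with composites $a\bigcirc_i^j b$ of $j$-cells over $i$-cells ($i<j$), defined exactly when $cod_i^j a=dom_i^j b$ and compatible with domains and codomains; it is a strict omega category if the associative, interchange, identity and identity-interchange laws hold. A bridge relation $R$ on an omega graph consists of relations $R_i\subseteq X_i\times X_i\times X_{i+1}$ such that $(a,b,c)\in R_i$ implies that $a,b$ are parallel and $c$ goes from $a$ to $b$, $(a,a,id\,a)\in R_i$ always, and $c$ is determined by $(a,b)$. A weak 2-category is a diagram $X_1\leftrightarrows X_2\to X_3$ with $\lambda:X_2\to X_1$ and $\kappa:X_2\to X_3$ morphisms of omega magmas, $\rho:X_1\to X_2$ a morphism of omega graphs with $\lambda\rho=1$, $X_3$ a strict omega category, $R$ a bridge relation on $X_2$ for which $\kappa$ is a categorical Penon morphism (if $(a,b,c)\in R_i$ then $\kappa a=\kappa b$ and $\kappa c=id(\kappa a)$; if $a,b$ are parallel and $\kappa a=\kappa b$ then $(a,b,c)\in R_i$ for some $c$), and every cell of $X_1$ of dimension $>2$ an identity cell. Morphisms of weak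 2-categories (omega functors) are triples of omega magma morphisms that commute with $\lambda,\kappa,\rho$ and preserve $R$; they form the category $\mathit{Weak\_2Cat}$. $\mathit{Bicat}$ is the category of small bicategories and strict homomorphisms (preserving all operations and identities on the nose). A bicategory is regarded as an omega magma with only identity cells above dimension 2; this gives forgetful functors from $\mathit{Bicat}$ and from strict 2-categories to omega graphs. **Theorem 20.** Let $Y$ be a small bicategory with underlying omega graph $G$. There exist a free bicategory on $G$ and a free strict 2-category on $G$, the latter being also a free strict omega category on $G$. For any choice of these, let $S_W^B Y=\mathbf X$ be the following diagram: $X_1=Y$; $X_2$ is the free bicategory on $G$; $X_3$ is the free strict 2-category on $G$; $\rho:X_1\to X_2$ is the insertion of generators; $\lambda:X_2\to X_1$ is the counit, i.e. the strict homomorphism extending $1_G$; $\kappa:X_2\to X_3$ is the strict homomorphism commuting with the insertions of generators; $R_1$ consists of all $(a,b,c)$ with $c$ an invertible 2-cell of $X_2$ from $a$ to $b$, and $R_i=\{(a,a,id\,a)\}$ for $i\ne 1$. Then: 1. $\mathbf X$ is a weak 2-category, and $\kappa$ is injective on parallel 2-cells. 2. The coherence data of $Y$ are the images under $\lambda$ of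 bridge cells of $X_2$: for composable 1-cells $f,g,h$ of $Y$ the associator between the two triple composites of $f,g,h$ is $\lambda c$, where $c$ is the bridge cell between the corresponding composites of $\rho f,\rho g,\rho h$ in $X_2$, and likewise for the unitors; conversely, $\lambda$ sends every bridge 2-cell of $X_2$ to a coherence isomorphism of $Y$ (a composite of whiskered associators, unitors, their inverses and identities). 3. $S_W^B$ is a functor $\mathit{Bicat}\to\mathit{Weak\_2Cat}$ (a strict homomorphism $F$ is sent to $F$ together with the morphisms that it induces on the free objects), and $\mathit{Bicat}$ is a retract of $\mathit{Weak\_2Cat}$: there is a functor $U:\mathit{Weak\_2Cat}\to\mathit{Bicat}$ with $U\circ S_W^B\cong 1_{\mathit{Bicat}}$. Moreover $U$ can be chosen so that $U\mathbf X\cong Z$ for every weak 2-category $\mathbf X$ and every bicategory $Z$ whose omega magma is identified with $X_1$ in such a way that the associators and unitors of $Z$ are the images under $\lambda$ of the bridge cells between the corresponding composites in $X_2$ of 1-cells lifted by $\rho$. -/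

import Mathlib

open CategoryTheory Bicategory

universe u

namespace WeakOmega

/-! ### Omega graphs -/

/-- An omega graph (reflexive globular set). -/
structure OmegaGraph : Type (u + 1) where
  /-- the cells of each dimension -/
  cell : ℕ → Type u
  /-- domain of a cell -/
  dom : ∀ {n : ℕ}, cell (n + 1) → cell n
  /-- codomain of a cell -/
  cod : ∀ {n : ℕ}, cell (n + 1) → cell n
  /-- identity cell on a cell -/
  ide : ∀ {n : ℕ}, cell n → cell (n + 1)
  dom_dom : ∀ {n : ℕ} (x : cell (n + 2)), dom (dom x) = dom (cod x)
  cod_dom : ∀ {n : ℕ} (x : cell (n + 2)), cod (dom x) = cod (cod x)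
  dom_ide : ∀ {n : ℕ} (x : cell n), dom (ide x) = x
  cod_ide : ∀ {n : ℕ} (x : cell n), cod (ide x) = x

namespace OmegaGraph

/-- The iterated domain, from `j`-cells to `i`-cells, for `i ≤ j`. -/
def domTo (X : OmegaGraph.{u}) {i j : ℕ} (h : i ≤ j) : X.cell j → X.cell i :=
  Nat.leRecOn (C := fun k => X.cell k → X.cell i) h (fun f x => f (X.dom x)) (fun x => x)

/-- The iterated codomain, from `j`-cells to `i`-cells, for `i ≤ j`. -/
def codTo (X : OmegaGraph.{u}) {i j : ℕ} (h : i ≤ j) : X.cell j → X.cell i :=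
  Nat.leRecOn (C := fun k => X.cell k → X.cell i) h (fun f x => f (X.cod x)) (fun x => x)

/-- The iterated identity, from `i`-cells to `j`-cells, for `i ≤ j`. -/
def ideTo (X : OmegaGraph.{u}) {i j : ℕ} (h : i ≤ j) (x : X.cell i) : X.cell j :=
  Nat.leRecOn (C := fun k => X.cell k) h (fun y => X.ide y) x

theorem domTo_self (X : OmegaGraph.{u}) {i : ℕ} (x : X.cell i) : X.domTo le_rfl x = x := by
  unfold domTo; rw [Nat.leRecOn_self]

theorem codTo_self (X : OmegaGraph.{u}) {i : ℕ} (x : X.cell i) : X.codTo le_rfl x = x := by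
  unfold codTo; rw [Nat.leRecOn_self]

theorem domTo_succ (X : OmegaGraph.{u}) {i j : ℕ} (h : i ≤ j) (h' : i ≤ j + 1)
    (x : X.cell (j + 1)) : X.domTo h' x = X.domTo h (X.dom x) := by
  unfold domTo; rw [Nat.leRecOn_succ h]

theorem codTo_succ (X : OmegaGraph.{u}) {i j : ℕ} (h : i ≤ j) (h' : i ≤ j + 1)
    (x : X.cell (j + 1)) : X.codTo h' x = X.codTo h (X.cod x) := by
  unfold codTo; rw [Nat.leRecOn_succ h]

/-- Two cells of the same dimension are parallel; 0-cells always are. -/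
def Parallel (X : OmegaGraph.{u}) : ∀ {i : ℕ}, X.cell i → X.cell i → Prop
  | 0, _, _ => True
  | _ + 1, a, b => X.dom a = X.dom b ∧ X.cod a = X.cod b

/-- An omega graph is `n`-skeletal if every cell of dimension `> n` is an identity cell. -/
def IsSkeletal (X : OmegaGraph.{u}) (n : ℕ) : Prop :=
  ∀ i : ℕ, n ≤ i → ∀ x : X.cell (i + 1), ∃ y : X.cell i, x = X.ide y

/-- Morphisms of omega graphs. -/
@[ext]
structure Hom (X Y : OmegaGraph.{u}) : Type u where
  /-- the action on cells -/
  map : ∀ {n : ℕ}, X.cell n → Y.cell n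
  map_dom : ∀ {n : ℕ} (x : X.cell (n + 1)), map (X.dom x) = Y.dom (map x)
  map_cod : ∀ {n : ℕ} (x : X.cell (n + 1)), map (X.cod x) = Y.cod (map x)
  map_ide : ∀ {n : ℕ} (x : X.cell n), map (X.ide x) = Y.ide (map x)

instance : Category.{u} OmegaGraph.{u} where
  Hom := Hom
  id X := ⟨fun x => x, fun _ => rfl, fun _ => rfl, fun _ => rfl⟩
  comp F G :=
    ⟨fun x => G.map (F.map x), fun x => by rw [F.map_dom, G.map_dom],
      fun x => by rw [F.map_cod, G.map_cod], fun x => by rw [F.map_ide, G.map_ide]⟩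

end OmegaGraph

/-! ### Omega magmas and strict omega categories -/

/-- An omega magma: `Comp h a b c` says that `c` is the composite of the `j`-cells `a` and `b`
over `i`-cells (in the order: first `a`, then `b`), for `i < j`. -/
structure OmegaMagma : Type (u + 1) extends OmegaGraph.{u} where
  /-- the composition relations -/
  Comp : ∀ {i j : ℕ}, i < j → cell j → cell j → cell j → Prop
  comp_composable : ∀ {i j : ℕ} (h : i < j) {a b c : cell j}, Comp h a b c →
    toOmegaGraph.codTo h.le a = toOmegaGraph.domTo h.le b
  comp_unique : ∀ {i j : ℕ} (h : i < j) {a b c d : cell j}, Comp h a b c → Comp h a b d → c = d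
  comp_exists : ∀ {i j : ℕ} (h : i < j) (a b : cell j),
    toOmegaGraph.codTo h.le a = toOmegaGraph.domTo h.le b → ∃ c, Comp h a b c
  comp_boundary : ∀ {i : ℕ} {a b c : cell (i + 1)}, Comp (Nat.lt_succ_self i) a b c →
    dom c = dom a ∧ cod c = cod b
  comp_dom_cod : ∀ {i j : ℕ} (h : i < j) (h' : i < j + 1) {a b c : cell (j + 1)}, Comp h' a b c →
    Comp h (dom a) (dom b) (dom c) ∧ Comp h (cod a) (cod b) (cod c)

namespace OmegaMagma

/-- Morphisms of omega magmas: morphisms of omega graphs preserving composites. -/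
@[ext]
structure Hom (X Y : OmegaMagma.{u}) : Type u extends
    OmegaGraph.Hom X.toOmegaGraph Y.toOmegaGraph where
  map_comp : ∀ {i j : ℕ} (h : i < j) {a b c : X.cell j}, X.Comp h a b c →
    Y.Comp h (map a) (map b) (map c)

instance : Category.{u} OmegaMagma.{u} where
  Hom := Hom
  id X := { toHom := 𝟙 X.toOmegaGraph, map_comp := fun {_ _} _ {_ _ _} hc => hc }
  comp {X Y Z} F G :=
    { toHom := CategoryStruct.comp (obj := OmegaGraph.{u}) F.toHom G.toHom
      map_comp := fun {_ _} h {_ _ _} hc => G.map_comp h (F.map_comp h hc) }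

/-- A strict omega category is an omega magma satisfying the associative, interchange, identity
and identity interchange laws. -/
structure IsStrict (X : OmegaMagma.{u}) : Prop where
  assoc : ∀ {i j : ℕ} (h : i < j) {a b c ab bc l r : X.cell j},
    X.Comp h a b ab → X.Comp h ab c l → X.Comp h b c bc → X.Comp h a bc r → l = r
  interchange : ∀ {i j k : ℕ} (hij : i < j) (hjk : j < k) {a b c d ab cd ac bd l r : X.cell k},
    X.Comp hjk a b ab → X.Comp hjk c d cd → X.Comp (hij.trans hjk) ab cd l →
    X.Comp (hij.trans hjk) a c ac → X.Comp (hij.trans hjk) b d bd → X.Comp hjk ac bd r → l = r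
  ide_comp : ∀ {i j : ℕ} (h : i < j) (a : X.cell j), X.Comp h (X.ideTo h.le (X.domTo h.le a)) a a
  comp_ide : ∀ {i j : ℕ} (h : i < j) (a : X.cell j), X.Comp h a (X.ideTo h.le (X.codTo h.le a)) a
  ide_interchange : ∀ {i j : ℕ} (h : i < j) {a b c : X.cell j}, X.Comp h a b c →
    X.Comp (Nat.lt_succ_of_lt h) (X.ide a) (X.ide b) (X.ide c)

end OmegaMagma

/-- The forgetful functor from omega magmas to omega graphs. -/
def magmaGraph : OmegaMagma.{u} ⥤ OmegaGraph.{u} where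
  obj X := X.toOmegaGraph
  map F := F.toHom

/-- The category of strict omega categories, a full subcategory of that of omega magmas. -/
abbrev StrictOmegaCat : Type (u + 1) :=
  ObjectProperty.FullSubcategory (fun X : OmegaMagma.{u} => X.IsStrict)

/-- The forgetful functor from strict omega categories to omega graphs. -/
abbrev strictOmegaGraph : StrictOmegaCat.{u} ⥤ OmegaGraph.{u} :=
  ObjectProperty.ι _ ⋙ magmaGraph

/-! ### Bridge relations, Penon morphisms, weak omega categories -/

/-- A family of ternary relations of the type of a bridge relation. -/
abbrev BridgeRel (X : OmegaGraph.{u}) : Type u :=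
  ∀ i : ℕ, X.cell i → X.cell i → X.cell (i + 1) → Prop

/-- The axioms of a bridge relation. -/
structure IsBridgeRel (X : OmegaGraph.{u}) (R : BridgeRel X) : Prop where
  boundary : ∀ {i : ℕ} {a b : X.cell i} {c : X.cell (i + 1)}, R i a b c →
    X.Parallel a b ∧ X.dom c = a ∧ X.cod c = b
  refl : ∀ {i : ℕ} (a : X.cell i), R i a a (X.ide a)
  unique : ∀ {i : ℕ} {a b : X.cell i} {c d : X.cell (i + 1)}, R i a b c → R i a b d → c = d

/-- The diagonal bridge relation. -/
def diagonalBridge (X : OmegaGraph.{u}) : BridgeRel X :=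
  fun _ a b c => a = b ∧ c = X.ide a

/-- `F : (X, R) ⟶ (Z, diagonal)` is a categorical Penon morphism. -/
structure IsPenon {X Z : OmegaMagma.{u}} (R : BridgeRel X.toOmegaGraph) (F : X ⟶ Z) : Prop where
  strict : Z.IsStrict
  bridge : ∀ {i : ℕ} {a b : X.cell i} {c : X.cell (i + 1)}, R i a b c →
    diagonalBridge Z.toOmegaGraph i (F.map a) (F.map b) (F.map c)
  collapse : ∀ {i : ℕ} {a b : X.cell i} {c : X.cell (i + 1)}, R i a b c →
    F.map a = F.map b ∧ F.map c = Z.ide (F.map a)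
  lift : ∀ {i : ℕ} {a b : X.cell i}, X.Parallel a b → F.map a = F.map b → ∃ c, R i a b c

/-- A diagram `X1 ⇆ X2 → X3` of omega magmas with a family of relations on `X2`: the data of a weak
omega category. -/
structure Diagram : Type (u + 1) where
  /-- the underlying magma -/
  X1 : OmegaMagma.{u}
  /-- the coherence magma -/
  X2 : OmegaMagma.{u}
  /-- the target of the Penon morphism -/
  X3 : OmegaMagma.{u}
  /-- the coherence morphism -/
  lam : X2 ⟶ X1
  /-- the splitting, a morphism of omega graphs only -/
  rho : magmaGraph.obj X1 ⟶ magmaGraph.obj X2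
  /-- the bridge relation -/
  R : BridgeRel X2.toOmegaGraph
  /-- the Penon morphism -/
  kap : X2 ⟶ X3

/-- The diagram is a weak omega category. -/
structure Diagram.IsWeakOmegaCat (X : Diagram.{u}) : Prop where
  split : X.rho ≫ magmaGraph.map X.lam = 𝟙 (magmaGraph.obj X.X1)
  bridge : IsBridgeRel X.X2.toOmegaGraph X.R
  strict : X.X3.IsStrict
  penon : IsPenon X.R X.kap

/-- The diagram is a weak `n`-category. -/
structure Diagram.IsWeakNCat (X : Diagram.{u}) (n : ℕ) : Prop extends X.IsWeakOmegaCat where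
  skeletal : X.X1.IsSkeletal n

/-- Omega functors. -/
@[ext]
structure OmegaFunctor (X Y : Diagram.{u}) : Type u where
  F1 : X.X1 ⟶ Y.X1
  F2 : X.X2 ⟶ Y.X2
  F3 : X.X3 ⟶ Y.X3
  bridge : ∀ {i : ℕ} {a b : X.X2.cell i} {c : X.X2.cell (i + 1)}, X.R i a b c →
    Y.R i (F2.map a) (F2.map b) (F2.map c)
  lam_comm : X.lam ≫ F1 = F2 ≫ Y.lam
  kap_comm : X.kap ≫ F3 = F2 ≫ Y.kap
  rho_comm : X.rho ≫ magmaGraph.map F2 = magmaGraph.map F1 ≫ Y.rho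

instance : Category.{u} Diagram.{u} where
  Hom := OmegaFunctor
  id X :=
    { F1 := 𝟙 _, F2 := 𝟙 _, F3 := 𝟙 _
      bridge := fun h => h
      lam_comm := rfl
      kap_comm := rfl
      rho_comm := rfl }
  comp {X Y Z} F G :=
    { F1 := F.F1 ≫ G.F1, F2 := F.F2 ≫ G.F2, F3 := F.F3 ≫ G.F3
      bridge := fun h => G.bridge (F.bridge h)
      lam_comm := by
        rw [← Category.assoc, F.lam_comm, Category.assoc, G.lam_comm, Category.assoc]
      kap_comm := by
        rw [← Category.assoc, F.kap_comm, Category.assoc, G.kap_comm, Category.assoc]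
      rho_comm := by
        rw [Functor.map_comp, Functor.map_comp, ← Category.assoc, F.rho_comm, Category.assoc,
          G.rho_comm, Category.assoc] }

/-- The category of weak 2-categories and omega functors. -/
abbrev WeakTwoCat : Type (u + 1) :=
  ObjectProperty.FullSubcategory (fun X : Diagram.{u} => X.IsWeakNCat 2)

/-! ### The category of bicategories and strict homomorphisms -/

/-- Small bicategories. -/
structure Bicat : Type (u + 1) where
  /-- the 0-cells -/
  carrier : Type u
  [str : Bicategory.{u, u} carrier]

attribute [instance] Bicat.str

theorem strictPseudofunctor_ext {B C : Type u} [Bicategory.{u, u} B] [Bicategory.{u, u} C]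
    {F G : StrictPseudofunctor B C} (h : F.toPrelaxFunctor = G.toPrelaxFunctor) : F = G := by
  obtain ⟨⟨⟨F0, Fid, Fcomp, _, _, _, _, _⟩, Fi, hFi⟩, Fc, hFc⟩ := F
  obtain ⟨⟨⟨G0, Gid, Gcomp, _, _, _, _, _⟩, Gi, hGi⟩, Gc, hGc⟩ := G
  dsimp only at h
  subst h
  obtain rfl : Fid = Gid := by
    funext a; exact (hFi a).trans (hGi a).symm
  obtain rfl : @Fcomp = @Gcomp := by
    funext a b c f g; exact (hFc f g).trans (hGc f g).symm
  rfl

/-- Morphisms of bicategories preserve all operations and identities on the nose. -/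
instance : Category.{u} Bicat.{u} where
  Hom B C := StrictPseudofunctor B.carrier C.carrier
  id B := StrictPseudofunctor.id B.carrier
  comp F G := StrictPseudofunctor.comp F G
  id_comp _ := strictPseudofunctor_ext rfl
  comp_id _ := strictPseudofunctor_ext rfl
  assoc _ _ _ := strictPseudofunctor_ext rfl

/-- The category of (small) strict 2-categories, a full subcategory of that of bicategories. -/
abbrev StrictTwoCat : Type (u + 1) :=
  ObjectProperty.FullSubcategory (fun B : Bicat.{u} => Bicategory.Strict B.carrier)

/-! ### A bicategory as a 2-skeletal omega magma -/

section

variable (B : Type u) [Bicategory.{u, u} B]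

/-- The 1-cells of a bicategory, with their boundary. -/
structure OneCell : Type u where
  {src tgt : B}
  hom : src ⟶ tgt

/-- The 2-cells of a bicategory, with their boundary. -/
structure TwoCell : Type u where
  {src tgt : B}
  {dom cod : src ⟶ tgt}
  hom : dom ⟶ cod

/-- The cells of a bicategory regarded as a 2-skeletal omega graph: above dimension 2, there is one
(identity) cell for each 2-cell. -/
def bicatCell : ℕ → Type u
  | 0 => B
  | 1 => OneCell B
  | _ + 2 => TwoCell B

/-- The omega graph underlying a bicategory. -/
def bicatOmegaGraph : OmegaGraph.{u} where
  cell := bicatCell B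
  dom {n} := match n with
    | 0 => fun x : OneCell B => x.src
    | 1 => fun x : TwoCell B => OneCell.mk x.dom
    | _ + 2 => fun x => x
  cod {n} := match n with
    | 0 => fun x : OneCell B => x.tgt
    | 1 => fun x : TwoCell B => OneCell.mk x.cod
    | _ + 2 => fun x => x
  ide {n} := match n with
    | 0 => fun x : B => OneCell.mk (𝟙 x)
    | 1 => fun x : OneCell B => TwoCell.mk (𝟙 x.hom)
    | _ + 2 => fun x => x
  dom_dom {n} := match n with
    | 0 => fun _ => rfl
    | 1 => fun _ => rfl
    | _ + 2 => fun _ => rfl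
  cod_dom {n} := match n with
    | 0 => fun _ => rfl
    | 1 => fun _ => rfl
    | _ + 2 => fun _ => rfl
  dom_ide {n} := match n with
    | 0 => fun _ => rfl
    | 1 => fun _ => rfl
    | _ + 2 => fun _ => rfl
  cod_ide {n} := match n with
    | 0 => fun _ => rfl
    | 1 => fun _ => rfl
    | _ + 2 => fun _ => rfl

variable {B}

/-- The composition relations of a bicategory: composition of 1-cells, horizontal and vertical
composition of 2-cells, the same compositions for the identity cells on 2-cells, and composition
of the latter over cells of dimension at least 2. -/
inductive BicatComp : ∀ _ j : ℕ, bicatCell B j → bicatCell B j → bicatCell B j → Prop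
  | one {a b c : B} (f : a ⟶ b) (g : b ⟶ c) :
      BicatComp 0 1 (OneCell.mk f) (OneCell.mk g) (OneCell.mk (f ≫ g))
  | horizontal (n : ℕ) {a b c : B} {f f' : a ⟶ b} {g g' : b ⟶ c} (η : f ⟶ f') (θ : g ⟶ g') :
      BicatComp 0 (n + 2) (TwoCell.mk η) (TwoCell.mk θ) (TwoCell.mk (η ▷ g ≫ f' ◁ θ))
  | vertical (n : ℕ) {a b : B} {f g h : a ⟶ b} (η : f ⟶ g) (θ : g ⟶ h) :
      BicatComp 1 (n + 2) (TwoCell.mk η) (TwoCell.mk θ) (TwoCell.mk (η ≫ θ))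
  | identity (i n : ℕ) (h : i ≤ n) (x : TwoCell B) : BicatComp (i + 2) (n + 3) x x x


theorem bicat_domTo_two_le (B : Type u) [Bicategory.{u, u} B] {i j : ℕ} (hij : i + 2 ≤ j + 2)
    (x : TwoCell B) :
    (bicatOmegaGraph B).domTo (j := j + 2) hij x = x := by
  induction j with
  | zero =>
    obtain rfl : i = 0 := by omega
    exact (bicatOmegaGraph B).domTo_self (i := 0 + 2) x
  | succ j ih =>
    rcases Nat.lt_or_ge i (j + 1) with h | h
    · exact ((bicatOmegaGraph B).domTo_succ (by omega : i + 2 ≤ j + 2) hij _).trans (ih (by omega))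
    · obtain rfl : i = j + 1 := by omega
      exact (bicatOmegaGraph B).domTo_self (i := j + 1 + 2) x

theorem bicat_codTo_two_le (B : Type u) [Bicategory.{u, u} B] {i j : ℕ} (hij : i + 2 ≤ j + 2)
    (x : TwoCell B) :
    (bicatOmegaGraph B).codTo (j := j + 2) hij x = x := by
  induction j with
  | zero =>
    obtain rfl : i = 0 := by omega
    exact (bicatOmegaGraph B).codTo_self (i := 0 + 2) x
  | succ j ih =>
    rcases Nat.lt_or_ge i (j + 1) with h | h
    · exact ((bicatOmegaGraph B).codTo_succ (by omega : i + 2 ≤ j + 2) hij _).trans (ih (by omega))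
    · obtain rfl : i = j + 1 := by omega
      exact (bicatOmegaGraph B).codTo_self (i := j + 1 + 2) x

theorem bicat_domTo_one (B : Type u) [Bicategory.{u, u} B] (n : ℕ) (h : 1 ≤ n + 2)
    (x : TwoCell B) :
    (bicatOmegaGraph B).domTo (j := n + 2) h x = OneCell.mk x.dom := by
  induction n with
  | zero =>
    exact ((bicatOmegaGraph B).domTo_succ le_rfl h _).trans ((bicatOmegaGraph B).domTo_self _)
  | succ n ih => exact ((bicatOmegaGraph B).domTo_succ (by omega) h _).trans (ih (by omega))

theorem bicat_codTo_one (B : Type u) [Bicategory.{u, u} B] (n : ℕ) (h : 1 ≤ n + 2)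
    (x : TwoCell B) :
    (bicatOmegaGraph B).codTo (j := n + 2) h x = OneCell.mk x.cod := by
  induction n with
  | zero =>
    exact ((bicatOmegaGraph B).codTo_succ le_rfl h _).trans ((bicatOmegaGraph B).codTo_self _)
  | succ n ih => exact ((bicatOmegaGraph B).codTo_succ (by omega) h _).trans (ih (by omega))

theorem bicat_domTo_zero (B : Type u) [Bicategory.{u, u} B] (n : ℕ) (h : 0 ≤ n + 2)
    (x : TwoCell B) :
    (bicatOmegaGraph B).domTo (j := n + 2) h x = x.src := by
  induction n with
  | zero =>
    refine ((bicatOmegaGraph B).domTo_succ (Nat.zero_le 1) h _).trans ?_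
    exact ((bicatOmegaGraph B).domTo_succ le_rfl (Nat.zero_le 1) _).trans
      ((bicatOmegaGraph B).domTo_self _)
  | succ n ih => exact ((bicatOmegaGraph B).domTo_succ (by omega) h _).trans (ih (by omega))

theorem bicat_codTo_zero (B : Type u) [Bicategory.{u, u} B] (n : ℕ) (h : 0 ≤ n + 2)
    (x : TwoCell B) :
    (bicatOmegaGraph B).codTo (j := n + 2) h x = x.tgt := by
  induction n with
  | zero =>
    refine ((bicatOmegaGraph B).codTo_succ (Nat.zero_le 1) h _).trans ?_
    exact ((bicatOmegaGraph B).codTo_succ le_rfl (Nat.zero_le 1) _).trans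
      ((bicatOmegaGraph B).codTo_self _)
  | succ n ih => exact ((bicatOmegaGraph B).codTo_succ (by omega) h _).trans (ih (by omega))

theorem bicat_domTo_one_zero (B : Type u) [Bicategory.{u, u} B] (h : 0 ≤ 1) (x : OneCell B) :
    (bicatOmegaGraph B).domTo (i := 0) (j := 1) h x = x.src :=
  ((bicatOmegaGraph B).domTo_succ (i := 0) (j := 0) le_rfl h x).trans
    ((bicatOmegaGraph B).domTo_self (i := 0) x.src)

theorem bicat_codTo_one_zero (B : Type u) [Bicategory.{u, u} B] (h : 0 ≤ 1) (x : OneCell B) :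
    (bicatOmegaGraph B).codTo (i := 0) (j := 1) h x = x.tgt :=
  ((bicatOmegaGraph B).codTo_succ (i := 0) (j := 0) le_rfl h x).trans
    ((bicatOmegaGraph B).codTo_self (i := 0) x.tgt)

variable (B) in
/-- A bicategory regarded as a 2-skeletal omega magma. -/
def bicatOmegaMagma : OmegaMagma.{u} where
  toOmegaGraph := bicatOmegaGraph B
  Comp {i j} _ := BicatComp i j
  comp_composable {i j} h {a b c} hc := by
    cases hc with
    | one f g => exact (bicat_codTo_one_zero B _ _).trans (bicat_domTo_one_zero B _ (.mk g)).symm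
    | horizontal n η θ =>
      exact (bicat_codTo_zero B n _ (.mk η)).trans (bicat_domTo_zero B n _ (.mk θ)).symm
    | vertical n η θ =>
      exact (bicat_codTo_one B n _ (.mk η)).trans (bicat_domTo_one B n _ (.mk θ)).symm
    | identity i n h' =>
      exact (bicat_codTo_two_le B (j := n + 1) (by omega) _).trans
        (bicat_domTo_two_le B (j := n + 1) (by omega) _).symm
  comp_unique {i j} h {a b c d} hc hd := by
    cases hc <;> cases hd <;> rfl
  comp_exists {i j} h a b hab := by
    match i, j, h with
    | 0, 1, h =>
      obtain ⟨f⟩ := a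
      obtain ⟨g⟩ := b
      replace hab := ((bicat_codTo_one_zero B _ _).symm.trans hab).trans
        (bicat_domTo_one_zero B _ _)
      dsimp only at hab
      subst hab
      exact ⟨_, .one f g⟩
    | 0, n + 2, h =>
      obtain ⟨η⟩ := a
      obtain ⟨θ⟩ := b
      replace hab := ((bicat_codTo_zero B n _ _).symm.trans hab).trans (bicat_domTo_zero B n _ _)
      dsimp only at hab
      subst hab
      exact ⟨_, .horizontal n η θ⟩
    | 1, n + 2, h =>
      obtain ⟨η⟩ := a
      obtain ⟨θ⟩ := b
      replace hab := ((bicat_codTo_one B n _ _).symm.trans hab).trans (bicat_domTo_one B n _ _)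
      cases hab
      exact ⟨_, .vertical n η θ⟩
    | i + 2, j + 3, h =>
      replace hab := ((bicat_codTo_two_le B (i := i) (j := j + 1) (by omega) a).symm.trans hab).trans
        (bicat_domTo_two_le B (i := i) (j := j + 1) (by omega) b)
      cases hab
      exact ⟨_, .identity i j (by omega) a⟩
  comp_boundary {i a b c} hc := by
    cases hc <;> exact ⟨rfl, rfl⟩
  comp_dom_cod {i j} h h' {a b c} hc := by
    cases hc with
    | one f g => exact absurd h (by omega)
    | horizontal n η θ =>
      cases n with
      | zero => exact ⟨.one _ _, .one _ _⟩
      | succ n => exact ⟨.horizontal n η θ, .horizontal n η θ⟩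
    | vertical n η θ =>
      cases n with
      | zero => exact absurd h (by omega)
      | succ n => exact ⟨.vertical n η θ, .vertical n η θ⟩
    | identity i n h'' =>
      cases n with
      | zero => exact absurd h (by omega)
      | succ n => exact ⟨.identity i n (by omega) _, .identity i n (by omega) _⟩

end

/-! ### The forgetful functors from bicategories -/

section

variable {B C : Type u} [Bicategory.{u, u} B] [Bicategory.{u, u} C]

theorem twoCell_mk_eq {a b : B} {f f' g g' : a ⟶ b} (hf : f = f') (hg : g = g') (η : f ⟶ g)
    (θ : f' ⟶ g') (h : η = eqToHom hf ≫ θ ≫ eqToHom hg.symm) : TwoCell.mk η = TwoCell.mk θ := by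
  subst hf hg
  simp at h
  rw [h]

/-- The action of a strict homomorphism of bicategories on cells. -/
def bicatCellMap (F : StrictPseudofunctor B C) : ∀ {n : ℕ}, bicatCell B n → bicatCell C n
  | 0 => fun x : B => F.obj x
  | 1 => fun x : OneCell B => OneCell.mk (F.map x.hom)
  | _ + 2 => fun x : TwoCell B => TwoCell.mk (F.map₂ x.hom)

/-- The morphism of omega graphs underlying a strict homomorphism of bicategories. -/
def bicatOmegaGraphMap (F : StrictPseudofunctor B C) :
    OmegaGraph.Hom (bicatOmegaGraph B) (bicatOmegaGraph C) where
  map := bicatCellMap F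
  map_dom {n} x := match n, x with
    | 0, _ => rfl
    | 1, _ => rfl
    | _ + 2, _ => rfl
  map_cod {n} x := match n, x with
    | 0, _ => rfl
    | 1, _ => rfl
    | _ + 2, _ => rfl
  map_ide {n} x := match n, x with
    | 0, x => congrArg OneCell.mk (F.map_id x)
    | 1, x => congrArg TwoCell.mk (F.map₂_id x.hom)
    | _ + 2, _ => rfl

theorem bicatComp_map (F : StrictPseudofunctor B C) {i j : ℕ} {x y z : bicatCell B j}
    (h : BicatComp i j x y z) :
    BicatComp i j (bicatCellMap F x) (bicatCellMap F y) (bicatCellMap F z) := by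
  cases h with
  | one f g =>
    have e : OneCell.mk (F.map (f ≫ g)) = OneCell.mk (F.map f ≫ F.map g) :=
      congrArg OneCell.mk (F.map_comp f g)
    change BicatComp 0 1 _ _ (OneCell.mk (F.map (f ≫ g)))
    rw [e]
    exact .one _ _
  | @horizontal n a b c f f' g g' η θ =>
    have e : TwoCell.mk (F.map₂ (η ▷ g ≫ f' ◁ θ)) =
        TwoCell.mk (F.map₂ η ▷ F.map g ≫ F.map f' ◁ F.map₂ θ) := by
      refine twoCell_mk_eq (F.map_comp f g) (F.map_comp f' g') _ _ ?_
      simp [F.mapComp_eq_eqToIso]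
    change BicatComp 0 (n + 2) _ _ (TwoCell.mk (F.map₂ (η ▷ g ≫ f' ◁ θ)))
    rw [e]
    exact .horizontal n _ _
  | vertical n η θ =>
    change BicatComp 1 (n + 2) _ _ (TwoCell.mk (F.map₂ (η ≫ θ)))
    rw [F.map₂_comp]
    exact .vertical n _ _
  | identity i n h => exact .identity i n h _

end

/-- The functor regarding a bicategory as a 2-skeletal omega magma. -/
def bicatMagma : Bicat.{u} ⥤ OmegaMagma.{u} where
  obj Y := bicatOmegaMagma Y.carrier
  map F :=
    { toHom := bicatOmegaGraphMap F
      map_comp := fun {_ _} _ {_ _ _} hc => bicatComp_map F hc }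
  map_id Y := by
    apply OmegaMagma.Hom.ext
    funext n x
    match n, x with
    | 0, _ => rfl
    | 1, _ => rfl
    | _ + 2, _ => rfl
  map_comp F G := by
    apply OmegaMagma.Hom.ext
    funext n x
    match n, x with
    | 0, _ => rfl
    | 1, _ => rfl
    | _ + 2, _ => rfl

/-- The forgetful functor from bicategories to omega graphs. -/
abbrev bicatGraph : Bicat.{u} ⥤ OmegaGraph.{u} := bicatMagma ⋙ magmaGraph

/-- The forgetful functor from strict 2-categories to omega graphs. -/
abbrev strictTwoGraph : StrictTwoCat.{u} ⥤ OmegaGraph.{u} := ObjectProperty.ι _ ⋙ bicatGraph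

/-! ### Free objects -/

/-- A free object on `G` along a forgetful functor `V`, i.e. a universal arrow from `G` to `V`
(the unit at `G` of an adjunction with right adjoint `V`). -/
structure FreeObject {C : Type (u + 1)} [Category.{u} C] (V : C ⥤ OmegaGraph.{u})
    (G : OmegaGraph.{u}) : Type (u + 1) where
  /-- the free object -/
  obj : C
  /-- the insertion of generators -/
  unit : G ⟶ V.obj obj
  existsUnique : ∀ (Z : C) (φ : G ⟶ V.obj Z), ∃! F : obj ⟶ Z, unit ≫ V.map F = φ

namespace FreeObject

variable {C : Type (u + 1)} [Category.{u} C] {V : C ⥤ OmegaGraph.{u}} {G : OmegaGraph.{u}}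

/-- The morphism out of a free object induced by a morphism out of the generators. -/
noncomputable def desc (P : FreeObject V G) {Z : C} (φ : G ⟶ V.obj Z) : P.obj ⟶ Z :=
  (P.existsUnique Z φ).choose

theorem unit_desc (P : FreeObject V G) {Z : C} (φ : G ⟶ V.obj Z) :
    P.unit ≫ V.map (P.desc φ) = φ :=
  (P.existsUnique Z φ).choose_spec.1

theorem hom_ext (P : FreeObject V G) {Z : C} {F F' : P.obj ⟶ Z}
    (h : P.unit ≫ V.map F = P.unit ≫ V.map F') : F = F' :=
  (P.existsUnique Z _).unique h rfl

end FreeObject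

/-- A free bicategory on the omega graph underlying `Y`. -/
abbrev FreeBicat (Y : Bicat.{u}) : Type (u + 1) := FreeObject bicatGraph.{u} (bicatGraph.obj Y)

/-- A free strict 2-category on the omega graph underlying `Y`. -/
abbrev FreeStrict (Y : Bicat.{u}) : Type (u + 1) :=
  FreeObject strictTwoGraph.{u} (bicatGraph.obj Y)

/-! ### The diagram associated with a bicategory -/

/-- The bridge relation on (the magma of) a bicategory: diagonal except in dimension 1, where the
bridge cells are the invertible 2-cells. -/
def isoBridge (B : Type u) [Bicategory.{u, u} B] : BridgeRel (bicatOmegaGraph B)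
  | 1, x, y, c => ∃ (a b : B) (f g : a ⟶ b) (η : f ⟶ g), IsIso η ∧
      x = OneCell.mk f ∧ y = OneCell.mk g ∧ c = TwoCell.mk η
  | 0, x, y, c => diagonalBridge (bicatOmegaGraph B) 0 x y c
  | n + 2, x, y, c => diagonalBridge (bicatOmegaGraph B) (n + 2) x y c

/-- The counit at `Y`: the strict homomorphism from the free bicategory to `Y` extending the
identity of the underlying omega graph of `Y`. -/
noncomputable def counit {Y : Bicat.{u}} (P : FreeBicat Y) : P.obj ⟶ Y :=
  P.desc (𝟙 (bicatGraph.obj Y))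

/-- The comparison from the free bicategory to the free strict 2-category on the same omega graph:
the strict homomorphism commuting with the insertions of generators. -/
noncomputable def comparison {Y : Bicat.{u}} (P : FreeBicat Y) (Q : FreeStrict Y) :
    P.obj ⟶ Q.obj.obj :=
  P.desc (Z := Q.obj.obj) Q.unit

/-- The diagram of omega magmas associated with a bicategory `Y`. -/
noncomputable def standardDiagram {Y : Bicat.{u}} (P : FreeBicat Y) (Q : FreeStrict Y) :
    Diagram.{u} where
  X1 := bicatMagma.obj Y
  X2 := bicatMagma.obj P.obj
  X3 := bicatMagma.obj Q.obj.obj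
  lam := bicatMagma.map (counit P)
  rho := P.unit
  R := isoBridge P.obj.carrier
  kap := bicatMagma.map (comparison P Q)

theorem isoBridge_map {B C : Bicat.{u}} (F : B ⟶ C) {i : ℕ} {x y : bicatCell B.carrier i}
    {c : bicatCell B.carrier (i + 1)} (h : isoBridge B.carrier i x y c) :
    isoBridge C.carrier i ((bicatMagma.map F).map x) ((bicatMagma.map F).map y)
      ((bicatMagma.map F).map c) := by
  match i, x, y, c, h with
  | 1, _, _, _, ⟨a, b, f, g, η, hη, rfl, rfl, rfl⟩ =>
    refine ⟨_, _, _, _, (show StrictPseudofunctor B.carrier C.carrier from F).map₂ η, ?_, rfl, rfl, rfl⟩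
    exact inferInstanceAs (IsIso ((PrelaxFunctor.mapFunctor
      (show StrictPseudofunctor B.carrier C.carrier from F).toPrelaxFunctor a b).map η))
  | 0, _, _, _, ⟨rfl, rfl⟩ => exact ⟨rfl, (bicatMagma.map F).map_ide _⟩
  | _ + 2, _, _, _, ⟨rfl, rfl⟩ => exact ⟨rfl, (bicatMagma.map F).map_ide _⟩

/-- The omega functor induced by a strict homomorphism of bicategories. -/
noncomputable def standardMap {Y Y' : Bicat.{u}} (P : FreeBicat Y) (Q : FreeStrict Y)
    (P' : FreeBicat Y') (Q' : FreeStrict Y') (F : Y ⟶ Y') :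
    standardDiagram P Q ⟶ standardDiagram P' Q' where
  F1 := bicatMagma.map F
  F2 := bicatMagma.map (P.desc (bicatGraph.map F ≫ P'.unit))
  F3 := bicatMagma.map (Q.desc (bicatGraph.map F ≫ Q'.unit)).hom
  bridge h := isoBridge_map _ h
  lam_comm := by
    change bicatMagma.map _ ≫ bicatMagma.map _ = bicatMagma.map _ ≫ bicatMagma.map _
    rw [← Functor.map_comp, ← Functor.map_comp]
    congr 1
    apply P.hom_ext
    rw [Functor.map_comp, Functor.map_comp, counit, counit, ← Category.assoc, P.unit_desc,
      ← Category.assoc, P.unit_desc, Category.assoc, P'.unit_desc, Category.id_comp,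
      Category.comp_id]
  kap_comm := by
    change bicatMagma.map _ ≫ bicatMagma.map _ = bicatMagma.map _ ≫ bicatMagma.map _
    rw [← Functor.map_comp, ← Functor.map_comp]
    congr 1
    apply P.hom_ext
    rw [Functor.map_comp, Functor.map_comp, comparison, comparison, ← Category.assoc, P.unit_desc,
      ← Category.assoc, P.unit_desc, Category.assoc, P'.unit_desc]
    exact Q.unit_desc (bicatGraph.map F ≫ Q'.unit)
  rho_comm := P.unit_desc _

/-- The functor from bicategories to weak 2-categories, given that all the diagrams associated with
bicategories are weak 2-categories. -/
noncomputable def standardFunctor (P : ∀ Y : Bicat.{u}, FreeBicat Y)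
    (Q : ∀ Y : Bicat.{u}, FreeStrict Y)
    (h : ∀ Y : Bicat.{u}, (standardDiagram (P Y) (Q Y)).IsWeakNCat 2) :
    Bicat.{u} ⥤ WeakTwoCat.{u} where
  obj Y := ⟨standardDiagram (P Y) (Q Y), h Y⟩
  map {Y Y'} F := ObjectProperty.homMk (standardMap (P Y) (Q Y) (P Y') (Q Y') F)
  map_id Y := by
    apply ObjectProperty.hom_ext
    apply OmegaFunctor.ext
    · exact bicatMagma.map_id Y
    · refine (congrArg (fun F => bicatMagma.map F) ?_).trans (bicatMagma.map_id (P Y).obj)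
      apply (P Y).hom_ext
      rw [(P Y).unit_desc, CategoryTheory.Functor.map_id, CategoryTheory.Functor.map_id, Category.id_comp, Category.comp_id]
    · refine (congrArg (fun F : (Q Y).obj ⟶ (Q Y).obj => bicatMagma.map F.hom) ?_).trans
        (bicatMagma.map_id (Q Y).obj.obj)
      apply (Q Y).hom_ext (F' := 𝟙 _)
      rw [(Q Y).unit_desc, CategoryTheory.Functor.map_id, CategoryTheory.Functor.map_id, Category.id_comp, Category.comp_id]
  map_comp {Y Y' Y''} F G := by
    apply ObjectProperty.hom_ext
    apply OmegaFunctor.ext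
    · exact bicatMagma.map_comp F G
    · refine (congrArg (fun F => bicatMagma.map F) ?_).trans (bicatMagma.map_comp
        ((P Y).desc (bicatGraph.map F ≫ (P Y').unit))
        ((P Y').desc (bicatGraph.map G ≫ (P Y'').unit)))
      apply (P Y).hom_ext
      rw [(P Y).unit_desc, Functor.map_comp, Functor.map_comp, ← Category.assoc (P Y).unit,
        (P Y).unit_desc, Category.assoc, Category.assoc, (P Y').unit_desc]
    · refine (congrArg (fun F : (Q Y).obj ⟶ (Q Y'').obj => bicatMagma.map F.hom) ?_).trans
        (bicatMagma.map_comp ((Q Y).desc (bicatGraph.map F ≫ (Q Y').unit)).hom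
        ((Q Y').desc (bicatGraph.map G ≫ (Q Y'').unit)).hom)
      apply (Q Y).hom_ext (F' := (Q Y).desc (bicatGraph.map F ≫ (Q Y').unit) ≫
        (Q Y').desc (bicatGraph.map G ≫ (Q Y'').unit))
      rw [(Q Y).unit_desc, Functor.map_comp, Functor.map_comp, ← Category.assoc (Q Y).unit,
        (Q Y).unit_desc, Category.assoc, Category.assoc, (Q Y').unit_desc]

/-! ### Coherence data -/

/-- The coherence isomorphisms of a bicategory: the 2-cells obtained from identities, associators,
unitors and their inverses by vertical composition and whiskering. -/
inductive IsCoherence {B : Type u} [Bicategory.{u, u} B] :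
    ∀ {a b : B} {f g : a ⟶ b}, (f ⟶ g) → Prop
  | id {a b : B} (f : a ⟶ b) : IsCoherence (𝟙 f)
  | comp {a b : B} {f g h : a ⟶ b} {η : f ⟶ g} {θ : g ⟶ h} :
      IsCoherence η → IsCoherence θ → IsCoherence (η ≫ θ)
  | whiskerLeft {a b c : B} (f : a ⟶ b) {g h : b ⟶ c} {η : g ⟶ h} :
      IsCoherence η → IsCoherence (f ◁ η)
  | whiskerRight {a b c : B} {f g : a ⟶ b} {η : f ⟶ g} (h : b ⟶ c) :
      IsCoherence η → IsCoherence (η ▷ h)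
  | associator_hom {a b c d : B} (f : a ⟶ b) (g : b ⟶ c) (h : c ⟶ d) :
      IsCoherence (α_ f g h).hom
  | associator_inv {a b c d : B} (f : a ⟶ b) (g : b ⟶ c) (h : c ⟶ d) :
      IsCoherence (α_ f g h).inv
  | leftUnitor_hom {a b : B} (f : a ⟶ b) : IsCoherence (λ_ f).hom
  | leftUnitor_inv {a b : B} (f : a ⟶ b) : IsCoherence (λ_ f).inv
  | rightUnitor_hom {a b : B} (f : a ⟶ b) : IsCoherence (ρ_ f).hom
  | rightUnitor_inv {a b : B} (f : a ⟶ b) : IsCoherence (ρ_ f).inv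

/-- For a diagram `X`, a bicategory `Z` and an identification `e` of the magma of `Z` with the
underlying magma `X1`: the associators and unitors of `Z` are the images under `lam` of the bridge
cells of `X2` between the corresponding composites, formed in `X2`, of the cells lifted by
`rho`. -/
structure CoherenceFromBridges (X : Diagram.{u}) (Z : Bicat.{u}) (e : bicatMagma.obj Z ⟶ X.X1) :
    Prop where
  associator : ∀ {a b c d : Z.carrier} (f : a ⟶ b) (g : b ⟶ c) (h : c ⟶ d)
    {fg gh l r : X.X2.cell 1},
    X.X2.Comp Nat.zero_lt_one (X.rho.map (e.map (n := 1) (OneCell.mk f)))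
      (X.rho.map (e.map (n := 1) (OneCell.mk g))) fg →
    X.X2.Comp Nat.zero_lt_one fg (X.rho.map (e.map (n := 1) (OneCell.mk h))) l →
    X.X2.Comp Nat.zero_lt_one (X.rho.map (e.map (n := 1) (OneCell.mk g)))
      (X.rho.map (e.map (n := 1) (OneCell.mk h))) gh →
    X.X2.Comp Nat.zero_lt_one (X.rho.map (e.map (n := 1) (OneCell.mk f))) gh r →
    ∃ t : X.X2.cell 2, X.R 1 l r t ∧ X.lam.map t = e.map (n := 2) (TwoCell.mk (α_ f g h).hom)
  leftUnitor : ∀ {a b : Z.carrier} (f : a ⟶ b) {l : X.X2.cell 1},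
    X.X2.Comp Nat.zero_lt_one (X.X2.ide (X.rho.map (e.map (n := 0) a)))
      (X.rho.map (e.map (n := 1) (OneCell.mk f))) l →
    ∃ t : X.X2.cell 2, X.R 1 l (X.rho.map (e.map (n := 1) (OneCell.mk f))) t ∧
      X.lam.map t = e.map (n := 2) (TwoCell.mk (λ_ f).hom)
  rightUnitor : ∀ {a b : Z.carrier} (f : a ⟶ b) {l : X.X2.cell 1},
    X.X2.Comp Nat.zero_lt_one (X.rho.map (e.map (n := 1) (OneCell.mk f)))
      (X.X2.ide (X.rho.map (e.map (n := 0) b))) l →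
    ∃ t : X.X2.cell 2, X.R 1 l (X.rho.map (e.map (n := 1) (OneCell.mk f))) t ∧
      X.lam.map t = e.map (n := 2) (TwoCell.mk (ρ_ f).hom)

end WeakOmega

open WeakOmega

/-! The free bicategory. Omega graphs are reflexive, so the 1-cells of the free bicategory on the
graph of `Y` are bracketed words in the non-identity 1-cells of `Y`, an identity being inserted as
the identity word. Its 2-cells are terms built from structural 2-cells, the 2-cells of `Y`, vertical
composition and whiskering; two terms are equal when every graph morphism from `Y` to every
bicategory gives them the same value. With this semantic equality the bicategory axioms hold because
they hold in each target, and extensions exist by evaluation. Uniqueness is an induction on words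
and terms (`freeBicat_hom_ext`).

Coherence. By the coherence theorem for the free bicategory on a quiver there is at most one
coherence 2-cell between two words (`IsCoherence.unique`), and there is one exactly when the words
have the same underlying path (`exists_isCoherence`, `IsCoherence.norm_eq`). Taking paths as
1-cells, and as 2-cells the 2-cells between the corresponding words, gives a strict 2-category. The
projection onto it conjugates 2-cells by coherence isomorphisms, hence is locally faithful. A strict
homomorphism to a strict 2-category sends coherence 2-cells to identities, so it factors through
this projection: the strictification is the free strict 2-category. It is also free among strict
omega categories, because a graph morphism out of a bicategory lands in the 2-truncation of its
target, and that truncation is a strict 2-category.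

Bridges. Two parallel words with the same path are joined by a coherence isomorphism, which gives
the lifting property of `kap`. For the collapse property every invertible 2-cell of the free
bicategory must be a coherence 2-cell. Map it to the bicategory whose 2-cells are propositions
composed by conjunction, sending a generator to the statement that it is an identity. An invertible
2-cell goes to a true proposition, so every generator in a term representing it is an identity
(`isCoherence_of_isIso`).

The retraction. In a weak 2-category, parallel 2-cells of `X2` with equal images under `kap` have
equal images under `lam`, because the bridge 3-cell between them becomes an identity in the
2-skeletal magma `X1`. Bridges between composites of lifted 1-cells therefore give invertible
candidates for associators and unitors. The pentagon is not forced by this argument: it involves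
associators at `f ≫ g`, whose lift need not be the composite of the lifts. So the bicategory
assigned to `X` is `X1` with two parallel 2-cells identified when all coherent morphisms to
bicategories identify them. It is the universal bicategory under `X1` (`exists_realization_lift`,
`realization_hom_ext`), which gives functoriality. If `X1` is already the magma of a bicategory with
the right coherence data, the universal property yields the isomorphism. -/

namespace WeakOmega

/-! ### Cells bundled with their boundary -/

section Cells

variable {B C : Type u} [Bicategory.{u, u} B] [Bicategory.{u, u} C]

/-- Equations of cells are kept in bundled form, so that propositional equalities of boundaries need
no casts; this lemma and `TwoCell.exists_rep` recover typed cells when they are needed. -/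
theorem OneCell.exists_rep (x : OneCell B) {a b : B} (ha : x.src = a) (hb : x.tgt = b) :
    ∃ f : a ⟶ b, x = OneCell.mk f := by
  subst ha hb
  exact ⟨x.hom, rfl⟩

theorem TwoCell.exists_rep (x : TwoCell B) {a b : B} {f g : a ⟶ b}
    (hf : OneCell.mk x.dom = OneCell.mk f) (hg : OneCell.mk x.cod = OneCell.mk g) :
    ∃ η : f ⟶ g, x = TwoCell.mk η := by
  obtain ⟨η⟩ := x
  cases hf
  cases hg
  exact ⟨η, rfl⟩

theorem OneCell.mk_inj {a b : B} {f g : a ⟶ b} : OneCell.mk f = OneCell.mk g ↔ f = g :=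
  ⟨fun h => by cases h; rfl, fun h => by rw [h]⟩

theorem TwoCell.mk_inj {a b : B} {f g : a ⟶ b} {η θ : f ⟶ g} :
    TwoCell.mk η = TwoCell.mk θ ↔ η = θ :=
  ⟨fun h => by cases h; rfl, fun h => by rw [h]⟩

/-- The dictionary between bundled equality and the conjugation by `eqToHom` in which the axioms of
strict pseudofunctors are phrased. -/
theorem TwoCell.mk_eq_iff {a b : B} {f f' g g' : a ⟶ b} (hf : f = f') (hg : g = g') (η : f ⟶ g)
    (θ : f' ⟶ g') :
    TwoCell.mk η = TwoCell.mk θ ↔ η = eqToHom hf ≫ θ ≫ eqToHom hg.symm := by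
  subst hf hg
  simp

theorem TwoCell.mk_eqToHom {a b : B} {f f' : a ⟶ b} (hf : f = f') :
    TwoCell.mk (eqToHom hf) = TwoCell.mk (𝟙 f) := by
  subst hf
  simp

theorem TwoCell.mk_eqToHom' {a b : B} {f f' : a ⟶ b} (hf : f = f') :
    TwoCell.mk (eqToHom hf) = TwoCell.mk (𝟙 f') := by
  subst hf
  simp

theorem TwoCell.mk_associator_congr {a b c d a' b' c' d' : B} {f : a ⟶ b} {g : b ⟶ c} {h : c ⟶ d}
    {f' : a' ⟶ b'} {g' : b' ⟶ c'} {h' : c' ⟶ d'} (hf : OneCell.mk f = OneCell.mk f')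
    (hg : OneCell.mk g = OneCell.mk g') (hh : OneCell.mk h = OneCell.mk h') :
    TwoCell.mk (α_ f g h).hom = TwoCell.mk (α_ f' g' h').hom ∧
      TwoCell.mk (α_ f g h).inv = TwoCell.mk (α_ f' g' h').inv := by
  cases hf
  cases hg
  cases hh
  exact ⟨rfl, rfl⟩

theorem TwoCell.mk_unitor_congr {a b a' b' : B} {f : a ⟶ b} {f' : a' ⟶ b'}
    (hf : OneCell.mk f = OneCell.mk f') :
    (TwoCell.mk (λ_ f).hom = TwoCell.mk (λ_ f').hom ∧
      TwoCell.mk (λ_ f).inv = TwoCell.mk (λ_ f').inv) ∧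
    TwoCell.mk (ρ_ f).hom = TwoCell.mk (ρ_ f').hom ∧
      TwoCell.mk (ρ_ f).inv = TwoCell.mk (ρ_ f').inv := by
  cases hf
  exact ⟨⟨rfl, rfl⟩, rfl, rfl⟩

theorem TwoCell.mk_inv_eq {a b a' b' : B} {f g : a ⟶ b} {f' g' : a' ⟶ b'} (η : f ≅ g) (θ : f' ≅ g')
    (h : TwoCell.mk η.hom = TwoCell.mk θ.hom) : TwoCell.mk η.inv = TwoCell.mk θ.inv := by
  obtain ⟨x, y, h1, h2⟩ := η
  obtain ⟨x', y', h1', h2'⟩ := θ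
  dsimp only at h ⊢
  cases h
  have : y = y' := by
    rw [← Category.comp_id y, ← h1', ← Category.assoc, h2, Category.id_comp]
  rw [this]

end Cells

/-! ### Strict homomorphisms on coherence data and whiskerings -/

section StrictHom

variable {B C : Type u} [Bicategory.{u, u} B] [Bicategory.{u, u} C] (F : StrictPseudofunctor B C)

theorem mk_map₂_associator {a b c d : B} (f : a ⟶ b) (g : b ⟶ c) (h : c ⟶ d) :
    TwoCell.mk (F.map₂ (α_ f g h).hom) = TwoCell.mk (α_ (F.map f) (F.map g) (F.map h)).hom := by
  refine twoCell_mk_eq (by simp [F.map_comp]) (by simp [F.map_comp]) _ _ ?_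
  simp [F.mapComp_eq_eqToIso]

theorem mk_map₂_leftUnitor {a b : B} (f : a ⟶ b) :
    TwoCell.mk (F.map₂ (λ_ f).hom) = TwoCell.mk (λ_ (F.map f)).hom := by
  refine twoCell_mk_eq (by simp [F.map_comp, F.map_id]) rfl _ _ ?_
  simp [F.mapComp_eq_eqToIso, F.mapId_eq_eqToIso]

theorem mk_map₂_rightUnitor {a b : B} (f : a ⟶ b) :
    TwoCell.mk (F.map₂ (ρ_ f).hom) = TwoCell.mk (ρ_ (F.map f)).hom := by
  refine twoCell_mk_eq (by simp [F.map_comp, F.map_id]) rfl _ _ ?_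
  simp [F.mapComp_eq_eqToIso, F.mapId_eq_eqToIso]

theorem map₂_whiskerLeft_eqToHom {a b c : B} (f : a ⟶ b) {g h : b ⟶ c} (η : g ⟶ h) :
    F.map₂ (f ◁ η) =
      eqToHom (F.map_comp f g) ≫ F.map f ◁ F.map₂ η ≫ eqToHom (F.map_comp f h).symm := by
  simp [F.mapComp_eq_eqToIso]

theorem map₂_whiskerRight_eqToHom {a b c : B} {f g : a ⟶ b} (η : f ⟶ g) (h : b ⟶ c) :
    F.map₂ (η ▷ h) =
      eqToHom (F.map_comp f h) ≫ F.map₂ η ▷ F.map h ≫ eqToHom (F.map_comp g h).symm := by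
  simp [F.mapComp_eq_eqToIso]

end StrictHom

/-! ### Magma morphisms into a bicategory, evaluated on typed cells -/

section MagmaHom

variable {M : OmegaMagma.{u}} {C : Bicat.{u}} (F : M ⟶ bicatMagma.obj C)

theorem map_comp_one {x y z : M.cell 1} (h : M.Comp Nat.zero_lt_one x y z) {a b c : C.carrier}
    {f : a ⟶ b} {g : b ⟶ c} (hx : F.map x = OneCell.mk f) (hy : F.map y = OneCell.mk g) :
    F.map z = OneCell.mk (f ≫ g) := by
  have := F.map_comp _ h
  rw [hx, hy] at this
  exact (bicatMagma.obj C).comp_unique _ this (BicatComp.one f g)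

theorem map_comp_vertical {x y z : M.cell 2} (h : M.Comp Nat.one_lt_two x y z) {a b : C.carrier}
    {f g k : a ⟶ b} {η : f ⟶ g} {θ : g ⟶ k} (hx : F.map x = TwoCell.mk η)
    (hy : F.map y = TwoCell.mk θ) :
    F.map z = TwoCell.mk (η ≫ θ) := by
  have := F.map_comp _ h
  rw [hx, hy] at this
  exact (bicatMagma.obj C).comp_unique _ this (BicatComp.vertical 0 η θ)

theorem map_comp_horizontal {x y z : M.cell 2} (h : M.Comp Nat.zero_lt_two x y z)
    {a b c : C.carrier} {f f' : a ⟶ b} {g g' : b ⟶ c} {η : f ⟶ f'} {θ : g ⟶ g'}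
    (hx : F.map x = TwoCell.mk η) (hy : F.map y = TwoCell.mk θ) :
    F.map z = TwoCell.mk (η ▷ g ≫ f' ◁ θ) := by
  have := F.map_comp _ h
  rw [hx, hy] at this
  exact (bicatMagma.obj C).comp_unique _ this (BicatComp.horizontal 0 η θ)

theorem map_ide_zero {x : M.cell 0} {a : C.carrier} (hx : F.map x = a) :
    F.map (M.ide x) = OneCell.mk (𝟙 a) := by
  rw [F.map_ide, hx]; rfl

theorem map_ide_one {x : M.cell 1} {a b : C.carrier} {f : a ⟶ b} (hx : F.map x = OneCell.mk f) :
    F.map (M.ide x) = TwoCell.mk (𝟙 f) := by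
  rw [F.map_ide, hx]; rfl

theorem map_one_exists_rep (x : M.cell 1) {a b : C.carrier} (ha : F.map (M.dom x) = a)
    (hb : F.map (M.cod x) = b) : ∃ f : a ⟶ b, F.map x = OneCell.mk f :=
  OneCell.exists_rep _ ((F.map_dom x).symm.trans ha) ((F.map_cod x).symm.trans hb)

theorem map_two_exists_rep (x : M.cell 2) {a b : C.carrier} {f g : a ⟶ b}
    (hf : F.map (M.dom x) = OneCell.mk f) (hg : F.map (M.cod x) = OneCell.mk g) :
    ∃ η : f ⟶ g, F.map x = TwoCell.mk η :=
  TwoCell.exists_rep _ ((F.map_dom x).symm.trans hf) ((F.map_cod x).symm.trans hg)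

end MagmaHom

/-! ### Faithfulness of the passage from bicategories to omega magmas -/

section OutOfBicat

/-- Morphisms of omega graphs out of a bicategory are determined by their action on cells of
dimension at most 2. -/
theorem graphHom_ext {B : Bicat.{u}} {M : OmegaGraph.{u}} {F G : bicatGraph.obj B ⟶ M}
    (h0 : ∀ x : B.carrier, F.map (n := 0) x = G.map (n := 0) x)
    (h1 : ∀ x : OneCell B.carrier, F.map (n := 1) x = G.map (n := 1) x)
    (h2 : ∀ x : TwoCell B.carrier, F.map (n := 2) x = G.map (n := 2) x) : F = G := by
  apply OmegaGraph.Hom.ext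
  funext n x
  match n, x with
  | 0, x => exact h0 x
  | 1, x => exact h1 x
  | n + 2, x =>
    induction n with
    | zero => exact h2 x
    | succ n ih =>
      -- Above dimension 2 the identity operation of a bicategory is the identity function on
      -- `TwoCell`, so `map_ide` computes the value in dimension `n + 3` from that in dimension `n +
      -- 2`.
      have hF := F.map_ide (n := n + 2) x
      have hG := G.map_ide (n := n + 2) x
      rw [ih x] at hF
      exact hF.trans hG.symm

theorem magmaHom_ext {B : Bicat.{u}} {M : OmegaMagma.{u}} {F G : bicatMagma.obj B ⟶ M}
    (h0 : ∀ x : B.carrier, F.map (n := 0) x = G.map (n := 0) x)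
    (h1 : ∀ x : OneCell B.carrier, F.map (n := 1) x = G.map (n := 1) x)
    (h2 : ∀ x : TwoCell B.carrier, F.map (n := 2) x = G.map (n := 2) x) : F = G := by
  have := graphHom_ext (F := magmaGraph.map F) (G := magmaGraph.map G) h0 h1 h2
  apply OmegaMagma.Hom.ext
  exact congrArg (fun H => @OmegaGraph.Hom.map _ _ H) this

theorem bicatHom_ext {B C : Bicat.{u}} {F G : B ⟶ C}
    (h : bicatMagma.map F = bicatMagma.map G) : F = G := by
  apply strictPseudofunctor_ext
  have h0 : ∀ x : B.carrier, F.obj x = G.obj x := fun x =>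
    congrArg (fun H : bicatMagma.obj B ⟶ bicatMagma.obj C => H.map (n := 0) x) h
  have h1 : ∀ x : OneCell B.carrier, OneCell.mk (F.map x.hom) = OneCell.mk (G.map x.hom) := fun x =>
    congrArg (fun H : bicatMagma.obj B ⟶ bicatMagma.obj C => H.map (n := 1) x) h
  have h2 : ∀ x : TwoCell B.carrier, TwoCell.mk (F.map₂ x.hom) = TwoCell.mk (G.map₂ x.hom) :=
    fun x => congrArg (fun H : bicatMagma.obj B ⟶ bicatMagma.obj C => H.map (n := 2) x) h
  clear h
  obtain ⟨⟨⟨⟨⟨⟨F0, F1⟩, F2⟩, _, _⟩, _, _, _, _, _, _, _⟩, _, _⟩, _, _⟩ := F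
  obtain ⟨⟨⟨⟨⟨⟨G0, G1⟩, G2⟩, _, _⟩, _, _, _, _, _, _, _⟩, _, _⟩, _, _⟩ := G
  dsimp only at h0 h1 h2 ⊢
  obtain rfl : F0 = G0 := funext h0
  obtain rfl : @F1 = @G1 := by
    funext a b f
    exact OneCell.mk_inj.1 (h1 ⟨f⟩)
  obtain rfl : @F2 = @G2 := by
    funext a b f g η
    exact TwoCell.mk_inj.1 (h2 ⟨η⟩)
  rfl

instance : bicatMagma.{u}.Faithful := ⟨bicatHom_ext⟩

end OutOfBicat

/-! ### Magma morphisms that preserve associators and unitors are strict homomorphisms -/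

section Promote

variable {B C : Bicat.{u}}

/-- A morphism of omega magmas between bicategories preserves the associators and the unitors. -/
structure PreservesCoherence (F : bicatMagma.obj B ⟶ bicatMagma.obj C) : Prop where
  associator : ∀ {a b c d : B.carrier} (f : a ⟶ b) (g : b ⟶ c) (h : c ⟶ d)
    {a' b' c' d' : C.carrier} {f' : a' ⟶ b'} {g' : b' ⟶ c'} {h' : c' ⟶ d'},
    F.map (n := 1) (OneCell.mk f) = OneCell.mk f' → F.map (n := 1) (OneCell.mk g) = OneCell.mk g' →
    F.map (n := 1) (OneCell.mk h) = OneCell.mk h' →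
    F.map (n := 2) (TwoCell.mk (α_ f g h).hom) = TwoCell.mk (α_ f' g' h').hom
  leftUnitor : ∀ {a b : B.carrier} (f : a ⟶ b) {a' b' : C.carrier} {f' : a' ⟶ b'},
    F.map (n := 1) (OneCell.mk f) = OneCell.mk f' →
    F.map (n := 2) (TwoCell.mk (λ_ f).hom) = TwoCell.mk (λ_ f').hom
  rightUnitor : ∀ {a b : B.carrier} (f : a ⟶ b) {a' b' : C.carrier} {f' : a' ⟶ b'},
    F.map (n := 1) (OneCell.mk f) = OneCell.mk f' →
    F.map (n := 2) (TwoCell.mk (ρ_ f).hom) = TwoCell.mk (ρ_ f').hom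

theorem preservesCoherence_map (F : B ⟶ C) : PreservesCoherence (bicatMagma.map F) where
  associator f g h _ _ _ _ _ _ _ hf hg hh :=
    (mk_map₂_associator F f g h).trans (TwoCell.mk_associator_congr hf hg hh).1
  leftUnitor f _ _ _ hf :=
    (mk_map₂_leftUnitor F f).trans (TwoCell.mk_unitor_congr hf).1.1
  rightUnitor f _ _ _ hf :=
    (mk_map₂_rightUnitor F f).trans (TwoCell.mk_unitor_congr hf).2.1

/-- A morphism of omega magmas between bicategories that preserves associators and unitors
underlies a strict homomorphism. -/
theorem exists_bicatHom (F : bicatMagma.obj B ⟶ bicatMagma.obj C) (hF : PreservesCoherence F) :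
    ∃ G : B ⟶ C, bicatMagma.map G = F := by
  let F0 : B.carrier → C.carrier := fun a => F.map (n := 0) a
  have e1 : ∀ {a b : B.carrier} (f : a ⟶ b), ∃ f' : F0 a ⟶ F0 b,
      F.map (n := 1) (OneCell.mk f) = OneCell.mk f' := fun f =>
    map_one_exists_rep F (M := bicatMagma.obj B) (OneCell.mk f) rfl rfl
  choose F1 hF1 using @e1
  have e2 : ∀ {a b : B.carrier} {f g : a ⟶ b} (η : f ⟶ g), ∃ η' : F1 f ⟶ F1 g,
      F.map (n := 2) (TwoCell.mk η) = TwoCell.mk η' := fun η =>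
    map_two_exists_rep F (M := bicatMagma.obj B) (TwoCell.mk η) (hF1 _) (hF1 _)
  choose F2 hF2 using @e2
  have hid : ∀ a : B.carrier, F1 (𝟙 a) = 𝟙 (F0 a) := fun a =>
    OneCell.mk_inj.1 ((hF1 _).symm.trans (map_ide_zero F (M := bicatMagma.obj B) rfl))
  have hcomp : ∀ {a b c : B.carrier} (f : a ⟶ b) (g : b ⟶ c), F1 (f ≫ g) = F1 f ≫ F1 g :=
    fun f g => OneCell.mk_inj.1 ((hF1 _).symm.trans
      (map_comp_one F (M := bicatMagma.obj B) (.one f g) (hF1 f) (hF1 g)))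
  let G : StrictPseudofunctor B.carrier C.carrier := StrictPseudofunctor.mk'
    { obj := F0
      map := F1
      map₂ := F2
      map₂_id := fun f => TwoCell.mk_inj.1 ((hF2 _).symm.trans
        (map_ide_one F (M := bicatMagma.obj B) (hF1 f)))
      map₂_comp := fun η θ => TwoCell.mk_inj.1 ((hF2 _).symm.trans
        (map_comp_vertical F (M := bicatMagma.obj B) (.vertical 0 η θ) (hF2 η) (hF2 θ)))
      map_id := hid
      map_comp := hcomp
      -- Magma morphisms only know horizontal composites; a whiskering is the horizontal composite
      -- with an identity 2-cell.
      map₂_whisker_left := fun {a b c} f {g g'} η => by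
        rw [← TwoCell.mk_eq_iff (hcomp _ _) (hcomp _ _), ← hF2]
        have := map_comp_horizontal F (M := bicatMagma.obj B) (.horizontal 0 (𝟙 f) η)
          (map_ide_one F (M := bicatMagma.obj B) (hF1 f)) (hF2 η)
        simp only [id_whiskerRight, Category.id_comp] at this
        exact this
      map₂_whisker_right := fun {a b c} {f f'} η g => by
        rw [← TwoCell.mk_eq_iff (hcomp _ _) (hcomp _ _), ← hF2]
        have := map_comp_horizontal F (M := bicatMagma.obj B) (.horizontal 0 η (𝟙 g))
          (hF2 η) (map_ide_one F (M := bicatMagma.obj B) (hF1 g))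
        simp only [whiskerLeft_id, Category.comp_id] at this
        exact this
      map₂_left_unitor := fun f => by
        have := (TwoCell.mk_eq_iff (by rw [hcomp, hid]) rfl _ _).1
          ((hF2 _).symm.trans (hF.leftUnitor f (hF1 f)))
        simpa using this
      map₂_right_unitor := fun f => by
        have := (TwoCell.mk_eq_iff (by rw [hcomp, hid]) rfl _ _).1
          ((hF2 _).symm.trans (hF.rightUnitor f (hF1 f)))
        simpa using this
      map₂_associator := fun f g h => by
        have := (TwoCell.mk_eq_iff (by simp only [hcomp]) (by simp only [hcomp]) _ _).1
          ((hF2 _).symm.trans (hF.associator f g h (hF1 f) (hF1 g) (hF1 h)))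
        simpa using this }
  refine ⟨G, magmaHom_ext (fun x => rfl) (fun x => (hF1 x.hom).symm) (fun x => (hF2 x.hom).symm)⟩

end Promote

/-! ### Iterated domains, codomains and identities -/

namespace OmegaGraph

variable (X : OmegaGraph.{u})

theorem ideTo_self {i : ℕ} (x : X.cell i) : X.ideTo le_rfl x = x := by
  unfold ideTo; rw [Nat.leRecOn_self]

theorem ideTo_succ {i j : ℕ} (h : i ≤ j) (h' : i ≤ j + 1) (x : X.cell i) :
    X.ideTo h' x = X.ide (X.ideTo h x) := by
  unfold ideTo; rw [Nat.leRecOn_succ h]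

theorem domTo_one_zero (h : 0 ≤ 1) (x : X.cell 1) : X.domTo h x = X.dom x :=
  (X.domTo_succ le_rfl h x).trans (X.domTo_self _)

theorem codTo_one_zero (h : 0 ≤ 1) (x : X.cell 1) : X.codTo h x = X.cod x :=
  (X.codTo_succ le_rfl h x).trans (X.codTo_self _)

theorem domTo_two_one (h : 1 ≤ 2) (x : X.cell 2) : X.domTo h x = X.dom x :=
  (X.domTo_succ le_rfl h x).trans (X.domTo_self _)

theorem codTo_two_one (h : 1 ≤ 2) (x : X.cell 2) : X.codTo h x = X.cod x :=
  (X.codTo_succ le_rfl h x).trans (X.codTo_self _)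

theorem domTo_two_zero (h : 0 ≤ 2) (x : X.cell 2) : X.domTo h x = X.dom (X.dom x) :=
  (X.domTo_succ (Nat.zero_le 1) h x).trans (X.domTo_one_zero _ _)

theorem codTo_two_zero (h : 0 ≤ 2) (x : X.cell 2) : X.codTo h x = X.cod (X.cod x) :=
  (X.codTo_succ (Nat.zero_le 1) h x).trans (X.codTo_one_zero _ _)

theorem ideTo_one_zero (h : 0 ≤ 1) (x : X.cell 0) : X.ideTo h x = X.ide x :=
  (X.ideTo_succ le_rfl h x).trans (congrArg _ (X.ideTo_self _))

theorem ideTo_two_one (h : 1 ≤ 2) (x : X.cell 1) : X.ideTo h x = X.ide x :=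
  (X.ideTo_succ le_rfl h x).trans (congrArg _ (X.ideTo_self _))

theorem ideTo_two_zero (h : 0 ≤ 2) (x : X.cell 0) : X.ideTo h x = X.ide (X.ide x) :=
  (X.ideTo_succ (Nat.zero_le 1) h x).trans (congrArg _ (X.ideTo_one_zero _ _))

variable {X} {Y : OmegaGraph.{u}}

theorem map_domTo (F : X ⟶ Y) {i j : ℕ} (h : i ≤ j) (x : X.cell j) :
    F.map (X.domTo h x) = Y.domTo h (F.map x) := by
  induction j, h using Nat.le_induction with
  | base => rw [X.domTo_self, Y.domTo_self]
  | succ j h ih => rw [X.domTo_succ h, Y.domTo_succ h, ih, F.map_dom]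

theorem map_codTo (F : X ⟶ Y) {i j : ℕ} (h : i ≤ j) (x : X.cell j) :
    F.map (X.codTo h x) = Y.codTo h (F.map x) := by
  induction j, h using Nat.le_induction with
  | base => rw [X.codTo_self, Y.codTo_self]
  | succ j h ih => rw [X.codTo_succ h, Y.codTo_succ h, ih, F.map_cod]

end OmegaGraph

/-! ### The magma of a strict 2-category is a strict omega category -/

section StrictMagma

variable (B : Type u) [Bicategory.{u, u} B]

theorem bicat_ideTo_zero (n : ℕ) (h : 0 ≤ n + 2) (x : B) :
    (bicatOmegaGraph B).ideTo (i := 0) (j := n + 2) h x = TwoCell.mk (𝟙 (𝟙 x)) := by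
  induction n with
  | zero => exact (bicatOmegaGraph B).ideTo_two_zero h x
  | succ n ih =>
    exact ((bicatOmegaGraph B).ideTo_succ (Nat.zero_le (n + 2)) h _).trans (ih (Nat.zero_le _))

theorem bicat_ideTo_one (n : ℕ) (h : 1 ≤ n + 2) (x : OneCell B) :
    (bicatOmegaGraph B).ideTo (i := 1) (j := n + 2) h x = TwoCell.mk (𝟙 x.hom) := by
  induction n with
  | zero => exact (bicatOmegaGraph B).ideTo_two_one h x
  | succ n ih => exact ((bicatOmegaGraph B).ideTo_succ (by omega) h _).trans (ih (by omega))

theorem bicat_ideTo_two_le {i j : ℕ} (hij : i + 2 ≤ j + 2) (x : TwoCell B) :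
    (bicatOmegaGraph B).ideTo (i := i + 2) (j := j + 2) hij x = x := by
  induction j with
  | zero =>
    obtain rfl : i = 0 := by omega
    exact (bicatOmegaGraph B).ideTo_self (i := 0 + 2) x
  | succ j ih =>
    rcases Nat.lt_or_ge i (j + 1) with h | h
    · exact ((bicatOmegaGraph B).ideTo_succ (by omega : i + 2 ≤ j + 2) hij _).trans (ih (by omega))
    · obtain rfl : i = j + 1 := by omega
      exact (bicatOmegaGraph B).ideTo_self (i := j + 1 + 2) x

theorem bicatOmegaMagma_isStrict [Bicategory.Strict B] : (bicatOmegaMagma B).IsStrict where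
  assoc {i j} h {a b c ab bc l r} h1 h2 h3 h4 := by
    cases h1 with
    | one f g =>
      cases h2; cases h3; cases h4
      exact congrArg OneCell.mk (Bicategory.Strict.assoc _ _ _)
    | horizontal n η θ =>
      cases h2; cases h3; cases h4
      -- The two triple composites have boundaries that agree only propositionally; the comparison
      -- `eqToHom` cells are the associators, and naturality of the associator finishes.
      refine twoCell_mk_eq (Bicategory.Strict.assoc _ _ _) (Bicategory.Strict.assoc _ _ _) _ _ ?_
      simp [Bicategory.Strict.associator_eqToIso]
    | vertical n η θ =>
      cases h2; cases h3; cases h4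
      exact congrArg TwoCell.mk (Category.assoc _ _ _)
    | identity i n h' =>
      cases h2; cases h3; cases h4; rfl
  interchange {i j k} hij hjk {a b c d ab cd ac bd l r} h1 h2 h3 h4 h5 h6 := by
    cases h1 with
    | one => omega
    | horizontal => omega
    | vertical n η θ =>
      cases h2
      obtain rfl : i = 0 := by omega
      cases h3; cases h4; cases h5; cases h6
      refine congrArg TwoCell.mk ?_
      simp only [comp_whiskerRight, whiskerLeft_comp, Category.assoc]
      -- The only interchange law with content is that of horizontal and vertical composition; it
      -- reduces to the exchange of the two middle whiskerings.
      rw [whisker_exchange_assoc]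
    | identity j n h' =>
      cases h2
      -- Composition over cells of dimension at least 2 is only defined for equal cells, so `a = b`
      -- and `c = d` and both sides are the same composite.
      cases h4 <;> cases h3 <;> cases h5 <;> cases h6 <;> rfl
  ide_comp {i j} h a := by
    change BicatComp i j _ a a
    match i, j, h with
    | 0, 1, h =>
      erw [(bicatOmegaGraph B).ideTo_one_zero, (bicatOmegaGraph B).domTo_one_zero]
      have := BicatComp.one (𝟙 _) (OneCell.hom a)
      rw [Bicategory.Strict.id_comp] at this
      exact this
    | 0, n + 2, h =>
      erw [bicat_domTo_zero, bicat_ideTo_zero]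
      obtain ⟨η⟩ := a
      have := BicatComp.horizontal n (𝟙 (𝟙 _)) η
      have e : TwoCell.mk (𝟙 (𝟙 _) ▷ _ ≫ 𝟙 _ ◁ η) = TwoCell.mk η := by
        refine twoCell_mk_eq (Bicategory.Strict.id_comp _) (Bicategory.Strict.id_comp _) _ _ ?_
        simp [Bicategory.Strict.leftUnitor_eqToIso]
      rw [e] at this
      exact this
    | 1, n + 2, h =>
      erw [bicat_domTo_one, bicat_ideTo_one]
      have := BicatComp.vertical n (𝟙 _) (TwoCell.hom a)
      rw [Category.id_comp] at this
      exact this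
    | i + 2, j + 3, h =>
      erw [bicat_domTo_two_le B (j := j + 1) (by omega),
        bicat_ideTo_two_le B (j := j + 1) (by omega)]
      exact .identity i j (by omega) a
  comp_ide {i j} h a := by
    change BicatComp i j a _ a
    match i, j, h with
    | 0, 1, h =>
      erw [(bicatOmegaGraph B).ideTo_one_zero, (bicatOmegaGraph B).codTo_one_zero]
      have := BicatComp.one (OneCell.hom a) (𝟙 _)
      rw [Bicategory.Strict.comp_id] at this
      exact this
    | 0, n + 2, h =>
      erw [bicat_codTo_zero, bicat_ideTo_zero]
      obtain ⟨η⟩ := a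
      have := BicatComp.horizontal n η (𝟙 (𝟙 _))
      have e : TwoCell.mk (η ▷ 𝟙 _ ≫ _ ◁ 𝟙 (𝟙 _)) = TwoCell.mk η := by
        refine twoCell_mk_eq (Bicategory.Strict.comp_id _) (Bicategory.Strict.comp_id _) _ _ ?_
        simp [Bicategory.Strict.rightUnitor_eqToIso]
      rw [e] at this
      exact this
    | 1, n + 2, h =>
      erw [bicat_codTo_one, bicat_ideTo_one]
      have := BicatComp.vertical n (TwoCell.hom a) (𝟙 _)
      rw [Category.comp_id] at this
      exact this
    | i + 2, j + 3, h =>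
      erw [bicat_codTo_two_le B (j := j + 1) (by omega),
        bicat_ideTo_two_le B (j := j + 1) (by omega)]
      exact .identity i j (by omega) a
  ide_interchange {i j} h {a b c} hc := by
    change BicatComp i (j + 1) _ _ _
    cases hc with
    | one f g =>
      have := BicatComp.horizontal 0 (𝟙 f) (𝟙 g)
      rw [id_whiskerRight, whiskerLeft_id, Category.comp_id] at this
      exact this
    | horizontal n η θ => exact .horizontal (n + 1) η θ
    | vertical n η θ => exact .vertical (n + 1) η θ
    | identity i n h' => exact .identity i (n + 1) (by omega) _

end StrictMagma

/-! ### The 2-truncation of a strict omega category -/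

section Truncation

variable (M : OmegaMagma.{u})

/-- The 0-cells of an omega magma, as the objects of its 2-truncation. -/
def Trunc : Type u := M.cell 0

namespace Trunc

variable {M}

/-- 1-cells with prescribed boundary. -/
def Hom₁ (a b : M.cell 0) : Type u := {f : M.cell 1 // M.dom f = a ∧ M.cod f = b}

/-- 2-cells with prescribed boundary. -/
def Hom₂ {a b : M.cell 0} (f g : Hom₁ a b) : Type u :=
  {x : M.cell 2 // M.dom x = f.1 ∧ M.cod x = g.1}

theorem composable_one {f g : M.cell 1} (h : M.cod f = M.dom g) :
    M.codTo (Nat.zero_lt_one).le f = M.domTo (Nat.zero_lt_one).le g := by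
  rw [M.codTo_one_zero, M.domTo_one_zero, h]

theorem composable_vertical {x y : M.cell 2} (h : M.cod x = M.dom y) :
    M.codTo (Nat.one_lt_two).le x = M.domTo (Nat.one_lt_two).le y := by
  rw [M.codTo_two_one, M.domTo_two_one, h]

theorem composable_horizontal {x y : M.cell 2} (h : M.cod (M.cod x) = M.dom (M.dom y)) :
    M.codTo (Nat.zero_lt_two).le x = M.domTo (Nat.zero_lt_two).le y := by
  rw [M.codTo_two_zero, M.domTo_two_zero, h]

theorem exists_comp {a b c : M.cell 0} (f : Hom₁ a b) (g : Hom₁ b c) :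
    ∃ k : Hom₁ a c, M.Comp Nat.zero_lt_one f.1 g.1 k.1 := by
  obtain ⟨k, hk⟩ := M.comp_exists Nat.zero_lt_one f.1 g.1
    (composable_one (f.2.2.trans g.2.1.symm))
  have := M.comp_boundary hk
  exact ⟨⟨k, this.1.trans f.2.1, this.2.trans g.2.2⟩, hk⟩

noncomputable instance : CategoryStruct (Trunc M) where
  Hom a b := Hom₁ a b
  id a := ⟨M.ide a, M.dom_ide _, M.cod_ide _⟩
  comp f g := (exists_comp f g).choose

theorem comp_spec {a b c : Trunc M} (f : a ⟶ b) (g : b ⟶ c) :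
    M.Comp Nat.zero_lt_one f.1 g.1 (f ≫ g).1 :=
  (exists_comp f g).choose_spec

theorem exists_vcomp {a b : Trunc M} {f g h : a ⟶ b} (η : Hom₂ f g) (θ : Hom₂ g h) :
    ∃ x : Hom₂ f h, M.Comp Nat.one_lt_two η.1 θ.1 x.1 := by
  obtain ⟨k, hk⟩ := M.comp_exists Nat.one_lt_two η.1 θ.1
    (composable_vertical (η.2.2.trans θ.2.1.symm))
  have := M.comp_boundary hk
  exact ⟨⟨k, this.1.trans η.2.1, this.2.trans θ.2.2⟩, hk⟩

theorem exists_hcomp {a b c : Trunc M} {f f' : a ⟶ b} {g g' : b ⟶ c} (η : Hom₂ f f')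
    (θ : Hom₂ g g') : ∃ x : Hom₂ (f ≫ g) (f' ≫ g'), M.Comp Nat.zero_lt_two η.1 θ.1 x.1 := by
  obtain ⟨k, hk⟩ := M.comp_exists Nat.zero_lt_two η.1 θ.1
    (composable_horizontal (by rw [η.2.2, θ.2.1, f'.2.2, g.2.1]))
  have := M.comp_dom_cod Nat.zero_lt_one Nat.zero_lt_two hk
  rw [η.2.1, η.2.2, θ.2.1, θ.2.2] at this
  exact ⟨⟨k, M.comp_unique _ this.1 (comp_spec _ _), M.comp_unique _ this.2 (comp_spec _ _)⟩, hk⟩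

/-- Vertical composition in the 2-truncation. -/
noncomputable def vcomp {a b : Trunc M} {f g h : a ⟶ b} (η : Hom₂ f g) (θ : Hom₂ g h) :
    Hom₂ f h := (exists_vcomp η θ).choose

theorem vcomp_spec {a b : Trunc M} {f g h : a ⟶ b} (η : Hom₂ f g) (θ : Hom₂ g h) :
    M.Comp Nat.one_lt_two η.1 θ.1 (vcomp η θ).1 := (exists_vcomp η θ).choose_spec

/-- Horizontal composition in the 2-truncation. -/
noncomputable def hcomp {a b c : Trunc M} {f f' : a ⟶ b} {g g' : b ⟶ c} (η : Hom₂ f f')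
    (θ : Hom₂ g g') : Hom₂ (f ≫ g) (f' ≫ g') := (exists_hcomp η θ).choose

theorem hcomp_spec {a b c : Trunc M} {f f' : a ⟶ b} {g g' : b ⟶ c} (η : Hom₂ f f')
    (θ : Hom₂ g g') : M.Comp Nat.zero_lt_two η.1 θ.1 (hcomp η θ).1 :=
  (exists_hcomp η θ).choose_spec

/-- Identity 2-cells in the 2-truncation. -/
def idTwo {a b : Trunc M} (f : a ⟶ b) : Hom₂ f f := ⟨M.ide f.1, M.dom_ide _, M.cod_ide _⟩

variable (hM : M.IsStrict)
include hM

theorem ide_comp_one {a b : Trunc M} (f : a ⟶ b) : M.Comp Nat.zero_lt_one (M.ide a) f.1 f.1 := by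
  have := hM.ide_comp Nat.zero_lt_one f.1
  rwa [M.domTo_one_zero, M.ideTo_one_zero, f.2.1] at this

theorem comp_ide_one {a b : Trunc M} (f : a ⟶ b) : M.Comp Nat.zero_lt_one f.1 (M.ide b) f.1 := by
  have := hM.comp_ide Nat.zero_lt_one f.1
  rwa [M.codTo_one_zero, M.ideTo_one_zero, f.2.2] at this

theorem ide_comp_two {a b : Trunc M} {f g : a ⟶ b} (x : Hom₂ f g) :
    M.Comp Nat.one_lt_two (M.ide f.1) x.1 x.1 := by
  have := hM.ide_comp Nat.one_lt_two x.1
  rwa [M.domTo_two_one, M.ideTo_two_one, x.2.1] at this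

theorem comp_ide_two {a b : Trunc M} {f g : a ⟶ b} (x : Hom₂ f g) :
    M.Comp Nat.one_lt_two x.1 (M.ide g.1) x.1 := by
  have := hM.comp_ide Nat.one_lt_two x.1
  rwa [M.codTo_two_one, M.ideTo_two_one, x.2.2] at this

theorem ide_comp_two_zero {a b : Trunc M} {f g : a ⟶ b} (x : Hom₂ f g) :
    M.Comp Nat.zero_lt_two (M.ide (M.ide a)) x.1 x.1 := by
  have := hM.ide_comp Nat.zero_lt_two x.1
  rwa [M.domTo_two_zero, M.ideTo_two_zero, x.2.1, f.2.1] at this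

theorem comp_ide_two_zero {a b : Trunc M} {f g : a ⟶ b} (x : Hom₂ f g) :
    M.Comp Nat.zero_lt_two x.1 (M.ide (M.ide b)) x.1 := by
  have := hM.comp_ide Nat.zero_lt_two x.1
  rwa [M.codTo_two_zero, M.ideTo_two_zero, x.2.2, g.2.2] at this

/-- The hom categories of the 2-truncation of a strict omega category. -/
@[reducible]
noncomputable def homCategory (a b : Trunc M) : Category (a ⟶ b) where
  Hom f g := Hom₂ f g
  id f := idTwo f
  comp η θ := vcomp η θ
  id_comp η := Subtype.ext (M.comp_unique _ (vcomp_spec _ _) (ide_comp_two hM η))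
  comp_id η := Subtype.ext (M.comp_unique _ (vcomp_spec _ _) (comp_ide_two hM η))
  assoc η θ ι := Subtype.ext (hM.assoc _ (vcomp_spec η θ) (vcomp_spec _ _) (vcomp_spec θ ι)
    (vcomp_spec _ _))

theorem strict_id_comp {a b : Trunc M} (f : a ⟶ b) : 𝟙 a ≫ f = f :=
  Subtype.ext (M.comp_unique _ (comp_spec _ _) (ide_comp_one hM f))

theorem strict_comp_id {a b : Trunc M} (f : a ⟶ b) : f ≫ 𝟙 b = f :=
  Subtype.ext (M.comp_unique _ (comp_spec _ _) (comp_ide_one hM f))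

theorem strict_assoc {a b c d : Trunc M} (f : a ⟶ b) (g : b ⟶ c) (h : c ⟶ d) :
    (f ≫ g) ≫ h = f ≫ g ≫ h :=
  Subtype.ext (hM.assoc _ (comp_spec f g) (comp_spec _ _) (comp_spec g h) (comp_spec _ _))

theorem hcomp_vcomp {a b c : Trunc M} {f f' f'' : a ⟶ b} {g g' g'' : b ⟶ c} (η : Hom₂ f f')
    (η' : Hom₂ f' f'') (θ : Hom₂ g g') (θ' : Hom₂ g' g'') :
    hcomp (vcomp η η') (vcomp θ θ') = vcomp (hcomp η θ) (hcomp η' θ') :=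
  Subtype.ext (hM.interchange Nat.zero_lt_one Nat.one_lt_two 
    (vcomp_spec η η') (vcomp_spec θ θ') (hcomp_spec _ _)
    (hcomp_spec _ _) (hcomp_spec _ _) (vcomp_spec _ _))

theorem hcomp_idTwo {a b c : Trunc M} (f : a ⟶ b) (g : b ⟶ c) :
    hcomp (idTwo f) (idTwo g) = idTwo (f ≫ g) :=
  Subtype.ext (M.comp_unique _ (hcomp_spec _ _) (hM.ide_interchange _ (comp_spec f g)))

theorem vcomp_idTwo {a b : Trunc M} {f g : a ⟶ b} (η : Hom₂ f g) : vcomp η (idTwo g) = η :=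
  Subtype.ext (M.comp_unique _ (vcomp_spec _ _) (comp_ide_two hM η))

theorem idTwo_vcomp {a b : Trunc M} {f g : a ⟶ b} (η : Hom₂ f g) : vcomp (idTwo f) η = η :=
  Subtype.ext (M.comp_unique _ (vcomp_spec _ _) (ide_comp_two hM η))

/-- Interchange with identities inserted. Together with `hcomp_eq'`, which whiskers in the other
order, it gives the exchange law of the truncation. -/
theorem hcomp_eq {a b c : Trunc M} {f f' : a ⟶ b} {g g' : b ⟶ c} (η : Hom₂ f f')
    (θ : Hom₂ g g') : vcomp (hcomp η (idTwo g)) (hcomp (idTwo f') θ) = hcomp η θ := by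
  rw [← hcomp_vcomp hM, vcomp_idTwo hM, idTwo_vcomp hM]

theorem hcomp_eq' {a b c : Trunc M} {f f' : a ⟶ b} {g g' : b ⟶ c} (η : Hom₂ f f')
    (θ : Hom₂ g g') : vcomp (hcomp (idTwo f) θ) (hcomp η (idTwo g')) = hcomp η θ := by
  rw [← hcomp_vcomp hM, vcomp_idTwo hM, idTwo_vcomp hM]

/-- Associators and unitors of the truncation are `eqToIso` of propositional equalities. This lemma
reduces the axioms containing them to equalities of underlying 2-cells, where the laws of `M` apply.
-/
theorem eq_conj_of_val_eq {a b : Trunc M} {f f' g g' : a ⟶ b} (hf : f = f') (hg : g' = g)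
    (x : Hom₂ f g) (y : Hom₂ f' g') (h : x.1 = y.1) :
    letI := homCategory hM a b
    x = eqToHom hf ≫ (show f' ⟶ g' from y) ≫ eqToHom hg := by
  subst hf hg
  let := homCategory hM a b
  dsimp only
  rw [eqToHom_refl, eqToHom_refl, Category.id_comp, Category.comp_id]
  exact Subtype.ext h

theorem hcomp_idTwo_eqToHom {a b c : Trunc M} (f : a ⟶ b) {g h : b ⟶ c} (e : g = h) :
    letI := homCategory hM
    hcomp (idTwo f) (eqToHom e : g ⟶ h) = (eqToHom (by rw [e]) : f ≫ g ⟶ f ≫ h) := by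
  subst e
  exact hcomp_idTwo hM f g

theorem hcomp_eqToHom_idTwo {a b c : Trunc M} {f g : a ⟶ b} (e : f = g) (h : b ⟶ c) :
    letI := homCategory hM
    hcomp (eqToHom e : f ⟶ g) (idTwo h) = (eqToHom (by rw [e]) : f ≫ h ⟶ g ≫ h) := by
  subst e
  exact hcomp_idTwo hM f h

/-- The 2-truncation of a strict omega category. -/
@[reducible]
noncomputable def bicategory : Bicategory.{u, u} (Trunc M) :=
  letI := homCategory hM
  { toCategoryStruct := inferInstance
    homCategory := homCategory hM
    whiskerLeft := fun f _ _ η => hcomp (idTwo f) η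
    whiskerRight := fun η h => hcomp η (idTwo h)
    associator := fun f g h => eqToIso (strict_assoc hM f g h)
    leftUnitor := fun f => eqToIso (strict_id_comp hM f)
    rightUnitor := fun f => eqToIso (strict_comp_id hM f)
    whiskerLeft_id := fun f g => hcomp_idTwo hM f g
    whiskerLeft_comp := fun f _ _ _ η θ =>
      (congrArg (fun x => hcomp x _) (idTwo_vcomp hM (idTwo f)).symm).trans
        (hcomp_vcomp hM _ _ _ _)
    id_whiskerLeft := fun η =>
      eq_conj_of_val_eq hM (strict_id_comp hM _) (strict_id_comp hM _).symm _ _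
        (M.comp_unique _ (hcomp_spec _ _) (ide_comp_two_zero hM η))
    comp_whiskerLeft := fun f g _ _ η =>
      eq_conj_of_val_eq hM (strict_assoc hM _ _ _) (strict_assoc hM _ _ _).symm _ _
        -- Associativity of horizontal composition for the identities on `f` and `g` and the cell
        -- `η`; identity interchange turns the composite of the two identities into the identity on
        -- `f ≫ g`.
        (hM.assoc _ (hM.ide_interchange _ (comp_spec f g)) (hcomp_spec (idTwo (f ≫ g)) η)
          (hcomp_spec (idTwo g) η) (hcomp_spec (idTwo f) _))
    id_whiskerRight := fun f g => hcomp_idTwo hM f g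
    comp_whiskerRight := fun η θ i =>
      (congrArg (fun x => hcomp _ x) (idTwo_vcomp hM (idTwo i)).symm).trans
        (hcomp_vcomp hM _ _ _ _)
    whiskerRight_id := fun η =>
      eq_conj_of_val_eq hM (strict_comp_id hM _) (strict_comp_id hM _).symm _ _
        (M.comp_unique _ (hcomp_spec _ _) (comp_ide_two_zero hM η))
    whiskerRight_comp := fun η g h =>
      eq_conj_of_val_eq hM (strict_assoc hM _ _ _).symm (strict_assoc hM _ _ _) _ _
        (hM.assoc _ (hcomp_spec _ _) (hcomp_spec _ _) (hM.ide_interchange _ (comp_spec g h))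
          (hcomp_spec η (idTwo (g ≫ h)))).symm
    whisker_assoc := fun f _ _ η h =>
      eq_conj_of_val_eq hM (strict_assoc hM _ _ _) (strict_assoc hM _ _ _).symm _ _
        (hM.assoc _ (hcomp_spec _ _) (hcomp_spec _ _) (hcomp_spec _ _) (hcomp_spec _ _))
    whisker_exchange := fun η θ => (hcomp_eq' hM η θ).trans (hcomp_eq hM η θ).symm
    pentagon := fun f g h i => by
      dsimp only [eqToIso]
      erw [hcomp_idTwo_eqToHom hM, hcomp_eqToHom_idTwo hM]
      simp only [eqToHom_trans]
    triangle := fun f g => by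
      dsimp only [eqToIso]
      erw [hcomp_idTwo_eqToHom hM, hcomp_eqToHom_idTwo hM]
      simp only [eqToHom_trans] }

end Trunc

end Truncation

/-! ### Iterated identities on 2-cells -/

section IteratedIdentity

/-- The iterated identity on a 2-cell. -/
def OmegaGraph.ideIter (X : OmegaGraph.{u}) : ∀ n : ℕ, X.cell 2 → X.cell (n + 2)
  | 0, x => x
  | n + 1, x => X.ide (X.ideIter n x)

theorem OmegaGraph.ideIter_injective (X : OmegaGraph.{u}) (n : ℕ) :
    Function.Injective (X.ideIter n) := by
  induction n with
  | zero => exact fun _ _ h => h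
  | succ n ih =>
    intro x y h
    have := congrArg X.dom h
    simp only [ideIter, X.dom_ide] at this
    exact ih this

theorem OmegaGraph.domTo_ideIter (X : OmegaGraph.{u}) {i j : ℕ} (h : i + 2 ≤ j + 2)
    (x : X.cell 2) : X.domTo h (X.ideIter j x) = X.ideIter i x := by
  induction j with
  | zero =>
    obtain rfl : i = 0 := by omega
    exact X.domTo_self _
  | succ j ih =>
    rcases Nat.lt_or_ge i (j + 1) with h' | h'
    · rw [X.domTo_succ (by omega : i + 2 ≤ j + 2) h, ideIter, X.dom_ide, ih]
    · obtain rfl : i = j + 1 := by omega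
      exact X.domTo_self _

theorem OmegaGraph.ideTo_ideIter (X : OmegaGraph.{u}) {i j : ℕ} (h : i + 2 ≤ j + 2)
    (x : X.cell 2) : X.ideTo h (X.ideIter i x) = X.ideIter j x := by
  induction j with
  | zero =>
    obtain rfl : i = 0 := by omega
    exact X.ideTo_self _
  | succ j ih =>
    rcases Nat.lt_or_ge i (j + 1) with h' | h'
    · rw [X.ideTo_succ (by omega : i + 2 ≤ j + 2) h, ideIter, ih]
    · obtain rfl : i = j + 1 := by omega
      exact X.ideTo_self _

/-- The higher cells of a bicategory are iterated identities on 2-cells, and graph morphisms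
preserve identities. This is why a graph morphism out of a bicategory only sees the 2-truncation of
its target. -/
theorem graphHom_map_eq_ideIter {B : Bicat.{u}} {X : OmegaGraph.{u}} (F : bicatGraph.obj B ⟶ X)
    (n : ℕ) (x : TwoCell B.carrier) :
    F.map (n := n + 2) x = X.ideIter n (F.map (n := 2) x) := by
  induction n with
  | zero => rfl
  | succ n ih =>
    have := F.map_ide (n := n + 2) x
    rw [ih] at this
    exact this

end IteratedIdentity

/-! ### Strict omega categories and their 2-truncations: the universal property -/

section Inclusion

variable {M : OmegaMagma.{u}} (hM : M.IsStrict)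

/-- The 2-truncation of a strict omega category, as a bicategory. -/
noncomputable def truncBicat : Bicat.{u} := @Bicat.mk (Trunc M) (Trunc.bicategory hM)

theorem truncBicat_strict : Bicategory.Strict (truncBicat hM).carrier :=
  @Bicategory.Strict.mk _ (Trunc.bicategory hM) (Trunc.strict_id_comp hM) (Trunc.strict_comp_id hM)
    (Trunc.strict_assoc hM) (fun _ => rfl) (fun _ => rfl) (fun _ _ _ => rfl)

/-- The action on cells of the inclusion of the 2-truncation. -/
def truncCell : ∀ n : ℕ, bicatCell (truncBicat hM).carrier n → M.cell n
  | 0 => fun x => x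
  | 1 => fun x : OneCell (truncBicat hM).carrier => x.hom.1
  | n + 2 => fun x : TwoCell (truncBicat hM).carrier => M.ideIter n x.hom.1

theorem truncCell_comp {i j : ℕ} (h : i < j) {x y z : bicatCell (truncBicat hM).carrier j}
    (hc : BicatComp i j x y z) :
    M.Comp h (truncCell hM j x) (truncCell hM j y) (truncCell hM j z) := by
  cases hc with
  | one f g => exact Trunc.comp_spec f g
  | horizontal n η θ =>
    induction n with
    | zero =>
      -- In the magma of a bicategory a horizontal composite is written as a vertical composite of
      -- whiskerings; `hcomp_eq` identifies it with the horizontal composite of `M`.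
      have key : ∀ w, w = (Trunc.hcomp η θ).1 → M.Comp Nat.zero_lt_two η.1 θ.1 w := by
        rintro _ rfl
        exact Trunc.hcomp_spec η θ
      exact key _ (congrArg Subtype.val (Trunc.hcomp_eq hM η θ))
    | succ n ih => exact hM.ide_interchange _ (ih (by omega))
  | vertical n η θ =>
    induction n with
    | zero => exact Trunc.vcomp_spec η θ
    | succ n ih => exact hM.ide_interchange _ (ih (by omega))
  | identity i n h' =>
    have key : ∀ w : M.cell 2, M.Comp h (M.ideIter (n + 1) w) (M.ideIter (n + 1) w)
        (M.ideIter (n + 1) w) := fun w => by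
      -- An iterated identity is the iterated identity on its own iterated domain, so the left
      -- identity law says that it composes with itself to itself.
      have := hM.ide_comp h (M.ideIter (n + 1) w)
      rwa [M.domTo_ideIter, M.ideTo_ideIter] at this
    exact key _

/-- The inclusion of the 2-truncation of a strict omega category. -/
noncomputable def truncInclusion : bicatMagma.obj (truncBicat hM) ⟶ M where
  map {n} x := truncCell hM n x
  map_dom {n} x := match n, x with
    | 0, x => (OneCell.hom x).2.1.symm
    | 1, x => (TwoCell.hom x).2.1.symm
    | _ + 2, _ => (M.dom_ide _).symm
  map_cod {n} x := match n, x with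
    | 0, x => (OneCell.hom x).2.2.symm
    | 1, x => (TwoCell.hom x).2.2.symm
    | _ + 2, _ => (M.cod_ide _).symm
  map_ide {n} x := match n, x with
    | 0, _ => rfl
    | 1, _ => rfl
    | _ + 2, _ => rfl
  map_comp h _ _ _ hc := truncCell_comp hM h hc

theorem truncInclusion_injective (n : ℕ) :
    Function.Injective ((truncInclusion hM).map (n := n)) := by
  match n with
  | 0 => exact fun _ _ h => h
  | 1 =>
    rintro ⟨⟨f, rfl, rfl⟩⟩ ⟨⟨g, rfl, rfl⟩⟩ h
    change f = g at h
    cases h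
    rfl
  | n + 2 =>
    rintro ⟨⟨x, hx, hx'⟩⟩ ⟨⟨y, hy, hy'⟩⟩ h
    replace h : x = y := M.ideIter_injective n h
    rename_i a b f f' a' b' g g'
    obtain ⟨f, rfl, rfl⟩ := f
    obtain ⟨f', hf1, hf2⟩ := f'
    obtain ⟨g, rfl, rfl⟩ := g
    obtain ⟨g', hg1, hg2⟩ := g'
    dsimp only at hx hx' hy hy'
    subst h hx hx' hy hy'
    rfl

theorem truncInclusion_mono {B : Bicat.{u}}
    {F G : bicatGraph.obj B ⟶ bicatGraph.obj (truncBicat hM)}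
    (h : F ≫ magmaGraph.map (truncInclusion hM) = G ≫ magmaGraph.map (truncInclusion hM)) :
    F = G := by
  apply OmegaGraph.Hom.ext
  funext n x
  exact truncInclusion_injective hM n
    (congrArg (fun H : bicatGraph.obj B ⟶ M.toOmegaGraph => H.map x) h)

/-- Morphisms of omega graphs from a bicategory to a strict omega category factor through the
2-truncation. -/
theorem exists_graphHom_trunc {B : Bicat.{u}} (φ : bicatGraph.obj B ⟶ M.toOmegaGraph) :
    ∃ φ' : bicatGraph.obj B ⟶ bicatGraph.obj (truncBicat hM),
      φ' ≫ magmaGraph.map (truncInclusion hM) = φ := by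
  let c1 : OneCell B.carrier → OneCell (truncBicat hM).carrier := fun x =>
    @OneCell.mk (truncBicat hM).carrier _ (φ.map (n := 0) x.src) (φ.map (n := 0) x.tgt)
      ⟨φ.map (n := 1) x, (φ.map_dom (n := 0) x).symm, (φ.map_cod (n := 0) x).symm⟩
  let c2 : TwoCell B.carrier → TwoCell (truncBicat hM).carrier := fun x =>
    @TwoCell.mk (truncBicat hM).carrier _ _ _
      (c1 (OneCell.mk x.dom)).hom (c1 (OneCell.mk x.cod)).hom
      ⟨φ.map (n := 2) x, (φ.map_dom (n := 1) x).symm, (φ.map_cod (n := 1) x).symm⟩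
  let c : ∀ n : ℕ, bicatCell B.carrier n → bicatCell (truncBicat hM).carrier n := fun n =>
    match n with
    | 0 => fun x => φ.map (n := 0) x
    | 1 => c1
    | _ + 2 => c2
  have hc : ∀ (n : ℕ) (x : bicatCell B.carrier n), truncCell hM n (c n x) = φ.map x := fun n x =>
    match n, x with
    | 0, _ => rfl
    | 1, _ => rfl
    | n + 2, x => (graphHom_map_eq_ideIter φ n x).symm
  refine ⟨⟨fun {n} x => c n x, fun {n} x => ?_, fun {n} x => ?_, fun {n} x => ?_⟩, ?_⟩
  · match n, x with
    | 0, _ => rfl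
    | 1, _ => rfl
    | n + 2, _ => rfl
  · match n, x with
    | 0, _ => rfl
    | 1, _ => rfl
    | n + 2, _ => rfl
  · apply truncInclusion_injective hM
    have := (truncInclusion hM).map_ide (c n x)
    refine Eq.trans ?_ this.symm
    refine (hc (n + 1) _).trans ((φ.map_ide x).trans ?_)
    exact congrArg M.ide (hc n x).symm
  · exact OmegaGraph.Hom.ext (by funext n x; exact hc n x)

/-- Bundled, the associators and unitors of a strict 2-category are identity 2-cells, which every
magma morphism preserves. Hence between strict 2-categories every magma morphism is a strict
homomorphism. -/
theorem preservesCoherence_of_strict {B C : Bicat.{u}} (hB : Bicategory.Strict B.carrier)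
    (hC : Bicategory.Strict C.carrier) (F : bicatMagma.obj B ⟶ bicatMagma.obj C) :
    PreservesCoherence F where
  associator f g h _ _ _ _ f' g' h' hf hg hh := by
    rw [Bicategory.Strict.associator_eqToIso, Bicategory.Strict.associator_eqToIso,
      eqToIso.hom, eqToIso.hom, TwoCell.mk_eqToHom, TwoCell.mk_eqToHom]
    exact map_ide_one F (M := bicatMagma.obj B) (map_comp_one F (M := bicatMagma.obj B) (.one _ _)
      (map_comp_one F (M := bicatMagma.obj B) (.one _ _) hf hg) hh)
  leftUnitor f _ _ f' hf := by
    rw [Bicategory.Strict.leftUnitor_eqToIso, Bicategory.Strict.leftUnitor_eqToIso,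
      eqToIso.hom, eqToIso.hom, TwoCell.mk_eqToHom', TwoCell.mk_eqToHom']
    exact map_ide_one F (M := bicatMagma.obj B) hf
  rightUnitor f _ _ f' hf := by
    rw [Bicategory.Strict.rightUnitor_eqToIso, Bicategory.Strict.rightUnitor_eqToIso,
      eqToIso.hom, eqToIso.hom, TwoCell.mk_eqToHom', TwoCell.mk_eqToHom']
    exact map_ide_one F (M := bicatMagma.obj B) hf

/-- Morphisms of omega magmas from a strict 2-category to a strict omega category factor through
the 2-truncation. -/
theorem exists_bicatHom_trunc {B : Bicat.{u}} (hB : Bicategory.Strict B.carrier)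
    (ψ : bicatMagma.obj B ⟶ M) :
    ∃ G : B ⟶ truncBicat hM, bicatMagma.map G ≫ truncInclusion hM = ψ := by
  obtain ⟨φ, hφ⟩ := exists_graphHom_trunc hM (magmaGraph.map ψ)
  have hφ' : ∀ {n : ℕ} (x : (bicatMagma.obj B).cell n),
      (truncInclusion hM).map (φ.map x) = ψ.map x := fun x =>
    congrArg (fun H : bicatGraph.obj B ⟶ M.toOmegaGraph => H.map x) hφ
  let F : bicatMagma.obj B ⟶ bicatMagma.obj (truncBicat hM) :=
    { toHom := φ
      map_comp := fun {i j} h {x y z} hc => by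
        have hd : (bicatMagma.obj (truncBicat hM)).codTo h.le (φ.map x) =
            (bicatMagma.obj (truncBicat hM)).domTo h.le (φ.map y) :=
          (OmegaGraph.map_codTo φ h.le x).symm.trans
            ((congrArg φ.map ((bicatMagma.obj B).comp_composable h hc)).trans
              (OmegaGraph.map_domTo φ h.le y))
        -- The factorization `φ` is only a graph morphism. It preserves composites because the
        -- inclusion of the truncation is injective: the composite `w` of the images and the image
        -- of the composite agree in `M`.
        obtain ⟨w, hw⟩ := (bicatMagma.obj (truncBicat hM)).comp_exists h _ _ hd
        have h1 := (truncInclusion hM).map_comp h hw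
        rw [hφ', hφ'] at h1
        have h2 := M.comp_unique h h1 (ψ.map_comp h hc)
        rw [← hφ'] at h2
        rw [← truncInclusion_injective hM _ h2]
        exact hw }
  obtain ⟨G, hG⟩ := exists_bicatHom F (preservesCoherence_of_strict hB (truncBicat_strict hM) F)
  refine ⟨G, ?_⟩
  rw [hG]
  exact OmegaMagma.Hom.ext (by funext n x; exact hφ' x)

end Inclusion

/-- A free strict 2-category on the omega graph of a bicategory is a free strict omega category. -/
theorem freeStrict_existsUnique (Y : Bicat.{u}) (Q : FreeStrict Y) (T : StrictOmegaCat.{u})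
    (φ : bicatGraph.obj Y ⟶ strictOmegaGraph.obj T) :
    ∃! ψ : bicatMagma.obj Q.obj.obj ⟶ T.obj, Q.unit ≫ magmaGraph.map ψ = φ := by
  let τ : StrictTwoCat.{u} := ⟨truncBicat T.property, truncBicat_strict T.property⟩
  obtain ⟨φ', hφ'⟩ := exists_graphHom_trunc T.property φ
  refine ⟨bicatMagma.map (Q.desc (Z := τ) φ').hom ≫ truncInclusion T.property, ?_, ?_⟩
  · dsimp only
    rw [Functor.map_comp, ← Category.assoc]
    refine Eq.trans ?_ hφ'
    congr 1
    exact Q.unit_desc (Z := τ) φ'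
  · intro ψ hψ
    -- Any competitor also factors through the truncation, as a strict homomorphism, so uniqueness
    -- reduces to that of the free strict 2-category.
    obtain ⟨G, rfl⟩ := exists_bicatHom_trunc T.property Q.obj.property ψ
    congr 2
    have : (ObjectProperty.homMk G : Q.obj ⟶ τ) = Q.desc (Z := τ) φ' := by
      apply Q.hom_ext
      rw [Q.unit_desc (Z := τ)]
      apply truncInclusion_mono T.property
      rw [hφ', ← hψ, Functor.map_comp, Category.assoc]
      rfl
    exact congrArg (fun H => H.hom) this

/-! ### Graph morphisms between bicategories in typed form -/

section GenMap

variable (Y : Type u) [Bicategory.{u, u} Y]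

/-- A morphism between the omega graphs underlying two bicategories, in dependently typed form. -/
structure GenMap (Z : Type u) [Bicategory.{u, u} Z] where
  /-- the action on 0-cells -/
  obj : Y → Z
  /-- the action on 1-cells -/
  map : ∀ {a b : Y}, (a ⟶ b) → (obj a ⟶ obj b)
  /-- the action on 2-cells -/
  map₂ : ∀ {a b : Y} {f g : a ⟶ b}, (f ⟶ g) → (map f ⟶ map g)
  map_id : ∀ a : Y, map (𝟙 a) = 𝟙 (obj a)
  map₂_id : ∀ {a b : Y} (f : a ⟶ b), map₂ (𝟙 f) = 𝟙 (map f)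

variable {Y}

/-- The morphism of omega graphs given by a `GenMap`. -/
def GenMap.toGraphHom {B C : Bicat.{u}} (m : GenMap B.carrier C.carrier) :
    bicatGraph.obj B ⟶ bicatGraph.obj C where
  map {n} x := match n, x with
    | 0, x => m.obj x
    | 1, x => OneCell.mk (m.map (OneCell.hom x))
    | _ + 2, x => TwoCell.mk (m.map₂ (TwoCell.hom x))
  map_dom {n} x := match n, x with
    | 0, _ => rfl
    | 1, _ => rfl
    | _ + 2, _ => rfl
  map_cod {n} x := match n, x with
    | 0, _ => rfl
    | 1, _ => rfl
    | _ + 2, _ => rfl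
  map_ide {n} x := match n, x with
    | 0, x => congrArg OneCell.mk (m.map_id x)
    | 1, x => congrArg TwoCell.mk (m.map₂_id (OneCell.hom x))
    | _ + 2, _ => rfl

theorem exists_genMap {B C : Bicat.{u}} (φ : bicatGraph.obj B ⟶ bicatGraph.obj C) :
    ∃ m : GenMap B.carrier C.carrier, m.toGraphHom = φ := by
  let F0 : B.carrier → C.carrier := fun a => φ.map (n := 0) a
  have e1 : ∀ {a b : B.carrier} (f : a ⟶ b), ∃ f' : F0 a ⟶ F0 b,
      φ.map (n := 1) (OneCell.mk f) = OneCell.mk f' := fun f =>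
    OneCell.exists_rep _ (φ.map_dom (n := 0) (OneCell.mk f)).symm
      (φ.map_cod (n := 0) (OneCell.mk f)).symm
  choose F1 hF1 using @e1
  have e2 : ∀ {a b : B.carrier} {f g : a ⟶ b} (η : f ⟶ g), ∃ η' : F1 f ⟶ F1 g,
      φ.map (n := 2) (TwoCell.mk η) = TwoCell.mk η' := fun η =>
    TwoCell.exists_rep _ ((φ.map_dom (n := 1) (TwoCell.mk η)).symm.trans (hF1 _))
      ((φ.map_cod (n := 1) (TwoCell.mk η)).symm.trans (hF1 _))
  choose F2 hF2 using @e2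
  refine ⟨⟨F0, F1, F2, fun a => ?_, fun f => ?_⟩, ?_⟩
  · exact OneCell.mk_inj.1 ((hF1 _).symm.trans (φ.map_ide (n := 0) a))
  · exact TwoCell.mk_inj.1 ((hF2 _).symm.trans ((φ.map_ide (n := 1) (OneCell.mk f)).trans
      (congrArg (bicatGraph.obj C).ide (hF1 f))))
  · exact graphHom_ext (fun _ => rfl) (fun x => (hF1 x.hom).symm) (fun x => (hF2 x.hom).symm)

end GenMap

/-! ### The 1-cells of the free bicategory -/

section Words

/-- A 1-cell is an identity. -/
inductive IsIdHom {Y : Type u} [Bicategory.{u, u} Y] : ∀ {a b : Y}, (a ⟶ b) → Prop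
  | mk (a : Y) : IsIdHom (𝟙 a)

variable (Y : Type u) [Bicategory.{u, u} Y]

theorem IsIdHom.eq {Y : Type u} [Bicategory.{u, u} Y] {a b : Y} {f : a ⟶ b} (h : IsIdHom f) :
    a = b := by
  cases h; rfl

/-- The quiver of the 1-cells of a bicategory that are not identities. -/
def Gen : Type u := Y

instance : Quiver.{u} (Gen Y) where
  Hom a b := {f : @Quiver.Hom Y _ a b // ¬ IsIdHom f}

variable {Y} in
/-- The generator given by a 1-cell that is not an identity. -/
def Gen.mk {a b : Y} (f : a ⟶ b) (h : ¬ IsIdHom f) : @Quiver.Hom (Gen Y) _ a b := ⟨f, h⟩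

/-- The 1-cells of the free bicategory on the omega graph underlying a bicategory. -/
abbrev Word (a b : Gen Y) : Type u := FreeBicategory.Hom a b

/-- The objects of the free bicategory on the omega graph underlying a bicategory. -/
def FreeOn : Type u := Gen Y

instance : CategoryStruct.{u} (FreeOn Y) where
  Hom a b := Word Y a b
  id a := FreeBicategory.Hom.id (B := Gen Y) a
  comp {a b c} f g := @FreeBicategory.Hom.comp (Gen Y) _ a b c f g

variable {Y}

open Classical in
/-- The 1-cell of the free bicategory given by a 1-cell of the bicategory. -/
noncomputable def gen {a b : Y} (f : a ⟶ b) : Word Y a b :=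
  -- The insertion of generators must preserve identities, so an identity 1-cell of `Y` becomes the
  -- identity word and not a letter.
  if h : IsIdHom f then h.eq ▸ FreeBicategory.Hom.id (B := Gen Y) a
  else @FreeBicategory.Hom.of (Gen Y) _ a b (Gen.mk f h)

theorem gen_id (a : Y) : gen (𝟙 a) = FreeBicategory.Hom.id (B := Gen Y) a :=
  dif_pos (IsIdHom.mk a)

theorem gen_of {a b : Y} (f : a ⟶ b) (h : ¬ IsIdHom f) :
    gen f = @FreeBicategory.Hom.of (Gen Y) _ a b (Gen.mk f h) :=
  dif_neg h

/-- The formal coherence 2-cells between two words of 1-cells. -/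
def CohHom {a b : Gen Y} (f g : Word Y a b) : Type u :=
  (FreeBicategory.homCategory (B := Gen Y) a b).Hom f g

variable {Z : Type u} [Bicategory.{u, u} Z] (m : GenMap Y Z)

/-- The action of a `GenMap` on the generating 1-cells. -/
def GenMap.pre : Prefunctor (Gen Y) Z where
  obj := m.obj
  map f := m.map f.1

/-- The extension of a `GenMap` to words. -/
def GenMap.word {a b : Gen Y} (f : Word Y a b) : m.obj a ⟶ m.obj b :=
  FreeBicategory.liftHom m.pre f

theorem GenMap.word_gen {a b : Y} (f : a ⟶ b) : m.word (gen f) = m.map f := by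
  by_cases h : IsIdHom f
  · cases h
    rw [gen_id, m.map_id]
    rfl
  · rw [gen_of f h]
    rfl

end Words

/-! ### The 2-cells of the free bicategory: terms modulo semantic equality -/

section Terms

variable {Y : Type u} [Bicategory.{u, u} Y]

/-- Terms for the 2-cells of the free bicategory. -/
inductive CellTerm : ∀ {a b : Gen Y}, Word Y a b → Word Y a b → Type u
  | coh {a b : Gen Y} {f g : Word Y a b} (c : CohHom f g) : CellTerm f g
  | of {a b : Y} {f g : a ⟶ b} (η : f ⟶ g) : CellTerm (gen f) (gen g)
  | vcomp {a b : Gen Y} {f g h : Word Y a b} (s : CellTerm f g) (t : CellTerm g h) : CellTerm f h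
  | whiskerLeft {a b c : Gen Y} (f : Word Y a b) {g h : Word Y b c} (t : CellTerm g h) :
      CellTerm (f.comp g) (f.comp h)
  | whiskerRight {a b c : Gen Y} {f g : Word Y a b} (h : Word Y b c) (t : CellTerm f g) :
      CellTerm (f.comp h) (g.comp h)

/-- The interpretation of coherence 2-cells. -/
def GenMap.evalCoh {Z : Type u} [Bicategory.{u, u} Z] (m : GenMap Y Z) {a b : Gen Y}
    {f g : Word Y a b} (c : CohHom f g) : m.word f ⟶ m.word g :=
  (FreeBicategory.lift m.pre).map₂ c

/-- The interpretation of terms. -/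
noncomputable def GenMap.eval {Z : Type u} [Bicategory.{u, u} Z] (m : GenMap Y Z) :
    ∀ {a b : Gen Y} {f g : Word Y a b}, CellTerm f g → (m.word f ⟶ m.word g)
  | _, _, _, _, .coh c => m.evalCoh c
  | _, _, _, _, .of η => eqToHom (m.word_gen _) ≫ m.map₂ η ≫ eqToHom (m.word_gen _).symm
  | _, _, _, _, .vcomp s t => m.eval s ≫ m.eval t
  | _, _, _, _, .whiskerLeft f t => m.word f ◁ m.eval t
  | _, _, _, _, .whiskerRight h t => m.eval t ▷ m.word h

/-- Terms are equivalent if they have the same interpretation in all bicategories. -/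
instance cellTermSetoid {a b : Gen Y} (f g : Word Y a b) : Setoid (CellTerm f g) where
  -- Equality is semantic rather than generated by a list of relations: each bicategory axiom for
  -- the quotient follows at once from the same axiom in every `Z`, and evaluation descends to the
  -- quotient by definition.
  r s t := ∀ (Z : Bicat.{u}) (m : GenMap Y Z.carrier), m.eval s = m.eval t
  iseqv := ⟨fun _ _ _ => rfl, fun h Z m => (h Z m).symm, fun h k Z m => (h Z m).trans (k Z m)⟩

/-- The 2-cells of the free bicategory. -/
def FreeCell {a b : Gen Y} (f g : Word Y a b) : Type u := Quotient (cellTermSetoid f g)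

/-- The 2-cell of the free bicategory represented by a term. -/
def FreeCell.mk {a b : Gen Y} {f g : Word Y a b} (t : CellTerm f g) : FreeCell f g := ⟦t⟧

theorem FreeCell.exists_rep {a b : Gen Y} {f g : Word Y a b} (x : FreeCell f g) :
    ∃ t, x = FreeCell.mk t := by
  obtain ⟨t, rfl⟩ := Quotient.exists_rep x
  exact ⟨t, rfl⟩

theorem FreeCell.sound {a b : Gen Y} {f g : Word Y a b} {s t : CellTerm f g}
    (h : ∀ (Z : Bicat.{u}) (m : GenMap Y Z.carrier), m.eval s = m.eval t) :
    FreeCell.mk s = FreeCell.mk t := Quotient.sound h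

instance freeHomCategory (a b : FreeOn Y) : Category.{u} (a ⟶ b) where
  Hom f g := FreeCell f g
  id f := FreeCell.mk (.coh ((FreeBicategory.homCategory (B := Gen Y) a b).id f))
  comp := Quotient.map₂ CellTerm.vcomp fun _ _ h _ _ h' Z m => by
    simp only [GenMap.eval, h Z m, h' Z m]
  id_comp x := by
    obtain ⟨s, rfl⟩ := FreeCell.exists_rep x
    exact FreeCell.sound fun Z m => Category.id_comp _
  comp_id x := by
    obtain ⟨s, rfl⟩ := FreeCell.exists_rep x
    exact FreeCell.sound fun _ _ => Category.comp_id _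
  assoc x y z := by
    obtain ⟨s, rfl⟩ := FreeCell.exists_rep x
    obtain ⟨t, rfl⟩ := FreeCell.exists_rep y
    obtain ⟨r, rfl⟩ := FreeCell.exists_rep z
    exact FreeCell.sound fun Z m => Category.assoc _ _ _

/-- Coherence 2-cells of the free bicategory. -/
def cohMk {a b : FreeOn Y} {f g : a ⟶ b} (c : CohHom f g) : f ⟶ g := FreeCell.mk (.coh c)

theorem cohMk_comp {a b : FreeOn Y} {f g h : a ⟶ b} (c : CohHom f g) (d : CohHom g h) :
    cohMk c ≫ cohMk d = cohMk (Y := Y) ((FreeBicategory.homCategory (B := Gen Y) a b).comp c d) :=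
  FreeCell.sound fun _ m => ((FreeBicategory.lift m.pre).map₂_comp _ _).symm

/-- The isomorphism of the free bicategory given by an isomorphism of words. -/
def cohIso {a b : FreeOn Y} {f g : a ⟶ b}
    (e : @Iso (Word Y a b) (FreeBicategory.homCategory (B := Gen Y) a b) f g) : f ≅ g where
  hom := cohMk (@Iso.hom _ (FreeBicategory.homCategory (B := Gen Y) a b) f g e)
  inv := cohMk (@Iso.inv _ (FreeBicategory.homCategory (B := Gen Y) a b) f g e)
  hom_inv_id := (cohMk_comp _ _).trans (congrArg cohMk
    (@Iso.hom_inv_id _ (FreeBicategory.homCategory (B := Gen Y) a b) f g e))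
  inv_hom_id := (cohMk_comp _ _).trans (congrArg cohMk
    (@Iso.inv_hom_id _ (FreeBicategory.homCategory (B := Gen Y) a b) f g e))

instance freeBicategory : Bicategory.{u, u} (FreeOn Y) where
  homCategory := freeHomCategory
  whiskerLeft f _ _ x := Quotient.map (CellTerm.whiskerLeft f) (fun _ _ (h : ∀ _ _, _) Z m =>
    congrArg (fun y => m.word f ◁ y) (h Z m)) x
  whiskerRight η h := Quotient.map (CellTerm.whiskerRight h) (fun _ _ (k : ∀ _ _, _) Z m =>
    congrArg (fun y => y ▷ m.word h) (k Z m)) η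
  associator {a b c d} f g h :=
    cohIso (Bicategory.associator (B := FreeBicategory (Gen Y)) (a := a) (b := b) (c := c)
      (d := d) f g h)
  leftUnitor {a b} f :=
    cohIso (Bicategory.leftUnitor (B := FreeBicategory (Gen Y)) (a := a) (b := b) f)
  rightUnitor {a b} f :=
    cohIso (Bicategory.rightUnitor (B := FreeBicategory (Gen Y)) (a := a) (b := b) f)
  whiskerLeft_id f g := FreeCell.sound fun Z m => Bicategory.whiskerLeft_id _ _
  whiskerLeft_comp f _ _ _ x y := by
    obtain ⟨s, rfl⟩ := FreeCell.exists_rep x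
    obtain ⟨t, rfl⟩ := FreeCell.exists_rep y
    exact FreeCell.sound fun Z m => Bicategory.whiskerLeft_comp _ _ _
  id_whiskerLeft x := by
    obtain ⟨s, rfl⟩ := FreeCell.exists_rep x
    exact FreeCell.sound fun Z m => Bicategory.id_whiskerLeft _
  comp_whiskerLeft _ _ _ _ x := by
    obtain ⟨s, rfl⟩ := FreeCell.exists_rep x
    exact FreeCell.sound fun Z m => Bicategory.comp_whiskerLeft _ _ _
  id_whiskerRight f g := FreeCell.sound fun Z m => Bicategory.id_whiskerRight _ _
  comp_whiskerRight x y _ := by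
    obtain ⟨s, rfl⟩ := FreeCell.exists_rep x
    obtain ⟨t, rfl⟩ := FreeCell.exists_rep y
    exact FreeCell.sound fun Z m => Bicategory.comp_whiskerRight _ _ _
  whiskerRight_id x := by
    obtain ⟨s, rfl⟩ := FreeCell.exists_rep x
    exact FreeCell.sound fun Z m => Bicategory.whiskerRight_id _
  whiskerRight_comp x _ _ := by
    obtain ⟨s, rfl⟩ := FreeCell.exists_rep x
    exact FreeCell.sound fun Z m => Bicategory.whiskerRight_comp _ _ _
  whisker_assoc _ _ _ x _ := by
    obtain ⟨s, rfl⟩ := FreeCell.exists_rep x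
    exact FreeCell.sound fun Z m => Bicategory.whisker_assoc _ _ _
  whisker_exchange x y := by
    obtain ⟨s, rfl⟩ := FreeCell.exists_rep x
    obtain ⟨t, rfl⟩ := FreeCell.exists_rep y
    exact FreeCell.sound fun Z m => Bicategory.whisker_exchange _ _
  pentagon f g h i := FreeCell.sound fun Z m => Bicategory.pentagon _ _ _ _
  triangle f g := FreeCell.sound fun Z m => Bicategory.triangle _ _

end Terms

/-! ### Extension of graph morphisms to the free bicategory -/

section Universal

theorem eq_eqToHom_conj {C : Type*} [Category C] {X Y : C} (f : X ⟶ Y) (h : X = X) (h' : Y = Y) :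
    f = eqToHom h ≫ f ≫ eqToHom h' := by simp

theorem eq_eqToHom_comp {C : Type*} [Category C] {X Y : C} (f : X ⟶ Y) (h : X = X) :
    f = eqToHom h ≫ f := by simp

variable {Y : Type u} [Bicategory.{u, u} Y]

/-- The generating 2-cells. -/
noncomputable def genTwo {a b : Y} {f g : a ⟶ b} (η : f ⟶ g) : FreeCell (gen f) (gen g) :=
  FreeCell.mk (.of η)

/-- Every `GenMap` preserves identity 2-cells, so the semantic quotient already identifies the
generator `𝟙 f` with the identity; no relation has to be imposed. -/
theorem genTwo_id {a b : Y} (f : a ⟶ b) :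
    genTwo (𝟙 f) = (freeHomCategory (Y := Y) a b).id (gen f) :=
  FreeCell.sound fun Z m => by
    change eqToHom _ ≫ m.map₂ (𝟙 f) ≫ eqToHom _ = 𝟙 _
    rw [m.map₂_id, Category.id_comp, eqToHom_trans, eqToHom_refl]

/-- The insertion of generators into the free bicategory. -/
noncomputable def genMapUnit : GenMap Y (FreeOn Y) where
  obj a := a
  map f := gen f
  map₂ η := genTwo η
  map_id a := gen_id a
  map₂_id f := genTwo_id f

/-- The strict homomorphism extending a `GenMap`. -/
noncomputable def GenMap.extend {Z : Bicat.{u}} (m : GenMap Y Z.carrier) :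
    StrictPseudofunctor (FreeOn Y) Z.carrier :=
  StrictPseudofunctor.mk'
  { obj := m.obj
    map := fun f => m.word f
    map₂ := Quotient.lift m.eval fun _ _ h => h Z m
    map₂_id := fun _ => rfl
    map₂_comp := fun x y => by
      obtain ⟨s, rfl⟩ := FreeCell.exists_rep x
      obtain ⟨t, rfl⟩ := FreeCell.exists_rep y
      rfl
    map_id := fun _ => rfl
    map_comp := fun _ _ => rfl
    map₂_whisker_left := fun f _ _ x => by
      obtain ⟨s, rfl⟩ := FreeCell.exists_rep x
      exact eq_eqToHom_conj _ _ _
    map₂_whisker_right := fun x h => by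
      obtain ⟨s, rfl⟩ := FreeCell.exists_rep x
      exact eq_eqToHom_conj _ _ _
    map₂_left_unitor := fun f => by
      exact eq_eqToHom_comp _ _
    map₂_right_unitor := fun f => by
      exact eq_eqToHom_comp _ _
    map₂_associator := fun f g h => by
      exact eq_eqToHom_conj _ _ _ }

end Universal

/-- The free bicategory on the omega graph underlying `Y`. -/
noncomputable def freeBicat (Y : Bicat.{u}) : Bicat.{u} := ⟨FreeOn Y.carrier⟩

/-- The insertion of generators into the free bicategory. -/
noncomputable def freeBicatUnit (Y : Bicat.{u}) : bicatGraph.obj Y ⟶ bicatGraph.obj (freeBicat Y) :=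
  GenMap.toGraphHom (C := freeBicat Y) (genMapUnit (Y := Y.carrier))

theorem freeBicat_exists (Y Z : Bicat.{u}) (φ : bicatGraph.obj Y ⟶ bicatGraph.obj Z) :
    ∃ F : freeBicat Y ⟶ Z, freeBicatUnit Y ≫ bicatGraph.map F = φ := by
  obtain ⟨m, rfl⟩ := exists_genMap φ
  refine ⟨(m.extend : StrictPseudofunctor (FreeOn Y.carrier) Z.carrier), ?_⟩
  refine graphHom_ext (fun _ => rfl) (fun x => ?_) (fun x => ?_)
  · exact congrArg OneCell.mk (m.word_gen x.hom)
  · refine twoCell_mk_eq (m.word_gen _) (m.word_gen _) _ _ ?_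
    rfl

/-! ### Coherence isomorphisms under strict homomorphisms -/

section Coherence

variable {B C : Type u} [Bicategory.{u, u} B] [Bicategory.{u, u} C]

theorem mk_map₂_associator_inv (F : StrictPseudofunctor B C) {a b c d : B} (f : a ⟶ b) (g : b ⟶ c)
    (h : c ⟶ d) :
    TwoCell.mk (F.map₂ (α_ f g h).inv) = TwoCell.mk (α_ (F.map f) (F.map g) (F.map h)).inv :=
  TwoCell.mk_inv_eq (F.map₂Iso (α_ f g h)) (α_ (F.map f) (F.map g) (F.map h))
    (mk_map₂_associator F f g h)

theorem mk_map₂_leftUnitor_inv (F : StrictPseudofunctor B C) {a b : B} (f : a ⟶ b) :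
    TwoCell.mk (F.map₂ (λ_ f).inv) = TwoCell.mk (λ_ (F.map f)).inv :=
  TwoCell.mk_inv_eq (F.map₂Iso (λ_ f)) (λ_ (F.map f)) (mk_map₂_leftUnitor F f)

theorem mk_map₂_rightUnitor_inv (F : StrictPseudofunctor B C) {a b : B} (f : a ⟶ b) :
    TwoCell.mk (F.map₂ (ρ_ f).inv) = TwoCell.mk (ρ_ (F.map f)).inv :=
  TwoCell.mk_inv_eq (F.map₂Iso (ρ_ f)) (ρ_ (F.map f)) (mk_map₂_rightUnitor F f)

theorem isCoherence_eqToHom {a b : B} {f g : a ⟶ b} (h : f = g) : IsCoherence (eqToHom h) := by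
  subst h
  exact .id _

/-- Structural 2-cells go to structural 2-cells up to conjugation by `eqToHom`, and the latter are
coherence 2-cells, being identities after substitution. -/
theorem IsCoherence.map₂ (F : StrictPseudofunctor B C) {a b : B} {f g : a ⟶ b} {η : f ⟶ g}
    (h : IsCoherence η) : IsCoherence (F.map₂ η) := by
  induction h with
  | id f =>
    rw [F.map₂_id]
    exact .id _
  | comp _ _ ih1 ih2 =>
    rw [F.map₂_comp]
    exact .comp ih1 ih2
  | whiskerLeft f _ ih =>
    rw [map₂_whiskerLeft_eqToHom]
    exact .comp (isCoherence_eqToHom _) (.comp (.whiskerLeft _ ih) (isCoherence_eqToHom _))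
  | whiskerRight f _ ih =>
    rw [map₂_whiskerRight_eqToHom]
    exact .comp (isCoherence_eqToHom _) (.comp (.whiskerRight _ ih) (isCoherence_eqToHom _))
  | associator_hom f g h =>
    rw [(TwoCell.mk_eq_iff (by simp [F.map_comp]) (by simp [F.map_comp]) _ _).1
      (mk_map₂_associator F f g h)]
    exact .comp (isCoherence_eqToHom _) (.comp (.associator_hom _ _ _) (isCoherence_eqToHom _))
  | associator_inv f g h =>
    rw [(TwoCell.mk_eq_iff (by simp [F.map_comp]) (by simp [F.map_comp]) _ _).1
      (mk_map₂_associator_inv F f g h)]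
    exact .comp (isCoherence_eqToHom _) (.comp (.associator_inv _ _ _) (isCoherence_eqToHom _))
  | leftUnitor_hom f =>
    rw [(TwoCell.mk_eq_iff (by simp [F.map_comp, F.map_id]) rfl _ _).1
      (mk_map₂_leftUnitor F f)]
    exact .comp (isCoherence_eqToHom _) (.comp (.leftUnitor_hom _) (isCoherence_eqToHom _))
  | leftUnitor_inv f =>
    rw [(TwoCell.mk_eq_iff rfl (by simp [F.map_comp, F.map_id]) _ _).1
      (mk_map₂_leftUnitor_inv F f)]
    exact .comp (isCoherence_eqToHom _) (.comp (.leftUnitor_inv _) (isCoherence_eqToHom _))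
  | rightUnitor_hom f =>
    rw [(TwoCell.mk_eq_iff (by simp [F.map_comp, F.map_id]) rfl _ _).1
      (mk_map₂_rightUnitor F f)]
    exact .comp (isCoherence_eqToHom _) (.comp (.rightUnitor_hom _) (isCoherence_eqToHom _))
  | rightUnitor_inv f =>
    rw [(TwoCell.mk_eq_iff rfl (by simp [F.map_comp, F.map_id]) _ _).1
      (mk_map₂_rightUnitor_inv F f)]
    exact .comp (isCoherence_eqToHom _) (.comp (.rightUnitor_inv _) (isCoherence_eqToHom _))

/-- In a strict 2-category, coherence isomorphisms are identities. -/
theorem IsCoherence.eq_eqToHom [Bicategory.Strict B] {a b : B} {f g : a ⟶ b} {η : f ⟶ g}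
    (h : IsCoherence η) : ∃ e : f = g, η = eqToHom e := by
  induction h with
  | id f => exact ⟨rfl, rfl⟩
  | comp _ _ ih1 ih2 =>
    obtain ⟨rfl, rfl⟩ := ih1
    obtain ⟨rfl, rfl⟩ := ih2
    exact ⟨rfl, by simp⟩
  | whiskerLeft f _ ih =>
    obtain ⟨rfl, rfl⟩ := ih
    exact ⟨rfl, by simp⟩
  | whiskerRight f _ ih =>
    obtain ⟨rfl, rfl⟩ := ih
    exact ⟨rfl, by simp⟩
  | associator_hom f g h => exact ⟨Bicategory.Strict.assoc _ _ _,
      congrArg Iso.hom (Bicategory.Strict.associator_eqToIso _ _ _)⟩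
  | associator_inv f g h => exact ⟨(Bicategory.Strict.assoc _ _ _).symm,
      congrArg Iso.inv (Bicategory.Strict.associator_eqToIso _ _ _)⟩
  | leftUnitor_hom f => exact ⟨Bicategory.Strict.id_comp _,
      congrArg Iso.hom (Bicategory.Strict.leftUnitor_eqToIso _)⟩
  | leftUnitor_inv f => exact ⟨(Bicategory.Strict.id_comp _).symm,
      congrArg Iso.inv (Bicategory.Strict.leftUnitor_eqToIso _)⟩
  | rightUnitor_hom f => exact ⟨Bicategory.Strict.comp_id _,
      congrArg Iso.hom (Bicategory.Strict.rightUnitor_eqToIso _)⟩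
  | rightUnitor_inv f => exact ⟨(Bicategory.Strict.comp_id _).symm,
      congrArg Iso.inv (Bicategory.Strict.rightUnitor_eqToIso _)⟩

/-- Composites are unique in `N`. This is the inductive step whenever two morphisms are compared on
generated cells. -/
theorem map_eq_of_comp {M N : OmegaMagma.{u}} {F G : M ⟶ N} {i j : ℕ} {h : i < j}
    {x y z : M.cell j} (hc : M.Comp h x y z) (hx : F.map x = G.map x) (hy : F.map y = G.map y) :
    F.map z = G.map z := by
  have h1 := F.map_comp h hc
  rw [hx, hy] at h1
  exact N.comp_unique h h1 (G.map_comp h hc)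

theorem map_comp_two_eq {B : Bicat.{u}} {N : OmegaMagma.{u}} {F G : bicatMagma.obj B ⟶ N}
    {a b : B.carrier} {f g h : a ⟶ b} (η : f ⟶ g) (θ : g ⟶ h)
    (h1 : F.map (n := 2) (TwoCell.mk η) = G.map (n := 2) (TwoCell.mk η))
    (h2 : F.map (n := 2) (TwoCell.mk θ) = G.map (n := 2) (TwoCell.mk θ)) :
    F.map (n := 2) (TwoCell.mk (η ≫ θ)) = G.map (n := 2) (TwoCell.mk (η ≫ θ)) :=
  map_eq_of_comp (M := bicatMagma.obj B) (h := Nat.one_lt_two) (.vertical 0 η θ) h1 h2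

theorem map_id_two_eq {B : Bicat.{u}} {N : OmegaMagma.{u}} {F G : bicatMagma.obj B ⟶ N}
    {a b : B.carrier} (f : a ⟶ b)
    (h : F.map (n := 1) (OneCell.mk f) = G.map (n := 1) (OneCell.mk f)) :
    F.map (n := 2) (TwoCell.mk (𝟙 f)) = G.map (n := 2) (TwoCell.mk (𝟙 f)) :=
  (F.map_ide (n := 1) (OneCell.mk f)).trans ((congrArg N.ide h).trans
    (G.map_ide (n := 1) (OneCell.mk f)).symm)

theorem map_whiskerLeft_eq {B : Bicat.{u}} {N : OmegaMagma.{u}} {F G : bicatMagma.obj B ⟶ N}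
    {a b c : B.carrier} (f : a ⟶ b) {g h : b ⟶ c} (η : g ⟶ h)
    (h1 : F.map (n := 1) (OneCell.mk f) = G.map (n := 1) (OneCell.mk f))
    (h2 : F.map (n := 2) (TwoCell.mk η) = G.map (n := 2) (TwoCell.mk η)) :
    F.map (n := 2) (TwoCell.mk (f ◁ η)) = G.map (n := 2) (TwoCell.mk (f ◁ η)) := by
  have := map_eq_of_comp (M := bicatMagma.obj B) (h := Nat.zero_lt_two) (.horizontal 0 (𝟙 f) η)
    (map_id_two_eq f h1) h2
  simpa using this

theorem map_whiskerRight_eq {B : Bicat.{u}} {N : OmegaMagma.{u}} {F G : bicatMagma.obj B ⟶ N}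
    {a b c : B.carrier} {f g : a ⟶ b} (η : f ⟶ g) (h : b ⟶ c)
    (h1 : F.map (n := 1) (OneCell.mk h) = G.map (n := 1) (OneCell.mk h))
    (h2 : F.map (n := 2) (TwoCell.mk η) = G.map (n := 2) (TwoCell.mk η)) :
    F.map (n := 2) (TwoCell.mk (η ▷ h)) = G.map (n := 2) (TwoCell.mk (η ▷ h)) := by
  have := map_eq_of_comp (M := bicatMagma.obj B) (h := Nat.zero_lt_two) (.horizontal 0 η (𝟙 h))
    h2 (map_id_two_eq h h1)
  simpa using this

/-- Strict homomorphisms that agree on 1-cells agree on coherence isomorphisms. -/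
theorem IsCoherence.map_eq {B C : Bicat.{u}} {F G : B ⟶ C}
    (h1 : ∀ {a b : B.carrier} (f : a ⟶ b), (bicatMagma.map F).map (n := 1) (OneCell.mk f) =
      (bicatMagma.map G).map (n := 1) (OneCell.mk f)) {a b : B.carrier} {f g : a ⟶ b} {η : f ⟶ g}
    (h : IsCoherence η) : (bicatMagma.map F).map (n := 2) (TwoCell.mk η) =
      (bicatMagma.map G).map (n := 2) (TwoCell.mk η) := by
  obtain ⟨F, rfl⟩ : ∃ F' : StrictPseudofunctor B.carrier C.carrier, F = F' := ⟨F, rfl⟩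
  obtain ⟨G, rfl⟩ : ∃ G' : StrictPseudofunctor B.carrier C.carrier, G = G' := ⟨G, rfl⟩
  induction h with
  | id f => exact map_id_two_eq f (h1 f)
  | comp _ _ ih1 ih2 => exact map_comp_two_eq _ _ ih1 ih2
  | whiskerLeft f _ ih => exact map_whiskerLeft_eq f _ (h1 f) ih
  | whiskerRight f _ ih => exact map_whiskerRight_eq _ f (h1 f) ih
  | associator_hom f g h =>
    exact ((mk_map₂_associator F f g h).trans (TwoCell.mk_associator_congr (h1 f) (h1 g)
      (h1 h)).1).trans (mk_map₂_associator G f g h).symm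
  | associator_inv f g h =>
    exact ((mk_map₂_associator_inv F f g h).trans (TwoCell.mk_associator_congr (h1 f) (h1 g)
      (h1 h)).2).trans (mk_map₂_associator_inv G f g h).symm
  | leftUnitor_hom f =>
    exact ((mk_map₂_leftUnitor F f).trans (TwoCell.mk_unitor_congr (h1 f)).1.1).trans
      (mk_map₂_leftUnitor G f).symm
  | leftUnitor_inv f =>
    exact ((mk_map₂_leftUnitor_inv F f).trans (TwoCell.mk_unitor_congr (h1 f)).1.2).trans
      (mk_map₂_leftUnitor_inv G f).symm
  | rightUnitor_hom f =>
    exact ((mk_map₂_rightUnitor F f).trans (TwoCell.mk_unitor_congr (h1 f)).2.1).trans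
      (mk_map₂_rightUnitor G f).symm
  | rightUnitor_inv f =>
    exact ((mk_map₂_rightUnitor_inv F f).trans (TwoCell.mk_unitor_congr (h1 f)).2.2).trans
      (mk_map₂_rightUnitor_inv G f).symm

end Coherence

/-! ### Formal coherence cells and uniqueness of extensions -/

section FreeCoherence

variable {Y : Type u} [Bicategory.{u, u} Y]

/-- Induction on a formal expression representing `c`: its constructors match those of
`IsCoherence`. -/
theorem isCoherence_cohMk {a b : FreeOn Y} {f g : a ⟶ b} (c : CohHom f g) :
    IsCoherence (cohMk c) := by
  obtain ⟨t, rfl⟩ := Quot.exists_rep c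
  induction t with
  | id f => exact .id _
  | @vcomp a b f g h η θ ih1 ih2 =>
    have e := cohMk_comp (Y := Y) (a := a) (b := b) (f := f) (g := g) (h := h) (Quot.mk _ η)
      (Quot.mk _ θ)
    exact e ▸ .comp ih1 ih2
  | @whisker_left a b c f g h η ih =>
    have e : (show @Quiver.Hom (FreeOn Y) _ a b from f) ◁ cohMk (Y := Y) (a := b) (b := c) (f := g)
      (g := h) (Quot.mk _ η) = cohMk (Quot.mk _ (.whisker_left f η)) :=
        FreeCell.sound fun Z m => rfl
    exact e ▸ .whiskerLeft _ ih
  | @whisker_right a b c f g h η ih =>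
    have e : cohMk (Y := Y) (a := a) (b := b) (f := f)
      (g := g) (Quot.mk _ η) ▷ (show @Quiver.Hom (FreeOn Y) _ b c from h) =
        cohMk (Quot.mk _ (.whisker_right h η)) :=
        FreeCell.sound fun Z m => rfl
    exact e ▸ .whiskerRight _ ih
  | @associator a b c d f g h =>
    exact IsCoherence.associator_hom (B := FreeOn Y) (a := a) (b := b) (c := c) (d := d) f g h
  | @associator_inv a b c d f g h =>
    exact IsCoherence.associator_inv (B := FreeOn Y) (a := a) (b := b) (c := c) (d := d) f g h
  | @right_unitor a b f => exact IsCoherence.rightUnitor_hom (B := FreeOn Y) (a := a) (b := b) f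
  | @right_unitor_inv a b f => exact IsCoherence.rightUnitor_inv (B := FreeOn Y) (a := a) (b := b) f
  | @left_unitor a b f => exact IsCoherence.leftUnitor_hom (B := FreeOn Y) (a := a) (b := b) f
  | @left_unitor_inv a b f => exact IsCoherence.leftUnitor_inv (B := FreeOn Y) (a := a) (b := b) f

end FreeCoherence

/-- Agreement on generators spreads to words by induction, then to terms. Structural 2-cells need no
generators: their images are determined by those of 1-cells. -/
theorem freeBicat_hom_ext {Y Z : Bicat.{u}} {F G : freeBicat Y ⟶ Z}
    (h : freeBicatUnit Y ≫ bicatGraph.map F = freeBicatUnit Y ≫ bicatGraph.map G) : F = G := by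
  have e : ∀ {n : ℕ} (x : (bicatGraph.obj Y).cell n),
      (bicatMagma.map F).map ((freeBicatUnit Y).map x) =
        (bicatMagma.map G).map ((freeBicatUnit Y).map x) := fun x =>
    congrArg (fun H : bicatGraph.obj Y ⟶ bicatGraph.obj Z => H.map x) h
  have h0 : ∀ a : FreeOn Y.carrier, (bicatMagma.map F).map (n := 0) a =
      (bicatMagma.map G).map (n := 0) a := fun a => e (n := 0) a
  have h1 : ∀ {a b : (freeBicat Y).carrier} (f : a ⟶ b),
      (bicatMagma.map F).map (n := 1) (OneCell.mk f) =
      (bicatMagma.map G).map (n := 1) (OneCell.mk f) := fun {a b} f => by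
    change Word Y.carrier a b at f
    induction f with
    | @of a b f =>
      -- A letter is a non-identity 1-cell, so its insertion is the one-letter word and the
      -- hypothesis on generators applies.
      have := e (n := 1) (OneCell.mk f.1)
      have hg : (freeBicatUnit Y).map (n := 1) (OneCell.mk f.1) =
        @OneCell.mk (FreeOn Y.carrier) _ a b (FreeBicategory.Hom.of (B := Gen Y.carrier) f) :=
      congrArg OneCell.mk (gen_of f.1 f.2)
      rwa [hg] at this
    | id a =>
      exact (OmegaGraph.Hom.map_ide (bicatMagma.map F).toHom (n := 0) a).trans
        ((congrArg _ (h0 a)).trans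
          (OmegaGraph.Hom.map_ide (bicatMagma.map G).toHom (n := 0) a).symm)
    | @comp a b c f g ihf ihg =>
      exact map_eq_of_comp (M := bicatMagma.obj (freeBicat Y)) (h := Nat.zero_lt_one)
        (@BicatComp.one (FreeOn Y.carrier) _ a b c f g) ihf ihg
  have h2 : ∀ {a b : Gen Y.carrier} {f g : Word Y.carrier a b} (t : CellTerm f g),
      (bicatMagma.map F).map (n := 2) (@TwoCell.mk (FreeOn Y.carrier) _ a b f g (FreeCell.mk t)) =
      (bicatMagma.map G).map (n := 2) (@TwoCell.mk (FreeOn Y.carrier) _ a b f g (FreeCell.mk t)) :=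
      fun {a b f g} t => by
    induction t with
    | coh c => exact IsCoherence.map_eq h1 (isCoherence_cohMk c)
    | of η => exact e (n := 2) (TwoCell.mk η)
    | @vcomp a b f g h s t ihs iht =>
      exact map_comp_two_eq (B := freeBicat Y) (a := a) (b := b) _ _ ihs iht
    | @whiskerLeft a b c f g h t ih =>
      exact map_whiskerLeft_eq (B := freeBicat Y) (a := a) (b := b) (c := c) f _ (h1 _) ih
    | @whiskerRight a b c f g h t ih =>
      exact map_whiskerRight_eq (B := freeBicat Y) (a := a) (b := b) (c := c) _ h (h1 _) ih
  apply bicatHom_ext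
  refine magmaHom_ext h0 (fun x => h1 x.hom) (fun x => ?_)
  obtain ⟨η⟩ := x
  obtain ⟨t, rfl⟩ := FreeCell.exists_rep η
  exact h2 t

/-- The free bicategory on the omega graph underlying a bicategory. -/
noncomputable def freeBicatObject (Y : Bicat.{u}) : FreeBicat Y where
  obj := freeBicat Y
  unit := freeBicatUnit Y
  existsUnique Z φ := by
    obtain ⟨F, hF⟩ := freeBicat_exists Y Z φ
    exact ⟨F, hF, fun G hG => freeBicat_hom_ext (hG.trans hF.symm)⟩

/-! ### Normal forms of words and the coherence theorem -/

section Normalization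

variable {Y : Type u} [Bicategory.{u, u} Y]

/-- The paths of generating 1-cells. -/
def GenPath (a b : FreeOn Y) : Type u := @Quiver.Path (Gen Y) (instQuiverGen Y) a b

/-- The empty path. -/
def GenPath.nil {a : FreeOn Y} : GenPath a a := @Quiver.Path.nil (Gen Y) _ a

/-- Composition of paths. -/
def GenPath.comp {a b c : FreeOn Y} (p : GenPath a b) (q : GenPath b c) : GenPath a c :=
  @Quiver.Path.comp (Gen Y) _ a b c p q

theorem GenPath.comp_assoc {a b c d : FreeOn Y} (p : GenPath a b) (q : GenPath b c)
    (r : GenPath c d) : (p.comp q).comp r = p.comp (q.comp r) :=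
  @Quiver.Path.comp_assoc (Gen Y) _ a b c d p q r

theorem GenPath.nil_comp {a b : FreeOn Y} (p : GenPath a b) : GenPath.nil.comp p = p :=
  @Quiver.Path.nil_comp (Gen Y) _ a b p

theorem GenPath.comp_nil {a b : FreeOn Y} (p : GenPath a b) : p.comp GenPath.nil = p :=
  @Quiver.Path.comp_nil (Gen Y) _ a b p

/-- The normal form of a word. -/
def norm {a b : FreeOn Y} (f : a ⟶ b) : GenPath a b :=
  FreeBicategory.normalizeAux (B := Gen Y) (b := a) Quiver.Path.nil f

/-- The word given by a path. -/
def incl {a b : FreeOn Y} (p : GenPath a b) : a ⟶ b :=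
  FreeBicategory.inclusionPathAux (B := Gen Y) p

theorem norm_comp {a b c : FreeOn Y} (f : a ⟶ b) (g : b ⟶ c) :
    norm (f ≫ g) = (norm f).comp (norm g) :=
  FreeBicategory.normalizeAux_nil_comp (B := Gen Y) f g

theorem norm_id (a : FreeOn Y) : norm (𝟙 a) = GenPath.nil := rfl

theorem norm_incl {a b : FreeOn Y} (p : GenPath a b) : norm (incl p) = p := by
  induction p with
  | nil => rfl
  | @cons b c p f ih => exact congrArg (fun q => @Quiver.Path.cons (Gen Y) _ a b c q f) ih

/-- Converse of `isCoherence_cohMk`. It brings every coherence 2-cell of `FreeOn Y` back to the free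
bicategory on the quiver of letters, which is locally thin. -/
theorem IsCoherence.exists_cohMk {a b : FreeOn Y} {f g : a ⟶ b} {η : f ⟶ g}
    (h : IsCoherence η) : ∃ c, η = cohMk c := by
  induction h with
  | id f => exact ⟨_, rfl⟩
  | comp _ _ ih1 ih2 =>
    obtain ⟨c, rfl⟩ := ih1
    obtain ⟨d, rfl⟩ := ih2
    exact ⟨_, cohMk_comp c d⟩
  | @whiskerLeft a b c f g h η _ ih =>
    obtain ⟨c, rfl⟩ := ih
    obtain ⟨t, rfl⟩ := Quot.exists_rep c
    exact ⟨Quot.mk _ (.whisker_left f t), FreeCell.sound fun Z m => rfl⟩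
  | whiskerRight h _ ih =>
    obtain ⟨c, rfl⟩ := ih
    obtain ⟨t, rfl⟩ := Quot.exists_rep c
    exact ⟨Quot.mk _ (.whisker_right h t), FreeCell.sound fun Z m => rfl⟩
  | associator_hom f g h => exact ⟨_, rfl⟩
  | associator_inv f g h => exact ⟨_, rfl⟩
  | leftUnitor_hom f => exact ⟨_, rfl⟩
  | leftUnitor_inv f => exact ⟨_, rfl⟩
  | rightUnitor_hom f => exact ⟨_, rfl⟩
  | rightUnitor_inv f => exact ⟨_, rfl⟩

/-- The coherence theorem: parallel coherence isomorphisms of the free bicategory are equal. -/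
theorem IsCoherence.unique {a b : FreeOn Y} {f g : a ⟶ b} {η θ : f ⟶ g}
    (h : IsCoherence η) (h' : IsCoherence θ) : η = θ := by
  obtain ⟨c, rfl⟩ := h.exists_cohMk
  obtain ⟨d, rfl⟩ := h'.exists_cohMk
  have : Subsingleton (CohHom f g) :=
    FreeBicategory.locally_thin (B := Gen Y) (a := a) (b := b) f g
  exact congrArg cohMk (Subsingleton.elim (α := CohHom f g) c d)

/-- The isomorphism between a word and its normal form. -/
theorem exists_normalizeIso {a b : FreeBicategory (Gen Y)} (f : a ⟶ b) :
    Nonempty (@Iso (@Quiver.Hom (FreeBicategory (Gen Y)) _ a b) _ f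
      (FreeBicategory.inclusionPathAux (B := Gen Y)
        (FreeBicategory.normalizeAux (B := Gen Y) (b := a) Quiver.Path.nil f))) :=
  -- Normalization acts on a word with a path as prefix; the empty prefix contributes an identity
  -- factor, removed by the left unitor.
  ⟨(λ_ f).symm ≪≫ FreeBicategory.normalizeIso (B := Gen Y) (b := a) Quiver.Path.nil f⟩

/-- Both words are joined to their common normal form by coherence isomorphisms. -/
theorem exists_isCoherence {a b : FreeOn Y} {f g : a ⟶ b} (h : norm f = norm g) :
    ∃ η : f ⟶ g, IsCoherence η := by
  have key : ∀ f : a ⟶ b, Nonempty (@Iso (Word Y a b)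
      (FreeBicategory.homCategory (B := Gen Y) a b) f (incl (norm f))) := fun f =>
    exists_normalizeIso (Y := Y) (a := a) (b := b) f
  obtain ⟨e⟩ := key f
  obtain ⟨e'⟩ := key g
  exact ⟨(cohIso e).hom ≫ eqToHom (by rw [h]) ≫ (cohIso e').inv,
    .comp (isCoherence_cohMk _) (.comp (isCoherence_eqToHom _) (isCoherence_cohMk _))⟩

/-- The coherence isomorphism between two words with the same normal form. -/
noncomputable def coh {a b : FreeOn Y} (f g : a ⟶ b) (h : norm f = norm g) : f ⟶ g :=
  (exists_isCoherence h).choose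

theorem isCoherence_coh {a b : FreeOn Y} {f g : a ⟶ b} (h : norm f = norm g) :
    IsCoherence (coh f g h) := (exists_isCoherence h).choose_spec

theorem IsCoherence.norm_eq {a b : FreeOn Y} {f g : a ⟶ b} {η : f ⟶ g}
    (h : IsCoherence η) : norm f = norm g := by
  obtain ⟨c, rfl⟩ := h.exists_cohMk
  exact FreeBicategory.normalizeAux_congr (B := Gen Y) (b := a) (c := b) Quiver.Path.nil c

/-- The workhorse of the strictification: every coherence 2-cell is rewritten to the canonical
`coh`, and the `simp` lemmas on `coh` then compose and whisker such cells without tracking how they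
were built. -/
theorem IsCoherence.eq_coh {a b : FreeOn Y} {f g : a ⟶ b} {η : f ⟶ g}
    (h : IsCoherence η) : η = coh f g h.norm_eq := h.unique (isCoherence_coh _)

@[simp]
theorem coh_self {a b : FreeOn Y} (f : a ⟶ b) (h : norm f = norm f) : coh f f h = 𝟙 f :=
  (IsCoherence.id f).eq_coh.symm

@[simp]
theorem coh_comp {a b : FreeOn Y} {f g k : a ⟶ b} (h : norm f = norm g) (h' : norm g = norm k) :
    coh f g h ≫ coh g k h' = coh f k (h.trans h') :=
  (IsCoherence.comp (isCoherence_coh h) (isCoherence_coh h')).eq_coh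

@[simp]
theorem coh_comp_assoc {a b : FreeOn Y} {f g k l : a ⟶ b} (h : norm f = norm g)
    (h' : norm g = norm k) (x : k ⟶ l) :
    coh f g h ≫ coh g k h' ≫ x = coh f k (h.trans h') ≫ x := by
  rw [← Category.assoc, coh_comp]

theorem norm_comp_congr {a b c : FreeOn Y} {f f' : a ⟶ b} {g g' : b ⟶ c} (h : norm f = norm f')
    (h' : norm g = norm g') : norm (f ≫ g) = norm (f' ≫ g') := by
  rw [norm_comp, norm_comp, h, h']

@[simp]
theorem whiskerLeft_coh {a b c : FreeOn Y} (f : a ⟶ b) {g k : b ⟶ c} (h : norm g = norm k) :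
    f ◁ coh g k h = coh (f ≫ g) (f ≫ k) (norm_comp_congr rfl h) :=
  (IsCoherence.whiskerLeft f (isCoherence_coh h)).eq_coh

@[simp]
theorem coh_whiskerRight {a b c : FreeOn Y} {f g : a ⟶ b} (k : b ⟶ c) (h : norm f = norm g) :
    coh f g h ▷ k = coh (f ≫ k) (g ≫ k) (norm_comp_congr h rfl) :=
  (IsCoherence.whiskerRight k (isCoherence_coh h)).eq_coh

/-- The exchange law moves the coherence isomorphism from `f` to `f'` past `y`. It permits replacing
the whiskering word by another one with the same path. -/
theorem whiskerLeft_conj_coh {a b c : FreeOn Y} {f f' : a ⟶ b} (e : norm f = norm f')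
    {g h : b ⟶ c} (y : g ⟶ h) :
    f ◁ y = coh (f ≫ g) (f' ≫ g) (norm_comp_congr e rfl) ≫ f' ◁ y ≫
      coh (f' ≫ h) (f ≫ h) (norm_comp_congr e.symm rfl) := by
  rw [← coh_whiskerRight (h := e), ← whisker_exchange_assoc]
  simp

theorem whiskerRight_conj_coh {a b c : FreeOn Y} {f g : a ⟶ b} (y : f ⟶ g) {h h' : b ⟶ c}
    (e : norm h = norm h') :
    y ▷ h = coh (f ≫ h) (f ≫ h') (norm_comp_congr rfl e) ≫ y ▷ h' ≫
      coh (g ≫ h') (g ≫ h) (norm_comp_congr rfl e.symm) := by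
  rw [← whiskerLeft_coh (h := e), whisker_exchange_assoc]
  simp

theorem norm_assoc {a b c d : FreeOn Y} (f : a ⟶ b) (g : b ⟶ c) (h : c ⟶ d) :
    norm ((f ≫ g) ≫ h) = norm (f ≫ g ≫ h) := by
  simp only [norm_comp, GenPath.comp_assoc]

theorem comp_whiskerLeft_coh {a b c d : FreeOn Y} (f : a ⟶ b) (g : b ⟶ c) {h h' : c ⟶ d}
    (y : h ⟶ h') : (f ≫ g) ◁ y = coh ((f ≫ g) ≫ h) (f ≫ g ≫ h) (norm_assoc _ _ _) ≫
      f ◁ g ◁ y ≫ coh (f ≫ g ≫ h') ((f ≫ g) ≫ h') (norm_assoc _ _ _).symm := by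
  rw [Bicategory.comp_whiskerLeft, (IsCoherence.associator_hom f g h).eq_coh,
    (IsCoherence.associator_inv f g h').eq_coh]

theorem whiskerRight_comp_coh {a b c d : FreeOn Y} {f f' : a ⟶ b} (y : f ⟶ f') (g : b ⟶ c)
    (h : c ⟶ d) : y ▷ (g ≫ h) = coh (f ≫ g ≫ h) ((f ≫ g) ≫ h) (norm_assoc _ _ _).symm ≫
      y ▷ g ▷ h ≫ coh ((f' ≫ g) ≫ h) (f' ≫ g ≫ h) (norm_assoc _ _ _) := by
  rw [Bicategory.whiskerRight_comp, (IsCoherence.associator_hom f' g h).eq_coh,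
    (IsCoherence.associator_inv f g h).eq_coh]

theorem whisker_assoc_coh {a b c d : FreeOn Y} (f : a ⟶ b) {g g' : b ⟶ c} (y : g ⟶ g')
    (h : c ⟶ d) : (f ◁ y) ▷ h = coh ((f ≫ g) ≫ h) (f ≫ g ≫ h) (norm_assoc _ _ _) ≫
      f ◁ y ▷ h ≫ coh (f ≫ g' ≫ h) ((f ≫ g') ≫ h) (norm_assoc _ _ _).symm := by
  rw [Bicategory.whisker_assoc, (IsCoherence.associator_hom f g h).eq_coh,
    (IsCoherence.associator_inv f g' h).eq_coh]

theorem norm_id_comp {a b : FreeOn Y} (f : a ⟶ b) : norm (𝟙 a ≫ f) = norm f := by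
  rw [norm_comp, norm_id, GenPath.nil_comp]

theorem norm_comp_id {a b : FreeOn Y} (f : a ⟶ b) : norm (f ≫ 𝟙 b) = norm f := by
  rw [norm_comp, norm_id, GenPath.comp_nil]

theorem id_whiskerLeft_coh {a b : FreeOn Y} {f g : a ⟶ b} (y : f ⟶ g) :
    𝟙 a ◁ y = coh (𝟙 a ≫ f) f (norm_id_comp f) ≫ y ≫ coh g (𝟙 a ≫ g) (norm_id_comp g).symm := by
  rw [Bicategory.id_whiskerLeft, (IsCoherence.leftUnitor_hom f).eq_coh,
    (IsCoherence.leftUnitor_inv g).eq_coh]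

theorem whiskerRight_id_coh {a b : FreeOn Y} {f g : a ⟶ b} (y : f ⟶ g) :
    y ▷ 𝟙 b = coh (f ≫ 𝟙 b) f (norm_comp_id f) ≫ y ≫ coh g (g ≫ 𝟙 b) (norm_comp_id g).symm := by
  rw [Bicategory.whiskerRight_id, (IsCoherence.rightUnitor_hom f).eq_coh,
    (IsCoherence.rightUnitor_inv g).eq_coh]

theorem norm_incl_comp {a b c : FreeOn Y} (p : GenPath a b) (q : GenPath b c) :
    norm (incl (p.comp q)) = norm (incl p ≫ incl q) := by
  rw [norm_comp, norm_incl, norm_incl, norm_incl]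

theorem norm_incl_congr {a b : FreeOn Y} {p q : GenPath a b} (h : p = q) :
    norm (incl p) = norm (incl q) := by rw [h]

end Normalization

/-! ### The strict 2-category of paths -/

section Strictification

variable {Y : Type u} [Bicategory.{u, u} Y]

/-- Left whiskering in the strictification. -/
noncomputable def pathWhiskerLeft {a b c : FreeOn Y} (p : GenPath a b) {q r : GenPath b c}
    (y : incl q ⟶ incl r) : incl (p.comp q) ⟶ incl (p.comp r) :=
  coh _ _ (norm_incl_comp p q) ≫ incl p ◁ y ≫ coh _ _ (norm_incl_comp p r).symm

/-- Right whiskering in the strictification. -/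
noncomputable def pathWhiskerRight {a b c : FreeOn Y} {p q : GenPath a b}
    (y : incl p ⟶ incl q) (r : GenPath b c) : incl (p.comp r) ⟶ incl (q.comp r) :=
  coh _ _ (norm_incl_comp p r) ≫ y ▷ incl r ≫ coh _ _ (norm_incl_comp q r).symm

theorem isCoherence_pathWhiskerLeft {a b c : FreeOn Y} (p : GenPath a b) {q r : GenPath b c}
    {y : incl q ⟶ incl r} (h : IsCoherence y) : IsCoherence (pathWhiskerLeft p y) :=
  .comp (isCoherence_coh _) (.comp (.whiskerLeft _ h) (isCoherence_coh _))

theorem isCoherence_pathWhiskerRight {a b c : FreeOn Y} {p q : GenPath a b}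
    {y : incl p ⟶ incl q} (h : IsCoherence y) (r : GenPath b c) :
    IsCoherence (pathWhiskerRight y r) :=
  .comp (isCoherence_coh _) (.comp (.whiskerRight _ h) (isCoherence_coh _))

theorem pathWhiskerLeft_comp {a b c : FreeOn Y} (p : GenPath a b) {q r s : GenPath b c}
    (y : incl q ⟶ incl r) (z : incl r ⟶ incl s) :
    pathWhiskerLeft p (y ≫ z) = pathWhiskerLeft p y ≫ pathWhiskerLeft p z := by
  simp [pathWhiskerLeft]

theorem comp_pathWhiskerRight {a b c : FreeOn Y} {p q r : GenPath a b}
    (y : incl p ⟶ incl q) (z : incl q ⟶ incl r) (s : GenPath b c) :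
    pathWhiskerRight (y ≫ z) s = pathWhiskerRight y s ≫ pathWhiskerRight z s := by
  simp [pathWhiskerRight]

theorem nil_pathWhiskerLeft {a b : FreeOn Y} {q r : GenPath a b} (y : incl q ⟶ incl r) :
    pathWhiskerLeft (GenPath.nil : GenPath a a) y =
      coh _ _ (norm_incl_congr (GenPath.nil_comp _)) ≫ y ≫
        coh _ _ (norm_incl_congr (GenPath.nil_comp _).symm) := by
  -- The word of the empty path is the identity word, and is presented as such so that the unit law
  -- for whiskering applies.
  rw [pathWhiskerLeft, whiskerLeft_conj_coh (f := incl GenPath.nil) (f' := 𝟙 a) rfl y,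
    id_whiskerLeft_coh]
  simp only [Category.assoc, coh_comp, coh_comp_assoc]

theorem pathWhiskerRight_nil {a b : FreeOn Y} {q r : GenPath a b} (y : incl q ⟶ incl r) :
    pathWhiskerRight y (GenPath.nil : GenPath b b) =
      coh _ _ (norm_incl_congr (GenPath.comp_nil _)) ≫ y ≫
        coh _ _ (norm_incl_congr (GenPath.comp_nil _).symm) := by
  rw [pathWhiskerRight, whiskerRight_conj_coh (h := incl GenPath.nil) (h' := 𝟙 b) y rfl,
    whiskerRight_id_coh]
  simp only [Category.assoc, coh_comp, coh_comp_assoc]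

theorem pathWhiskerLeft_id {a b c : FreeOn Y} (p : GenPath a b) (q : GenPath b c) :
    pathWhiskerLeft p (𝟙 (incl q)) = 𝟙 (incl (p.comp q)) := by
  simp [pathWhiskerLeft]

theorem id_pathWhiskerRight {a b c : FreeOn Y} (p : GenPath a b) (q : GenPath b c) :
    pathWhiskerRight (𝟙 (incl p)) q = 𝟙 (incl (p.comp q)) := by
  simp [pathWhiskerRight]

/-- Both sides are the word whiskering of `y` by `incl q` and `incl p` between coherence 2-cells,
and parallel coherence 2-cells agree. The other whiskering laws below hold in the same way. -/
theorem comp_pathWhiskerLeft {a b c d : FreeOn Y} (p : GenPath a b) (q : GenPath b c)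
    {r s : GenPath c d} (y : incl r ⟶ incl s) :
    pathWhiskerLeft (p.comp q) y =
      coh _ _ (norm_incl_congr (GenPath.comp_assoc p q r)) ≫
        pathWhiskerLeft p (pathWhiskerLeft q y) ≫
        coh _ _ (norm_incl_congr (GenPath.comp_assoc p q s).symm) := by
  rw [pathWhiskerLeft, whiskerLeft_conj_coh (norm_incl_comp p q), comp_whiskerLeft_coh]
  simp [pathWhiskerLeft, -Bicategory.comp_whiskerLeft]

theorem pathWhiskerRight_comp {a b c d : FreeOn Y} {p q : GenPath a b} (y : incl p ⟶ incl q)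
    (r : GenPath b c) (s : GenPath c d) :
    pathWhiskerRight y (r.comp s) =
      coh _ _ (norm_incl_congr (GenPath.comp_assoc p r s).symm) ≫
        pathWhiskerRight (pathWhiskerRight y r) s ≫
        coh _ _ (norm_incl_congr (GenPath.comp_assoc q r s)) := by
  rw [pathWhiskerRight, whiskerRight_conj_coh y (norm_incl_comp r s), whiskerRight_comp_coh]
  simp [pathWhiskerRight, -Bicategory.whiskerRight_comp]

theorem pathWhisker_assoc {a b c d : FreeOn Y} (p : GenPath a b) {q r : GenPath b c}
    (y : incl q ⟶ incl r) (s : GenPath c d) :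
    pathWhiskerRight (pathWhiskerLeft p y) s =
      coh _ _ (norm_incl_congr (GenPath.comp_assoc p q s)) ≫
        pathWhiskerLeft p (pathWhiskerRight y s) ≫
        coh _ _ (norm_incl_congr (GenPath.comp_assoc p r s).symm) := by
  simp [pathWhiskerLeft, pathWhiskerRight, -Bicategory.whisker_assoc, whisker_assoc_coh]

theorem pathWhisker_exchange {a b c : FreeOn Y} {p q : GenPath a b} {r s : GenPath b c}
    (y : incl p ⟶ incl q) (z : incl r ⟶ incl s) :
    pathWhiskerLeft p z ≫ pathWhiskerRight y s = pathWhiskerRight y r ≫ pathWhiskerLeft q z := by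
  simp [pathWhiskerLeft, pathWhiskerRight, whisker_exchange_assoc]

/-- Both sides are coherence 2-cells with the same boundary; the triangle is the same argument. -/
theorem path_pentagon {a b c d e : FreeOn Y} (p : GenPath a b) (q : GenPath b c) (r : GenPath c d)
    (s : GenPath d e) :
    pathWhiskerRight (coh _ _ (norm_incl_congr (GenPath.comp_assoc p q r))) s ≫
        coh _ _ (norm_incl_congr (GenPath.comp_assoc p (q.comp r) s)) ≫
        pathWhiskerLeft p (coh _ _ (norm_incl_congr (GenPath.comp_assoc q r s))) =
      coh _ _ (norm_incl_congr (GenPath.comp_assoc (p.comp q) r s)) ≫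
        coh _ _ (norm_incl_congr (GenPath.comp_assoc p q (r.comp s))) :=
  IsCoherence.unique
    (.comp (isCoherence_pathWhiskerRight (isCoherence_coh _) _)
      (.comp (isCoherence_coh _) (isCoherence_pathWhiskerLeft _ (isCoherence_coh _))))
    (.comp (isCoherence_coh _) (isCoherence_coh _))

theorem path_triangle {a b c : FreeOn Y} (p : GenPath a b) (q : GenPath b c) :
    coh _ _ (norm_incl_congr (GenPath.comp_assoc p .nil q)) ≫
        pathWhiskerLeft p (coh _ _ (norm_incl_congr (GenPath.nil_comp q))) =
      pathWhiskerRight (coh _ _ (norm_incl_congr (GenPath.comp_nil p))) q :=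
  IsCoherence.unique
    (.comp (isCoherence_coh _) (isCoherence_pathWhiskerLeft _ (isCoherence_coh _)))
    (isCoherence_pathWhiskerRight (isCoherence_coh _) _)

variable (Y) in
/-- The objects of the strictification of the free bicategory. -/
def StrictOn : Type u := FreeOn Y

instance : CategoryStruct.{u} (StrictOn Y) where
  Hom a b := GenPath (Y := Y) a b
  id a := GenPath.nil (Y := Y) (a := a)
  comp {a b c} p q := GenPath.comp (Y := Y) (a := a) (b := b) (c := c) p q

/-- The category of paths, as a full subcategory of the category of words. -/
@[reducible]
def pathCategory (a b : FreeOn Y) : Category.{u} (GenPath a b) where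
  Hom p q := incl p ⟶ incl q
  id p := 𝟙 (incl p)
  comp {p q r} (x : incl p ⟶ incl q) (y : incl q ⟶ incl r) := x ≫ y
  id_comp {p q} (x : incl p ⟶ incl q) := Category.id_comp x
  comp_id {p q} (x : incl p ⟶ incl q) := Category.comp_id x
  assoc {p q r s} (x : incl p ⟶ incl q) (y : incl q ⟶ incl r) (z : incl r ⟶ incl s) :=
    Category.assoc x y z

instance strictHomCategory (a b : StrictOn Y) : Category.{u} (a ⟶ b) :=
  pathCategory (Y := Y) a b

/-- The isomorphism of the strictification given by an equality of paths. -/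
noncomputable def pathIso {a b : StrictOn Y} {p q : a ⟶ b} (h : p = q) : p ≅ q where
  hom := coh (Y := Y) (incl p) (incl q) (norm_incl_congr h)
  inv := coh (Y := Y) (incl q) (incl p) (norm_incl_congr h.symm)
  hom_inv_id := (coh_comp (Y := Y) _ _).trans (coh_self _ _)
  inv_hom_id := (coh_comp (Y := Y) _ _).trans (coh_self _ _)

/-- A coherence 2-cell from a word to itself is the identity. This makes the bicategory of paths
strict. -/
theorem pathIso_eq_eqToIso {a b : StrictOn Y} {p q : a ⟶ b} (h : p = q) :
    pathIso h = eqToIso h := by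
  subst h
  exact Iso.ext (coh_self (Y := Y) (incl p) rfl)

noncomputable instance strictBicategory : Bicategory.{u, u} (StrictOn Y) where
  homCategory := strictHomCategory
  whiskerLeft {a b c} p _ _ y := pathWhiskerLeft (Y := Y) (a := a) (b := b) (c := c) p y
  whiskerRight {a b c} _ _ y r := pathWhiskerRight (Y := Y) (a := a) (b := b) (c := c) y r
  associator {a b c d} p q r :=
    pathIso (GenPath.comp_assoc (Y := Y) (a := a) (b := b) (c := c) (d := d) p q r)
  leftUnitor {a b} p := pathIso (GenPath.nil_comp (Y := Y) (a := a) (b := b) p)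
  rightUnitor {a b} p := pathIso (GenPath.comp_nil (Y := Y) (a := a) (b := b) p)
  whiskerLeft_id p q := pathWhiskerLeft_id (Y := Y) p q
  whiskerLeft_comp p _ _ _ y z := pathWhiskerLeft_comp (Y := Y) p y z
  id_whiskerLeft y := nil_pathWhiskerLeft (Y := Y) y
  comp_whiskerLeft p q _ _ y := comp_pathWhiskerLeft (Y := Y) p q y
  id_whiskerRight p q := id_pathWhiskerRight (Y := Y) p q
  comp_whiskerRight y z s := comp_pathWhiskerRight (Y := Y) y z s
  whiskerRight_id y := pathWhiskerRight_nil (Y := Y) y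
  whiskerRight_comp y r s := pathWhiskerRight_comp (Y := Y) y r s
  whisker_assoc p _ _ y s := pathWhisker_assoc (Y := Y) p y s
  whisker_exchange y z := pathWhisker_exchange (Y := Y) y z
  pentagon p q r s := path_pentagon (Y := Y) p q r s
  triangle p q := path_triangle (Y := Y) p q

instance : Bicategory.Strict (StrictOn Y) where
  id_comp p := GenPath.nil_comp (Y := Y) p
  comp_id p := GenPath.comp_nil (Y := Y) p
  assoc p q r := GenPath.comp_assoc (Y := Y) p q r
  leftUnitor_eqToIso _ := pathIso_eq_eqToIso _
  rightUnitor_eqToIso _ := pathIso_eq_eqToIso _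
  associator_eqToIso _ _ _ := pathIso_eq_eqToIso _

end Strictification

/-! ### The projection from the free bicategory to its strictification -/

section NormalizeCells

variable {Y : Type u} [Bicategory.{u, u} Y]

/-- The 2-cell between normal forms given by a 2-cell. -/
noncomputable def normCell {a b : FreeOn Y} {f g : a ⟶ b} (y : f ⟶ g) :
    incl (norm f) ⟶ incl (norm g) :=
  coh _ _ (norm_incl (norm f)) ≫ y ≫ coh _ _ (norm_incl (norm g)).symm

theorem normCell_id {a b : FreeOn Y} (f : a ⟶ b) : normCell (𝟙 f) = 𝟙 (incl (norm f)) := by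
  simp [normCell]

theorem normCell_comp {a b : FreeOn Y} {f g h : a ⟶ b} (y : f ⟶ g) (z : g ⟶ h) :
    normCell (y ≫ z) = normCell y ≫ normCell z := by
  simp [normCell]

theorem IsCoherence.normCell {a b : FreeOn Y} {f g : a ⟶ b} {y : f ⟶ g} (h : IsCoherence y) :
    WeakOmega.normCell y = coh _ _ (norm_incl_congr h.norm_eq) :=
  (IsCoherence.comp (isCoherence_coh _) (.comp h (isCoherence_coh _))).eq_coh

theorem normCell_whiskerLeft {a b c : FreeOn Y} (f : a ⟶ b) {g h : b ⟶ c} (y : g ⟶ h) :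
    normCell (f ◁ y) = coh _ _ (norm_incl_congr (norm_comp f g)) ≫
      pathWhiskerLeft (norm f) (normCell y) ≫
        coh _ _ (norm_incl_congr (norm_comp f h).symm) := by
  rw [pathWhiskerLeft, whiskerLeft_conj_coh (norm_incl (norm f))]
  simp [normCell]

theorem normCell_whiskerRight {a b c : FreeOn Y} {f g : a ⟶ b} (y : f ⟶ g) (h : b ⟶ c) :
    normCell (y ▷ h) = coh _ _ (norm_incl_congr (norm_comp f h)) ≫
      pathWhiskerRight (normCell y) (norm h) ≫
        coh _ _ (norm_incl_congr (norm_comp g h).symm) := by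
  rw [pathWhiskerRight, whiskerRight_conj_coh _ (norm_incl (norm h))]
  simp [normCell]

theorem normCell_associator {a b c d : FreeOn Y} (f : a ⟶ b) (g : b ⟶ c) (h : c ⟶ d) :
    normCell (α_ f g h).hom =
      coh _ _ (norm_incl_congr (by rw [norm_comp, norm_comp])) ≫
        coh _ _ (norm_incl_congr (GenPath.comp_assoc (norm f) (norm g) (norm h))) ≫
          coh _ _ (norm_incl_congr (by rw [norm_comp, norm_comp])) := by
  rw [(IsCoherence.associator_hom f g h).normCell, coh_comp, coh_comp]

theorem normCell_leftUnitor {a b : FreeOn Y} (f : a ⟶ b) :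
    normCell (λ_ f).hom = coh _ _ (norm_incl_congr (norm_comp (𝟙 a) f)) ≫
      coh _ _ (norm_incl_congr (GenPath.nil_comp (norm f))) := by
  rw [(IsCoherence.leftUnitor_hom f).normCell]
  exact (coh_comp _ _).symm

theorem normCell_rightUnitor {a b : FreeOn Y} (f : a ⟶ b) :
    normCell (ρ_ f).hom = coh _ _ (norm_incl_congr (norm_comp f (𝟙 b))) ≫
      coh _ _ (norm_incl_congr (GenPath.comp_nil (norm f))) := by
  rw [(IsCoherence.rightUnitor_hom f).normCell]
  exact (coh_comp _ _).symm

/-- Normalization conjugates by isomorphisms, and conjugating back recovers the cell. This is the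
source of the local faithfulness of `kap`. -/
theorem normCell_injective {a b : FreeOn Y} {f g : a ⟶ b} {y z : f ⟶ g}
    (h : normCell y = normCell z) : y = z := by
  have := congrArg (fun w => coh f _ (norm_incl (norm f)).symm ≫ w ≫ coh _ g (norm_incl (norm g))) h
  simpa [normCell] using this

theorem strictOn_eqToHom {a b : StrictOn Y} {p q : a ⟶ b} (h : p = q) :
    eqToHom h = (pathIso h).hom := by
  rw [pathIso_eq_eqToIso]; rfl

theorem strictOn_eqToHom_comp {a b : StrictOn Y} {p q r : a ⟶ b} (h : p = q) (y : q ⟶ r) :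
    eqToHom h ≫ y = (pathIso h).hom ≫ y := by
  rw [strictOn_eqToHom]

theorem strictOn_conj_eqToHom {a b : StrictOn Y} {p q r s : a ⟶ b} (h : p = q) (y : q ⟶ r)
    (h' : r = s) : eqToHom h ≫ y ≫ eqToHom h' = (pathIso h).hom ≫ y ≫ (pathIso h').hom := by
  rw [strictOn_eqToHom, strictOn_eqToHom]

variable (Y) in
/-- The comparison from the free bicategory to its strictification. -/
noncomputable def strictification : StrictPseudofunctor (FreeOn Y) (StrictOn Y) :=
  StrictPseudofunctor.mk'
  { obj := fun a => a
    map := fun f => norm f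
    map₂ := fun y => normCell y
    map₂_id := fun f => normCell_id f
    map₂_comp := fun y z => normCell_comp y z
    map_id := fun a => norm_id a
    map_comp := fun f g => norm_comp f g
    map₂_whisker_left := fun f _ _ y => (normCell_whiskerLeft f y).trans
      (strictOn_conj_eqToHom (Y := Y) _ _ _).symm
    map₂_whisker_right := fun y h => (normCell_whiskerRight y h).trans
      (strictOn_conj_eqToHom (Y := Y) _ _ _).symm
    map₂_left_unitor := fun f => (normCell_leftUnitor f).trans
      (strictOn_eqToHom_comp (Y := Y) _ _).symm
    map₂_right_unitor := fun f => (normCell_rightUnitor f).trans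
      (strictOn_eqToHom_comp (Y := Y) _ _).symm
    map₂_associator := fun f g h => (normCell_associator f g h).trans
      (strictOn_conj_eqToHom (Y := Y) _ _ _).symm }

end NormalizeCells

/-! ### Universal property of the strictification -/

section OutOfStrictification

variable {Y Z : Type u} [Bicategory.{u, u} Y] [Bicategory.{u, u} Z] [Bicategory.Strict Z]
  (F : StrictPseudofunctor (FreeOn Y) Z)

/-- A coherence 2-cell joins `f` and `g`; its image is a coherence 2-cell of a strict 2-category,
hence an identity up to transport. -/
theorem map_eq_of_norm_eq {a b : FreeOn Y} {f g : a ⟶ b} (h : norm f = norm g) :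
    F.map f = F.map g :=
  ((isCoherence_coh h).map₂ F).eq_eqToHom.choose

theorem map₂_coh {a b : FreeOn Y} {f g : a ⟶ b} (h : norm f = norm g) :
    F.map₂ (coh f g h) = eqToHom (map_eq_of_norm_eq F h) :=
  ((isCoherence_coh h).map₂ F).eq_eqToHom.choose_spec

theorem map_incl_comp {a b c : FreeOn Y} (p : GenPath a b) (q : GenPath b c) :
    F.map (incl (p.comp q)) = F.map (incl p) ≫ F.map (incl q) := by
  rw [← F.map_comp]
  exact map_eq_of_norm_eq F (norm_incl_comp p q)

theorem map₂_pathWhiskerLeft {a b c : FreeOn Y} (p : GenPath a b) {q r : GenPath b c}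
    (y : incl q ⟶ incl r) : F.map₂ (pathWhiskerLeft p y) = eqToHom (map_incl_comp F p q) ≫
      F.map (incl p) ◁ F.map₂ y ≫ eqToHom (map_incl_comp F p r).symm := by
  rw [pathWhiskerLeft, F.map₂_comp, F.map₂_comp, map₂_whiskerLeft_eqToHom, map₂_coh, map₂_coh]
  simp

theorem map₂_pathWhiskerRight {a b c : FreeOn Y} {p q : GenPath a b} (y : incl p ⟶ incl q)
    (r : GenPath b c) : F.map₂ (pathWhiskerRight y r) = eqToHom (map_incl_comp F p r) ≫
      F.map₂ y ▷ F.map (incl r) ≫ eqToHom (map_incl_comp F q r).symm := by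
  rw [pathWhiskerRight, F.map₂_comp, F.map₂_comp, map₂_whiskerRight_eqToHom, map₂_coh, map₂_coh]
  simp

/-- A strict homomorphism from the free bicategory to a strict 2-category factors through the
strictification. -/
noncomputable def strictLift : StrictPseudofunctor (StrictOn Y) Z :=
  StrictPseudofunctor.mk''
  { obj := fun a => F.obj a
    map := fun p => F.map (incl p)
    map₂ := fun {a b p q} y => F.map₂ (a := a) (b := b) (f := incl p) (g := incl q) y
    map₂_id := fun p => F.map₂_id (incl p)
    map₂_comp := fun {a b p q r} y z =>
      F.map₂_comp (a := a) (b := b) (f := incl p) (g := incl q) (h := incl r) y z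
    map_id := fun a => F.map_id a
    map_comp := fun p q => map_incl_comp F p q
    map₂_whisker_left := fun p _ _ y => map₂_pathWhiskerLeft F p y
    map₂_whisker_right := fun y r => map₂_pathWhiskerRight F y r }

theorem map_incl_norm {a b : FreeOn Y} (f : a ⟶ b) : F.map (incl (norm f)) = F.map f :=
  map_eq_of_norm_eq F (norm_incl _)

theorem mk_map₂_normCell {a b : FreeOn Y} {f g : a ⟶ b} (y : f ⟶ g) :
    TwoCell.mk (F.map₂ (normCell y)) = TwoCell.mk (F.map₂ y) := by
  refine twoCell_mk_eq (map_incl_norm F f) (map_incl_norm F g) _ _ ?_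
  rw [normCell, F.map₂_comp, F.map₂_comp, map₂_coh, map₂_coh]

end OutOfStrictification

/-- The strictification of the free bicategory. -/
noncomputable def freeStrict (Y : Bicat.{u}) : StrictTwoCat.{u} :=
  ⟨⟨StrictOn Y.carrier⟩, inferInstanceAs (Bicategory.Strict (StrictOn Y.carrier))⟩

/-- The comparison from the free bicategory to its strictification. -/
noncomputable def toFreeStrict (Y : Bicat.{u}) : freeBicat Y ⟶ (freeStrict Y).obj :=
  strictification Y.carrier

theorem exists_strictLift {Y Z : Bicat.{u}} (hZ : Bicategory.Strict Z.carrier)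
    (F : freeBicat Y ⟶ Z) : ∃ H : (freeStrict Y).obj ⟶ Z, toFreeStrict Y ≫ H = F := by
  obtain ⟨F, rfl⟩ : ∃ F' : StrictPseudofunctor (FreeOn Y.carrier) Z.carrier, F = F' := ⟨F, rfl⟩
  refine ⟨(strictLift F : StrictPseudofunctor (StrictOn Y.carrier) Z.carrier),
    bicatHom_ext (magmaHom_ext (fun x => rfl) (fun x => ?_) (fun x => ?_))⟩
  · have := @map_incl_norm Y.carrier Z.carrier Y.str Z.str hZ F _ _
      (@OneCell.hom (FreeOn Y.carrier) freeBicategory x)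
    exact congrArg (@OneCell.mk Z.carrier _ _ _) this
  · exact @mk_map₂_normCell Y.carrier Z.carrier Y.str Z.str hZ F _ _ _ _
      (@TwoCell.hom (FreeOn Y.carrier) freeBicategory x)

/-- A path is the normal form of its own word. Surjectivity on cells makes the factorization through
the strictification unique. -/
theorem toFreeStrict_one_surjective (Y : Bicat.{u}) (x : OneCell (freeStrict Y).obj.carrier) :
    ∃ y : OneCell (freeBicat Y).carrier, (bicatMagma.map (toFreeStrict Y)).map (n := 1) y = x := by
  obtain ⟨p⟩ := x
  exact ⟨@OneCell.mk (FreeOn Y.carrier) _ _ _ (incl p),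
    congrArg (@OneCell.mk (StrictOn Y.carrier) _ _ _) (@norm_incl Y.carrier Y.str _ _ p)⟩

theorem toFreeStrict_two_surjective (Y : Bicat.{u}) (x : TwoCell (freeStrict Y).obj.carrier) :
    ∃ y : TwoCell (freeBicat Y).carrier, (bicatMagma.map (toFreeStrict Y)).map (n := 2) y = x := by
  obtain @⟨a, b, p, q, x⟩ := x
  -- By construction a 2-cell of the strictification is already a 2-cell of the free bicategory
  -- between words of paths; normalizing it changes it only by transport.
  refine ⟨@TwoCell.mk (FreeOn Y.carrier) _ a b (@incl Y.carrier Y.str _ _ p)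
    (@incl Y.carrier Y.str _ _ q) x, ?_⟩
  refine twoCell_mk_eq (B := StrictOn Y.carrier) (@norm_incl Y.carrier Y.str _ _ p)
    (@norm_incl Y.carrier Y.str _ _ q)
    (normCell (Y := Y.carrier) x) x ?_
  exact (strictOn_conj_eqToHom (Y := Y.carrier) _ _ _).symm

/-- The free strict 2-category on the omega graph underlying a bicategory. -/
noncomputable def freeStrictObject (Y : Bicat.{u}) : FreeStrict Y where
  obj := freeStrict Y
  unit := freeBicatUnit Y ≫ bicatGraph.map (toFreeStrict Y)
  existsUnique Z φ := by
    obtain ⟨F, hF⟩ := freeBicat_exists Y Z.obj φ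
    obtain ⟨H, rfl⟩ := exists_strictLift Z.property F
    refine ⟨ObjectProperty.homMk H, ?_, fun G hG => ?_⟩
    · dsimp only
      rw [← hF, Functor.map_comp, Category.assoc]
      rfl
    · apply ObjectProperty.hom_ext
      have e : toFreeStrict Y ≫ G.hom = toFreeStrict Y ≫ H := by
        apply freeBicat_hom_ext
        rw [hF, ← hG, Functor.map_comp, Category.assoc]
        rfl
      have e' : ∀ {n : ℕ} (x : (bicatMagma.obj (freeBicat Y)).cell n),
          (bicatMagma.map G.hom).map ((bicatMagma.map (toFreeStrict Y)).map x) =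
          (bicatMagma.map H).map ((bicatMagma.map (toFreeStrict Y)).map x) := fun {n} x =>
        congrArg (fun K : bicatMagma.obj (freeBicat Y) ⟶ bicatMagma.obj Z.obj => K.map x)
          ((bicatMagma.map_comp _ _).symm.trans ((congrArg (fun K => bicatMagma.map K) e).trans
            (bicatMagma.map_comp _ _)))
      refine bicatHom_ext (magmaHom_ext (fun x => e' (n := 0) x) (fun x => ?_) (fun x => ?_))
      · obtain ⟨y, rfl⟩ := toFreeStrict_one_surjective Y x
        exact e' (n := 1) y
      · obtain ⟨y, rfl⟩ := toFreeStrict_two_surjective Y x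
        exact e' (n := 2) y

/-! ### Invertible 2-cells of the free bicategory -/

section InvertibleCells

/-- The objects of the bicategory with one 1-cell and propositions as 2-cells. -/
def PropOb : Type u := PUnit.{u + 1}

instance : CategoryStruct.{u} PropOb.{u} where
  Hom _ _ := PUnit.{u + 1}
  id _ := PUnit.unit
  comp _ _ := PUnit.unit

instance (a b : PropOb.{u}) : Category.{u} (a ⟶ b) where
  Hom _ _ := ULift.{u} Prop
  id _ := ⟨True⟩
  comp p q := ⟨p.down ∧ q.down⟩
  id_comp p := ULift.ext _ _ (propext (Iff.of_eq (true_and p.down)))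
  comp_id p := ULift.ext _ _ (propext (Iff.of_eq (and_true p.down)))
  assoc _ _ _ := ULift.ext _ _ (propext and_assoc)

/-- The bicategory with one 1-cell whose 2-cells are propositions, composed by conjunction. -/
instance propBicategory : Bicategory.{u, u} PropOb.{u} where
  whiskerLeft _ _ _ p := p
  whiskerRight p _ := p
  associator _ _ _ := Iso.refl _
  leftUnitor _ := Iso.refl _
  rightUnitor _ := Iso.refl _
  whisker_exchange p q := ULift.ext _ _ (propext and_comm)
  id_whiskerLeft p := ((Category.id_comp _).trans (Category.comp_id p)).symm
  comp_whiskerLeft _ _ _ _ p := ((Category.id_comp _).trans (Category.comp_id p)).symm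
  whiskerRight_id p := ((Category.id_comp _).trans (Category.comp_id p)).symm
  whiskerRight_comp p _ _ := ((Category.id_comp _).trans (Category.comp_id p)).symm
  whisker_assoc _ _ _ p _ := ((Category.id_comp _).trans (Category.comp_id p)).symm
  whiskerLeft_id _ _ := rfl
  whiskerLeft_comp _ _ _ _ _ _ := rfl
  id_whiskerRight _ _ := rfl
  comp_whiskerRight _ _ _ := rfl
  pentagon _ _ _ _ := Category.id_comp _
  triangle _ _ := Category.id_comp _

/-- A conjunction equal to `True` has a true first component. -/
theorem down_of_isIso {a b : PropOb.{u}} {f g : a ⟶ b} (p : f ⟶ g) [IsIso p] :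
    ULift.down.{u} (show ULift Prop from p) := by
  have h : (p ≫ inv p : f ⟶ f) = (⟨True⟩ : ULift.{u} Prop) := IsIso.hom_inv_id p
  exact (of_eq_true (congrArg ULift.down h)).1

variable {Y : Type u} [Bicategory.{u, u} Y]

/-- A 2-cell is an identity. -/
inductive IsIdTwo : ∀ {a b : Y} {f g : a ⟶ b}, (f ⟶ g) → Prop
  | mk {a b : Y} (f : a ⟶ b) : IsIdTwo (𝟙 f)

variable (Y) in
/-- The graph morphism that tells identity 2-cells from the others. -/
def idMap : GenMap Y PropOb.{u} where
  obj _ := PUnit.unit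
  map _ := PUnit.unit
  map₂ η := ⟨IsIdTwo η⟩
  map_id _ := rfl
  map₂_id f := ULift.ext _ _ (eq_true (IsIdTwo.mk f))

theorem isCoherence_genTwo_id {a b : Y} (f : a ⟶ b) :
    @IsCoherence (FreeOn Y) _ a b (gen f) (gen f) (genTwo (𝟙 f)) := by
  rw [genTwo_id]
  exact .id (B := FreeOn Y) (a := a) (b := b) _

/-- Under `idMap` vertical composition becomes conjunction and whiskering does nothing, so truth of
the value forces every generating 2-cell in `t` to be an identity. What remains of the term is
structural. -/
theorem isCoherence_mk {a b : FreeOn Y} {f g : Word Y a b} (t : CellTerm f g)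
    (h : ULift.down.{u} (show ULift Prop from (idMap Y).eval t)) :
    @IsCoherence (FreeOn Y) _ a b f g (FreeCell.mk t) := by
  induction t with
  | coh c => exact isCoherence_cohMk c
  | of η =>
    -- A generator is evaluated between two `eqToHom` cells, so its value is a triple conjunction
    -- with the proposition of interest in the middle.
    obtain ⟨_, h, _⟩ := h
    change IsIdTwo η at h
    cases h with
    | mk => exact isCoherence_genTwo_id _
  | @vcomp a b f g k s t ihs iht =>
    exact IsCoherence.comp (B := FreeOn Y) (a := a) (b := b) (ihs h.1) (iht h.2)
  | @whiskerLeft a b c f g k t ih =>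
    exact IsCoherence.whiskerLeft (B := FreeOn Y) (a := a) (b := b) (c := c) f (ih h)
  | @whiskerRight a b c f g k t ih =>
    exact IsCoherence.whiskerRight (B := FreeOn Y) (a := a) (b := b) (c := c) k (ih h)

/-- The invertible 2-cells of the free bicategory are the coherence isomorphisms. -/
theorem isCoherence_of_isIso {a b : FreeOn Y} {f g : a ⟶ b} (η : f ⟶ g) [IsIso η] :
    IsCoherence η := by
  -- The strict homomorphism extending `idMap` preserves invertibility, so the value of `η` is true.
  have : IsIso ((GenMap.extend (Z := ⟨PropOb.{u}⟩) (idMap Y)).map₂ η) :=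
    inferInstanceAs (IsIso ((PrelaxFunctor.mapFunctor
      (GenMap.extend (Z := ⟨PropOb.{u}⟩) (idMap Y)).toPrelaxFunctor a b).map η))
  have h := down_of_isIso ((GenMap.extend (Z := ⟨PropOb.{u}⟩) (idMap Y)).map₂ η)
  obtain ⟨t, rfl⟩ := FreeCell.exists_rep η
  exact isCoherence_mk t h

theorem IsCoherence.isIso {B : Type u} [Bicategory.{u, u} B] {a b : B} {f g : a ⟶ b} {η : f ⟶ g}
    (h : IsCoherence η) : IsIso η := by
  induction h with
  | comp _ _ ih1 ih2 => exact IsIso.comp_isIso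
  | _ => infer_instance

end InvertibleCells

/-! ### Bridges and local faithfulness for the standard free objects -/

section StandardFree

variable {Y : Type u} [Bicategory.{u, u} Y]

/-- An invertible 2-cell is a coherence 2-cell, so its image in the strict 2-category of paths is an
`eqToHom`. -/
theorem strictification_bridge {x y : OneCell (FreeOn Y)} {c : TwoCell (FreeOn Y)}
    (h : isoBridge (FreeOn Y) 1 x y c) :
    bicatCellMap (strictification Y) (n := 1) x = bicatCellMap (strictification Y) (n := 1) y ∧
    bicatCellMap (strictification Y) (n := 2) c = (bicatOmegaGraph (StrictOn Y)).ide (n := 1)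
        (bicatCellMap (strictification Y) (n := 1) x) := by
  obtain ⟨a, b, f, g, η, hη, rfl, rfl, rfl⟩ := h
  have hc := isCoherence_of_isIso η
  obtain ⟨e, he⟩ := (hc.map₂ (strictification Y)).eq_eqToHom
  refine ⟨congrArg (@OneCell.mk (StrictOn Y) _ _ _) e, ?_⟩
  change TwoCell.mk ((strictification Y).map₂ η) = _
  rw [he, TwoCell.mk_eqToHom]
  rfl

theorem exists_bridge_of_strictification {x y : OneCell (FreeOn Y)}
    (hp : (bicatOmegaGraph (FreeOn Y)).Parallel (i := 1) x y)
    (h : bicatCellMap (strictification Y) (n := 1) x =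
      bicatCellMap (strictification Y) (n := 1) y) :
    ∃ c, isoBridge (FreeOn Y) 1 x y c := by
  obtain ⟨hs, ht⟩ := hp
  obtain @⟨a, b, f⟩ := x
  obtain ⟨g, rfl⟩ := OneCell.exists_rep (B := FreeOn Y) y (a := a) (b := b) hs.symm ht.symm
  have h' : norm f = norm g := (OneCell.mk_inj (B := StrictOn Y)).1 h
  exact ⟨TwoCell.mk (coh f g h'), a, b, f, g, coh f g h', (isCoherence_coh h').isIso, rfl, rfl, rfl⟩

theorem strictification_faithful {x y : TwoCell (FreeOn Y)}
    (hp : (bicatOmegaGraph (FreeOn Y)).Parallel (i := 2) x y)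
    (h : bicatCellMap (strictification Y) (n := 2) x =
      bicatCellMap (strictification Y) (n := 2) y) : x = y := by
  obtain ⟨hs, ht⟩ := hp
  obtain ⟨θ, rfl⟩ := TwoCell.exists_rep (B := FreeOn Y) y hs.symm ht.symm
  obtain ⟨η⟩ := x
  have h' : normCell η = normCell θ := (TwoCell.mk_inj (B := StrictOn Y)).1 h
  exact congrArg TwoCell.mk (normCell_injective h')

end StandardFree

theorem bicatMagma_map_comp_apply {B C D : Bicat.{u}} (F : B ⟶ C) (G : C ⟶ D) {n : ℕ}
    (x : (bicatMagma.obj B).cell n) :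
    (bicatMagma.map (F ≫ G)).map x = (bicatMagma.map G).map ((bicatMagma.map F).map x) :=
  congrArg (fun K : bicatMagma.obj B ⟶ bicatMagma.obj D => K.map x) (bicatMagma.map_comp F G)

theorem bicatMagma_map_id_apply {B : Bicat.{u}} {n : ℕ} (x : (bicatMagma.obj B).cell n) :
    (bicatMagma.map (𝟙 B)).map x = x :=
  congrArg (fun K : bicatMagma.obj B ⟶ bicatMagma.obj B => K.map x) (bicatMagma.map_id B)

theorem bicatMagma_inv_apply {B C : Bicat.{u}} (e : B ≅ C) {n : ℕ}
    (x : (bicatMagma.obj B).cell n) :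
    (bicatMagma.map e.inv).map ((bicatMagma.map e.hom).map x) = x := by
  rw [← bicatMagma_map_comp_apply, e.hom_inv_id, bicatMagma_map_id_apply]

theorem bicatMagma_hom_injective {B C : Bicat.{u}} (e : B ≅ C) {n : ℕ}
    {x y : (bicatMagma.obj B).cell n}
    (h : (bicatMagma.map e.hom).map x = (bicatMagma.map e.hom).map y) : x = y := by
  rw [← bicatMagma_inv_apply e x, h, bicatMagma_inv_apply]

theorem OmegaGraph.map_parallel {X Y : OmegaGraph.{u}} (F : X ⟶ Y) {i : ℕ} {x y : X.cell i}
    (h : X.Parallel x y) : Y.Parallel (F.map x) (F.map y) := by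
  cases i with
  | zero => trivial
  | succ i =>
    obtain ⟨h1, h2⟩ := h
    exact ⟨(F.map_dom x).symm.trans ((congrArg F.map h1).trans (F.map_dom y)),
      (F.map_cod x).symm.trans ((congrArg F.map h2).trans (F.map_cod y))⟩

theorem FreeObject.unit_desc_comp {C : Type (u + 1)} [Category.{u} C] {V : C ⥤ OmegaGraph.{u}}
    {G : OmegaGraph.{u}} (P : FreeObject V G) {Z Z' : C} (φ : G ⟶ V.obj Z) (F : Z ⟶ Z') :
    P.unit ≫ V.map (P.desc φ ≫ F) = φ ≫ V.map F := by
  rw [Functor.map_comp, ← Category.assoc, P.unit_desc]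

/-- Free objects on the same omega graph are isomorphic. -/
noncomputable def FreeObject.iso {C : Type (u + 1)} [Category.{u} C] {V : C ⥤ OmegaGraph.{u}}
    {G : OmegaGraph.{u}} (P P' : FreeObject V G) : P.obj ≅ P'.obj where
  hom := P.desc P'.unit
  inv := P'.desc P.unit
  hom_inv_id := P.hom_ext (by
    rw [Functor.map_comp, ← Category.assoc, P.unit_desc, P'.unit_desc,
      CategoryTheory.Functor.map_id,
      Category.comp_id])
  inv_hom_id := P'.hom_ext (by
    rw [Functor.map_comp, ← Category.assoc, P'.unit_desc, P.unit_desc,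
      CategoryTheory.Functor.map_id,
      Category.comp_id])

/-! ### Arbitrary free objects and the diagram of a bicategory -/

section FreeProperties

theorem toFreeStrict_faithful {Y : Bicat.{u}} {x y : (bicatMagma.obj (freeBicat Y)).cell 2}
    (hp : (bicatMagma.obj (freeBicat Y)).Parallel x y)
    (h : (bicatMagma.map (toFreeStrict Y)).map x = (bicatMagma.map (toFreeStrict Y)).map y) :
    x = y :=
  @strictification_faithful Y.carrier Y.str x y hp h

theorem exists_bridge_of_toFreeStrict {Y : Bicat.{u}} {x y : (bicatMagma.obj (freeBicat Y)).cell 1}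
    (hp : (bicatMagma.obj (freeBicat Y)).Parallel x y)
    (h : (bicatMagma.map (toFreeStrict Y)).map x = (bicatMagma.map (toFreeStrict Y)).map y) :
    ∃ c, isoBridge (freeBicat Y).carrier 1 x y c :=
  @exists_bridge_of_strictification Y.carrier Y.str x y hp h

theorem toFreeStrict_bridge {Y : Bicat.{u}} {x y : (bicatMagma.obj (freeBicat Y)).cell 1}
    {c : (bicatMagma.obj (freeBicat Y)).cell 2} (h : isoBridge (freeBicat Y).carrier 1 x y c) :
    (bicatMagma.map (toFreeStrict Y)).map x = (bicatMagma.map (toFreeStrict Y)).map y ∧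
    (bicatMagma.map (toFreeStrict Y)).map c =
      (bicatMagma.obj (freeStrict Y).obj).ide ((bicatMagma.map (toFreeStrict Y)).map x) :=
  @strictification_bridge Y.carrier Y.str x y c h

variable {Y : Bicat.{u}} (P : FreeBicat Y) (Q : FreeStrict Y)

/-- The isomorphism with the standard free bicategory. -/
noncomputable def freeBicatIso : P.obj ≅ freeBicat Y := P.iso (freeBicatObject Y)

/-- The isomorphism with the standard free strict 2-category. -/
noncomputable def freeStrictIso : Q.obj.obj ≅ (freeStrict Y).obj :=
  (ObjectProperty.ι _).mapIso (Q.iso (freeStrictObject Y))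

/-- Both sides agree on generators. Through this square all properties of the standard projection
are transported to the comparison of arbitrary free objects. -/
theorem comparison_comp_iso :
    comparison P Q ≫ (freeStrictIso Q).hom = (freeBicatIso P).hom ≫ toFreeStrict Y := by
  refine P.hom_ext ((P.unit_desc_comp (Z := Q.obj.obj) Q.unit _).trans ?_)
  refine Eq.trans ?_ (P.unit_desc_comp (freeBicatObject Y).unit (toFreeStrict Y)).symm
  exact Q.unit_desc (freeStrictObject Y).unit

theorem comparison_iso_apply {n : ℕ} (x : (bicatMagma.obj P.obj).cell n) :
    (bicatMagma.map (freeStrictIso Q).hom).map ((bicatMagma.map (comparison P Q)).map x) =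
      (bicatMagma.map (toFreeStrict Y)).map ((bicatMagma.map (freeBicatIso P).hom).map x) := by
  rw [← bicatMagma_map_comp_apply, comparison_comp_iso, bicatMagma_map_comp_apply]

theorem toFreeStrict_eq_of_comparison_eq {n : ℕ} {x y : (bicatMagma.obj P.obj).cell n}
    (h : (bicatMagma.map (comparison P Q)).map x = (bicatMagma.map (comparison P Q)).map y) :
    (bicatMagma.map (toFreeStrict Y)).map ((bicatMagma.map (freeBicatIso P).hom).map x) =
      (bicatMagma.map (toFreeStrict Y)).map ((bicatMagma.map (freeBicatIso P).hom).map y) := by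
  rw [← comparison_iso_apply P Q, h, comparison_iso_apply]

/-- The standard projection is the identity on 0-cells. -/
theorem comparison_zero_injective {x y : P.obj.carrier}
    (h : (bicatMagma.map (comparison P Q)).map (n := 0) x =
      (bicatMagma.map (comparison P Q)).map (n := 0) y) : x = y :=
  bicatMagma_hom_injective (n := 0) (freeBicatIso P)
    (toFreeStrict_eq_of_comparison_eq P Q (n := 0) h)

theorem comparison_faithful {x y : (bicatMagma.obj P.obj).cell 2}
    (hp : (bicatMagma.obj P.obj).Parallel x y)
    (h : (bicatMagma.map (comparison P Q)).map x = (bicatMagma.map (comparison P Q)).map y) :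
    x = y :=
  bicatMagma_hom_injective (freeBicatIso P) (toFreeStrict_faithful
    (OmegaGraph.map_parallel (bicatMagma.map (freeBicatIso P).hom).toHom hp)
    (toFreeStrict_eq_of_comparison_eq P Q h))

theorem exists_bridge_of_comparison {x y : (bicatMagma.obj P.obj).cell 1}
    (hp : (bicatMagma.obj P.obj).Parallel x y)
    (h : (bicatMagma.map (comparison P Q)).map x = (bicatMagma.map (comparison P Q)).map y) :
    ∃ c, isoBridge P.obj.carrier 1 x y c := by
  obtain ⟨c, hc⟩ := exists_bridge_of_toFreeStrict
    (OmegaGraph.map_parallel (bicatMagma.map (freeBicatIso P).hom).toHom hp)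
    (toFreeStrict_eq_of_comparison_eq P Q h)
  have hc' := isoBridge_map (B := freeBicat Y) (freeBicatIso P).inv hc
  rw [bicatMagma_inv_apply, bicatMagma_inv_apply] at hc'
  exact ⟨_, hc'⟩

theorem comparison_bridge {x y : (bicatMagma.obj P.obj).cell 1} {c : (bicatMagma.obj P.obj).cell 2}
    (h : isoBridge P.obj.carrier 1 x y c) :
    (bicatMagma.map (comparison P Q)).map x = (bicatMagma.map (comparison P Q)).map y ∧
    (bicatMagma.map (comparison P Q)).map c =
      (bicatMagma.obj Q.obj.obj).ide ((bicatMagma.map (comparison P Q)).map x) := by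
  obtain ⟨h1, h2⟩ := toFreeStrict_bridge (isoBridge_map (freeBicatIso P).hom h)
  constructor
  · apply bicatMagma_hom_injective (freeStrictIso Q)
    rw [comparison_iso_apply, comparison_iso_apply]
    exact h1
  · apply bicatMagma_hom_injective (freeStrictIso Q)
    rw [comparison_iso_apply, OmegaGraph.Hom.map_ide, comparison_iso_apply]
    exact h2

/-- The counit factors through the standard free bicategory, where invertible 2-cells are coherence
2-cells; strict homomorphisms preserve these. -/
theorem exists_isCoherence_of_bridge {x y : (bicatMagma.obj P.obj).cell 1}
    {c : (bicatMagma.obj P.obj).cell 2} (h : isoBridge P.obj.carrier 1 x y c) :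
    ∃ (a b : Y.carrier) (f g : a ⟶ b) (η : f ⟶ g),
      IsCoherence η ∧ (bicatMagma.map (counit P)).map c = TwoCell.mk η := by
  let ev : freeBicat Y ⟶ Y := counit (freeBicatObject Y)
  have hk : (freeBicatIso P).hom ≫ ev = counit P :=
    P.hom_ext ((P.unit_desc_comp (freeBicatObject Y).unit ev).trans
      (((freeBicatObject Y).unit_desc _).trans (P.unit_desc _).symm))
  obtain ⟨a, b, f, g, η, hη, -, -, hc⟩ := isoBridge_map (freeBicatIso P).hom h
  rw [← hk, bicatMagma_map_comp_apply, hc]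
  exact ⟨_, _, _, _, _, (@isCoherence_of_isIso Y.carrier Y.str a b f g η hη).map₂ ev, rfl⟩

theorem standardDiagram_split :
    P.unit ≫ magmaGraph.map (bicatMagma.map (counit P)) = 𝟙 (bicatGraph.obj Y) :=
  P.unit_desc _

theorem isBridgeRel_isoBridge :
    IsBridgeRel (bicatOmegaGraph P.obj.carrier) (isoBridge P.obj.carrier) where
  boundary {i x y c} h := by
    match i, x, y, c, h with
    | 0, _, _, _, ⟨rfl, rfl⟩ => exact ⟨trivial, rfl, rfl⟩
    | 1, _, _, _, ⟨a, b, f, g, η, hη, rfl, rfl, rfl⟩ => exact ⟨⟨rfl, rfl⟩, rfl, rfl⟩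
    | _ + 2, _, _, _, ⟨rfl, rfl⟩ => exact ⟨⟨rfl, rfl⟩, rfl, rfl⟩
  refl {i} x := by
    match i, x with
    | 0, _ => exact ⟨rfl, rfl⟩
    | 1, ⟨f⟩ => exact ⟨_, _, f, f, 𝟙 f, inferInstance, rfl, rfl, rfl⟩
    | _ + 2, _ => exact ⟨rfl, rfl⟩
  unique {i x y c d} h h' := by
    match i, x, y, c, d, h, h' with
    | 0, _, _, _, _, ⟨rfl, rfl⟩, ⟨_, rfl⟩ => rfl
    -- Two bridges between the same words are parallel and both go to the identity under the
    -- comparison with a free strict 2-category; local faithfulness identifies them.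
    | 1, x, y, c, d, h, h' =>
      have hb : ∀ {c : TwoCell P.obj.carrier}, isoBridge P.obj.carrier 1 x y c →
          OneCell.mk c.dom = x ∧ OneCell.mk c.cod = y := by
        rintro _ ⟨a, b, f, g, η, hη, rfl, rfl, rfl⟩
        exact ⟨rfl, rfl⟩
      exact comparison_faithful P (freeStrictObject Y)
        ⟨(hb h).1.trans (hb h').1.symm, (hb h).2.trans (hb h').2.symm⟩
        ((comparison_bridge P (freeStrictObject Y) h).2.trans
          (comparison_bridge P (freeStrictObject Y) h').2.symm)
    | _ + 2, _, _, _, _, ⟨rfl, rfl⟩, ⟨_, rfl⟩ => rfl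

theorem bicatOmegaGraph_isSkeletal (B : Type u) [Bicategory.{u, u} B] :
    (bicatOmegaGraph B).IsSkeletal 2 := by
  intro i hi x
  obtain ⟨j, rfl⟩ := Nat.exists_eq_add_of_le' hi
  exact ⟨x, rfl⟩

theorem isStrict_of_freeStrict : (bicatMagma.obj Q.obj.obj).IsStrict :=
  have := Q.obj.property
  bicatOmegaMagma_isStrict Q.obj.obj.carrier

theorem comparison_collapse {i : ℕ} {x y : (bicatMagma.obj P.obj).cell i}
    {c : (bicatMagma.obj P.obj).cell (i + 1)} (h : isoBridge P.obj.carrier i x y c) :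
    (bicatMagma.map (comparison P Q)).map x = (bicatMagma.map (comparison P Q)).map y ∧
    (bicatMagma.map (comparison P Q)).map c =
      (bicatMagma.obj Q.obj.obj).ide ((bicatMagma.map (comparison P Q)).map x) := by
  match i, x, y, c, h with
  | 0, _, _, _, ⟨rfl, rfl⟩ => exact ⟨rfl, OmegaGraph.Hom.map_ide _ _⟩
  | 1, _, _, _, h => exact comparison_bridge P Q h
  | _ + 2, _, _, _, ⟨rfl, rfl⟩ => exact ⟨rfl, OmegaGraph.Hom.map_ide _ _⟩

theorem standardDiagram_isWeakNCat : (standardDiagram P Q).IsWeakNCat 2 where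
  split := standardDiagram_split P
  bridge := isBridgeRel_isoBridge P
  strict := isStrict_of_freeStrict Q
  skeletal := bicatOmegaGraph_isSkeletal Y.carrier
  penon :=
    { strict := isStrict_of_freeStrict Q
      bridge := fun h => (comparison_collapse P Q h).imp_right fun h => h
      collapse := fun h => comparison_collapse P Q h
      lift := fun {i x y} hp h => by
        match i, x, y, hp, h with
        | 0, x, y, _, h => exact ⟨_, comparison_zero_injective P Q h, rfl⟩
        | 1, x, y, hp, h => exact exists_bridge_of_comparison P Q hp h
        | 2, x, y, hp, h => exact ⟨_, comparison_faithful P Q hp h, rfl⟩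
        -- From dimension 3 on the domain map is the identity function, so parallel cells are equal.
        | _ + 3, x, y, hp, h => exact ⟨_, hp.1, rfl⟩ }

/-- The insertion of 0-cells into the free bicategory. -/
def unitObj (a : Y.carrier) : P.obj.carrier := P.unit.map (n := 0) a

theorem exists_unit_rep {a b : Y.carrier} (f : a ⟶ b) :
    ∃ f' : unitObj P a ⟶ unitObj P b, P.unit.map (n := 1) (OneCell.mk f) = OneCell.mk f' :=
  OneCell.exists_rep (B := P.obj.carrier) _ (P.unit.map_dom (n := 0) (OneCell.mk f)).symm
    (P.unit.map_cod (n := 0) (OneCell.mk f)).symm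

theorem counit_unit {n : ℕ} (x : (bicatMagma.obj Y).cell n) :
    (bicatMagma.map (counit P)).map (P.unit.map x) = x :=
  congrArg (fun K : bicatGraph.obj Y ⟶ bicatGraph.obj Y => K.map x) (standardDiagram_split P)

theorem standardDiagram_coherenceFromBridges :
    CoherenceFromBridges (standardDiagram P Q) Y (𝟙 (bicatMagma.obj Y)) where
  associator {a b c d} f g h fg gh l r h1 h2 h3 h4 := by
    obtain ⟨f', hf⟩ := exists_unit_rep P f
    obtain ⟨g', hg⟩ := exists_unit_rep P g
    obtain ⟨h', hh⟩ := exists_unit_rep P h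
    change BicatComp 0 1 (P.unit.map (n := 1) (OneCell.mk f))
      (P.unit.map (n := 1) (OneCell.mk g)) fg at h1
    change BicatComp 0 1 fg (P.unit.map (n := 1) (OneCell.mk h)) l at h2
    change BicatComp 0 1 (P.unit.map (n := 1) (OneCell.mk g))
      (P.unit.map (n := 1) (OneCell.mk h)) gh at h3
    change BicatComp 0 1 (P.unit.map (n := 1) (OneCell.mk f)) gh r at h4
    rw [hf, hg] at h1
    rw [hg, hh] at h3
    -- Composites are unique, so the given composites are the two bracketings of the lifts. The
    -- associator of the free bicategory is invertible, hence a bridge between them.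
    obtain rfl := (bicatMagma.obj P.obj).comp_unique Nat.zero_lt_one h1 (.one f' g')
    obtain rfl := (bicatMagma.obj P.obj).comp_unique Nat.zero_lt_one h3 (.one g' h')
    rw [hh] at h2
    rw [hf] at h4
    obtain rfl := (bicatMagma.obj P.obj).comp_unique Nat.zero_lt_one h2 (.one (f' ≫ g') h')
    obtain rfl := (bicatMagma.obj P.obj).comp_unique Nat.zero_lt_one h4 (.one f' (g' ≫ h'))
    refine ⟨TwoCell.mk (α_ f' g' h').hom, ⟨_, _, _, _, _, inferInstance, rfl, rfl, rfl⟩, ?_⟩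
    exact (preservesCoherence_map (counit P)).associator f' g' h'
      ((congrArg _ hf).symm.trans (counit_unit P (n := 1) (OneCell.mk f)))
      ((congrArg _ hg).symm.trans (counit_unit P (n := 1) (OneCell.mk g)))
      ((congrArg _ hh).symm.trans (counit_unit P (n := 1) (OneCell.mk h)))
  leftUnitor {a b} f l h1 := by
    obtain ⟨f', hf⟩ := exists_unit_rep P f
    change BicatComp 0 1 (OneCell.mk (𝟙 (unitObj P a)))
      (P.unit.map (n := 1) (OneCell.mk f)) l at h1
    rw [hf] at h1
    obtain rfl := (bicatMagma.obj P.obj).comp_unique Nat.zero_lt_one h1 (.one (𝟙 _) f')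
    refine ⟨TwoCell.mk (λ_ f').hom, ⟨_, _, _, _, _, inferInstance, rfl, hf, rfl⟩, ?_⟩
    exact (preservesCoherence_map (counit P)).leftUnitor f'
      ((congrArg _ hf).symm.trans (counit_unit P (n := 1) (OneCell.mk f)))
  rightUnitor {a b} f l h1 := by
    obtain ⟨f', hf⟩ := exists_unit_rep P f
    change BicatComp 0 1 (P.unit.map (n := 1) (OneCell.mk f))
      (OneCell.mk (𝟙 (unitObj P b))) l at h1
    rw [hf] at h1
    obtain rfl := (bicatMagma.obj P.obj).comp_unique Nat.zero_lt_one h1 (.one f' (𝟙 _))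
    refine ⟨TwoCell.mk (ρ_ f').hom, ⟨_, _, _, _, _, inferInstance, rfl, hf, rfl⟩, ?_⟩
    exact (preservesCoherence_map (counit P)).rightUnitor f'
      ((congrArg _ hf).symm.trans (counit_unit P (n := 1) (OneCell.mk f)))

end FreeProperties

/-- A morphism of omega magmas from the underlying magma of a diagram to a bicategory is coherent
if it sends the images under `lam` of the bridge cells between the composites of lifted 1-cells to
associators and unitors. -/
structure Diagram.IsCoherent (X : Diagram.{u}) {Z : Bicat.{u}} (F : X.X1 ⟶ bicatMagma.obj Z) :
    Prop where
  associator : ∀ {f g h : X.X1.cell 1} {fg gh l r : X.X2.cell 1} {t : X.X2.cell 2},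
    X.X2.Comp Nat.zero_lt_one (X.rho.map f) (X.rho.map g) fg →
    X.X2.Comp Nat.zero_lt_one fg (X.rho.map h) l →
    X.X2.Comp Nat.zero_lt_one (X.rho.map g) (X.rho.map h) gh →
    X.X2.Comp Nat.zero_lt_one (X.rho.map f) gh r → X.R 1 l r t →
    ∀ {a b c d : Z.carrier} {f' : a ⟶ b} {g' : b ⟶ c} {h' : c ⟶ d}, F.map f = OneCell.mk f' →
      F.map g = OneCell.mk g' → F.map h = OneCell.mk h' →
        F.map (X.lam.map t) = TwoCell.mk (α_ f' g' h').hom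
  leftUnitor : ∀ {f : X.X1.cell 1} {l : X.X2.cell 1} {t : X.X2.cell 2},
    X.X2.Comp Nat.zero_lt_one (X.X2.ide (X.rho.map (X.X1.dom f))) (X.rho.map f) l →
    X.R 1 l (X.rho.map f) t → ∀ {a b : Z.carrier} {f' : a ⟶ b}, F.map f = OneCell.mk f' →
      F.map (X.lam.map t) = TwoCell.mk (λ_ f').hom
  rightUnitor : ∀ {f : X.X1.cell 1} {l : X.X2.cell 1} {t : X.X2.cell 2},
    X.X2.Comp Nat.zero_lt_one (X.rho.map f) (X.X2.ide (X.rho.map (X.X1.cod f))) l →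
    X.R 1 l (X.rho.map f) t → ∀ {a b : Z.carrier} {f' : a ⟶ b}, F.map f = OneCell.mk f' →
      F.map (X.lam.map t) = TwoCell.mk (ρ_ f').hom

/-! ### Invertible 2-cells from bridges in a weak 2-category -/

section WeakTwoCategory

variable {X : Diagram.{u}} (hX : X.IsWeakNCat 2)

section
include hX

theorem lam_rho {n : ℕ} (x : X.X1.cell n) : X.lam.map (X.rho.map x) = x :=
  congrArg (fun K : magmaGraph.obj X.X1 ⟶ magmaGraph.obj X.X1 => K.map x) hX.split

/-- Parallel 2-cells with the same image under `kap` have the same image under `lam`. -/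
theorem lam_eq_of_kap_eq {x y : X.X2.cell 2} (hp : X.X2.Parallel x y)
    (h : X.kap.map x = X.kap.map y) : X.lam.map x = X.lam.map y := by
  -- The bridge 3-cell `s` between `x` and `y` becomes an identity in the 2-skeletal magma `X1`,
  -- which forces its two boundaries to agree.
  obtain ⟨s, hs⟩ := hX.penon.lift hp h
  obtain ⟨-, h1, h2⟩ := hX.bridge.boundary hs
  obtain ⟨z, hz⟩ := hX.skeletal 2 le_rfl (X.lam.map s)
  rw [← h1, ← h2, X.lam.map_dom, X.lam.map_cod, hz, X.X1.dom_ide, X.X1.cod_ide]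

theorem exists_bridge_hom {a b : Trunc X.X1} {f g : a ⟶ b} {l r : X.X2.cell 1}
    (hp : X.X2.Parallel l r) (hk : X.kap.map l = X.kap.map r) (hl : X.lam.map l = f.1)
    (hr : X.lam.map r = g.1) : ∃ (x : Trunc.Hom₂ f g) (t : X.X2.cell 2),
      X.R 1 l r t ∧ x.1 = X.lam.map t := by
  obtain ⟨t, ht⟩ := hX.penon.lift hp hk
  obtain ⟨-, h1, h2⟩ := hX.bridge.boundary ht
  exact ⟨⟨X.lam.map t, by rw [← X.lam.map_dom, h1, hl], by rw [← X.lam.map_cod, h2, hr]⟩, t, ht,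
    rfl⟩

/-- In `X2` the composite of two opposite bridges is parallel to the identity on `l`, and `kap`
sends both to the same identity; `lam_eq_of_kap_eq` then equates their images in `X1`. -/
theorem vcomp_bridge {a b : Trunc X.X1} {f g : a ⟶ b} {x : Trunc.Hom₂ f g} {y : Trunc.Hom₂ g f}
    {l r : X.X2.cell 1} {t s : X.X2.cell 2} (ht : X.R 1 l r t) (hs : X.R 1 r l s)
    (hx : x.1 = X.lam.map t) (hy : y.1 = X.lam.map s) :
    Trunc.vcomp x y = Trunc.idTwo f := by
  obtain ⟨-, t1, t2⟩ := hX.bridge.boundary ht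
  obtain ⟨-, s1, s2⟩ := hX.bridge.boundary hs
  obtain ⟨k1, k2⟩ := hX.penon.collapse ht
  obtain ⟨k3, k4⟩ := hX.penon.collapse hs
  obtain ⟨z, hz⟩ := X.X2.comp_exists Nat.one_lt_two t s
    (Trunc.composable_vertical (t2.trans s1.symm))
  obtain ⟨z1, z2⟩ := X.X2.comp_boundary hz
  have hl : X.lam.map l = f.1 := by rw [← t1, X.lam.map_dom, ← hx, x.2.1]
  have hk : X.kap.map z = X.kap.map (X.X2.ide l) := by
    have h1 := X.kap.map_comp _ hz
    rw [k2, k4, ← k1] at h1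
    have h2 := hX.strict.ide_comp Nat.one_lt_two (X.X3.ide (X.kap.map l))
    rw [X.X3.domTo_two_one, X.X3.ideTo_two_one, X.X3.dom_ide] at h2
    rw [X.kap.map_ide]
    exact X.X3.comp_unique _ h1 h2
  have hp : X.X2.Parallel (i := 2) z (X.X2.ide l) :=
    ⟨by rw [z1, t1, X.X2.dom_ide], by rw [z2, s2, X.X2.cod_ide]⟩
  apply Subtype.ext
  refine X.X1.comp_unique _ (Trunc.vcomp_spec x y) ?_
  have h3 := X.lam.map_comp _ hz
  rw [lam_eq_of_kap_eq hX hp hk, X.lam.map_ide, hl, ← hx, ← hy] at h3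
  exact h3

/-- The 2-cells given by the bridges between two parallel 1-cells of `X2`. -/
theorem exists_bridge_iso {a b : Trunc X.X1} {f g : a ⟶ b} {l r : X.X2.cell 1}
    (hp : X.X2.Parallel l r) (hk : X.kap.map l = X.kap.map r) (hl : X.lam.map l = f.1)
    (hr : X.lam.map r = g.1) : ∃ (x : Trunc.Hom₂ f g) (y : Trunc.Hom₂ g f),
      (∃ t : X.X2.cell 2, X.R 1 l r t ∧ x.1 = X.lam.map t) ∧
      Trunc.vcomp x y = Trunc.idTwo f ∧ Trunc.vcomp y x = Trunc.idTwo g := by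
  obtain ⟨x, t, ht, hx⟩ := exists_bridge_hom hX hp hk hl hr
  obtain ⟨y, s, hs, hy⟩ := exists_bridge_hom hX (f := g) (g := f) ⟨hp.1.symm, hp.2.symm⟩
    hk.symm hr hl
  exact ⟨x, y, ⟨t, ht, hx⟩, vcomp_bridge hX ht hs hx hy, vcomp_bridge hX hs ht hy hx⟩

end

theorem rho_composable {a b c : Trunc X.X1} (f : a ⟶ b) (g : b ⟶ c) :
    X.X2.cod (X.rho.map f.1) = X.X2.dom (X.rho.map g.1) :=
  (X.rho.map_cod f.1).symm.trans ((congrArg X.rho.map (f.2.2.trans g.2.1.symm)).trans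
    (X.rho.map_dom g.1))

/-- `l` is a composite of lifts of `f` and `g`. -/
theorem lam_comp {a b c : Trunc X.X1} {f : a ⟶ b} {g : b ⟶ c} {x y z : X.X2.cell 1}
    (h : X.X2.Comp Nat.zero_lt_one x y z) (hx : X.lam.map x = f.1) (hy : X.lam.map y = g.1) :
    X.lam.map z = (f ≫ g).1 := by
  have := X.lam.map_comp _ h
  rw [hx, hy] at this
  exact X.X1.comp_unique _ this (Trunc.comp_spec f g)

include hX

theorem exists_associator {a b c d : Trunc X.X1} (f : a ⟶ b) (g : b ⟶ c) (h : c ⟶ d) :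
    ∃ (x : Trunc.Hom₂ ((f ≫ g) ≫ h) (f ≫ g ≫ h)) (y : Trunc.Hom₂ (f ≫ g ≫ h) ((f ≫ g) ≫ h)),
      (∃ (fg gh l r : X.X2.cell 1) (t : X.X2.cell 2),
        X.X2.Comp Nat.zero_lt_one (X.rho.map f.1) (X.rho.map g.1) fg ∧
        X.X2.Comp Nat.zero_lt_one fg (X.rho.map h.1) l ∧
        X.X2.Comp Nat.zero_lt_one (X.rho.map g.1) (X.rho.map h.1) gh ∧
        X.X2.Comp Nat.zero_lt_one (X.rho.map f.1) gh r ∧ X.R 1 l r t ∧ x.1 = X.lam.map t) ∧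
      Trunc.vcomp x y = Trunc.idTwo _ ∧ Trunc.vcomp y x = Trunc.idTwo _ := by
  obtain ⟨fg, h1⟩ := X.X2.comp_exists Nat.zero_lt_one _ _
    (Trunc.composable_one (rho_composable f g))
  obtain ⟨gh, h3⟩ := X.X2.comp_exists Nat.zero_lt_one _ _
    (Trunc.composable_one (rho_composable g h))
  obtain ⟨b1, b2⟩ := X.X2.comp_boundary h1
  obtain ⟨b3, b4⟩ := X.X2.comp_boundary h3
  obtain ⟨l, h2⟩ := X.X2.comp_exists Nat.zero_lt_one fg (X.rho.map h.1)
    (Trunc.composable_one (b2.trans (rho_composable g h)))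
  obtain ⟨r, h4⟩ := X.X2.comp_exists Nat.zero_lt_one (X.rho.map f.1) gh
    (Trunc.composable_one ((rho_composable f g).trans b3.symm))
  obtain ⟨b5, b6⟩ := X.X2.comp_boundary h2
  obtain ⟨b7, b8⟩ := X.X2.comp_boundary h4
  obtain ⟨x, y, ⟨t, ht, hx⟩, hxy, hyx⟩ := exists_bridge_iso hX (f := (f ≫ g) ≫ h)
    (g := f ≫ g ≫ h) (l := l) (r := r)
    ⟨by rw [b5, b1, b7], by rw [b6, b8, b4]⟩
    -- The two bracketings in `X2` need not be equal, but associativity in `X3` makes their images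
    -- under `kap` equal, so a bridge joins them.
    (hX.strict.assoc _ (X.kap.map_comp _ h1) (X.kap.map_comp _ h2) (X.kap.map_comp _ h3)
      (X.kap.map_comp _ h4))
    (lam_comp h2 (lam_comp h1 (lam_rho hX _) (lam_rho hX _)) (lam_rho hX _))
    (lam_comp h4 (lam_rho hX _) (lam_comp h3 (lam_rho hX _) (lam_rho hX _)))
  exact ⟨x, y, ⟨fg, gh, l, r, t, h1, h2, h3, h4, ht, hx⟩, hxy, hyx⟩

theorem exists_ide_comp {x : X.X2.cell 1} {y : X.X2.cell 0} (h : X.X2.dom x = y) :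
    ∃ l, X.X2.Comp Nat.zero_lt_one (X.X2.ide y) x l ∧ X.X2.Parallel l x ∧
      X.kap.map l = X.kap.map x := by
  subst h
  obtain ⟨l, h1⟩ := X.X2.comp_exists Nat.zero_lt_one (X.X2.ide (X.X2.dom x)) x
    (Trunc.composable_one (X.X2.cod_ide _))
  obtain ⟨b1, b2⟩ := X.X2.comp_boundary h1
  refine ⟨l, h1, ⟨b1.trans (X.X2.dom_ide _), b2⟩, ?_⟩
  have h2 := X.kap.map_comp _ h1
  have h3 := hX.strict.ide_comp Nat.zero_lt_one (X.kap.map x)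
  rw [X.X3.domTo_one_zero, X.X3.ideTo_one_zero] at h3
  rw [X.kap.map_ide, X.kap.map_dom] at h2
  exact X.X3.comp_unique _ h2 h3

theorem exists_comp_ide {x : X.X2.cell 1} {y : X.X2.cell 0} (h : X.X2.cod x = y) :
    ∃ l, X.X2.Comp Nat.zero_lt_one x (X.X2.ide y) l ∧ X.X2.Parallel l x ∧
      X.kap.map l = X.kap.map x := by
  subst h
  obtain ⟨l, h1⟩ := X.X2.comp_exists Nat.zero_lt_one x (X.X2.ide (X.X2.cod x))
    (Trunc.composable_one (X.X2.dom_ide _).symm)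
  obtain ⟨b1, b2⟩ := X.X2.comp_boundary h1
  refine ⟨l, h1, ⟨b1, b2.trans (X.X2.cod_ide _)⟩, ?_⟩
  have h2 := X.kap.map_comp _ h1
  have h3 := hX.strict.comp_ide Nat.zero_lt_one (X.kap.map x)
  rw [X.X3.codTo_one_zero, X.X3.ideTo_one_zero] at h3
  rw [X.kap.map_ide, X.kap.map_cod] at h2
  exact X.X3.comp_unique _ h2 h3

theorem exists_leftUnitor {a b : Trunc X.X1} (f : a ⟶ b) :
    ∃ (x : Trunc.Hom₂ (𝟙 a ≫ f) f) (y : Trunc.Hom₂ f (𝟙 a ≫ f)),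
      (∃ (l : X.X2.cell 1) (t : X.X2.cell 2),
        X.X2.Comp Nat.zero_lt_one (X.X2.ide (X.rho.map (X.X1.dom f.1))) (X.rho.map f.1) l ∧
        X.R 1 l (X.rho.map f.1) t ∧ x.1 = X.lam.map t) ∧
      Trunc.vcomp x y = Trunc.idTwo _ ∧ Trunc.vcomp y x = Trunc.idTwo _ := by
  obtain ⟨l, h1, hp, hk⟩ := exists_ide_comp hX (X.rho.map_dom f.1).symm
  have e : X.lam.map (X.X2.ide (X.rho.map (X.X1.dom f.1))) = (𝟙 a : a ⟶ a).1 :=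
    (X.lam.map_ide _).trans (congrArg X.X1.ide ((lam_rho hX _).trans f.2.1))
  obtain ⟨x, y, ⟨t, ht, hx⟩, hxy, hyx⟩ := exists_bridge_iso hX (f := 𝟙 a ≫ f) (g := f) hp hk
    (lam_comp h1 e (lam_rho hX _)) (lam_rho hX _)
  exact ⟨x, y, ⟨l, t, h1, ht, hx⟩, hxy, hyx⟩

theorem exists_rightUnitor {a b : Trunc X.X1} (f : a ⟶ b) :
    ∃ (x : Trunc.Hom₂ (f ≫ 𝟙 b) f) (y : Trunc.Hom₂ f (f ≫ 𝟙 b)),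
      (∃ (l : X.X2.cell 1) (t : X.X2.cell 2),
        X.X2.Comp Nat.zero_lt_one (X.rho.map f.1) (X.X2.ide (X.rho.map (X.X1.cod f.1))) l ∧
        X.R 1 l (X.rho.map f.1) t ∧ x.1 = X.lam.map t) ∧
      Trunc.vcomp x y = Trunc.idTwo _ ∧ Trunc.vcomp y x = Trunc.idTwo _ := by
  obtain ⟨l, h1, hp, hk⟩ := exists_comp_ide hX (X.rho.map_cod f.1).symm
  have e : X.lam.map (X.X2.ide (X.rho.map (X.X1.cod f.1))) = (𝟙 b : b ⟶ b).1 :=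
    (X.lam.map_ide _).trans (congrArg X.X1.ide ((lam_rho hX _).trans f.2.2))
  obtain ⟨x, y, ⟨t, ht, hx⟩, hxy, hyx⟩ := exists_bridge_iso hX (f := f ≫ 𝟙 b) (g := f) hp hk
    (lam_comp h1 (lam_rho hX _) e) (lam_rho hX _)
  exact ⟨x, y, ⟨l, t, h1, ht, hx⟩, hxy, hyx⟩

end WeakTwoCategory

/-! ### Evaluation of 1-cells and 2-cells of a magma in a bicategory -/

section Evaluation

variable {M : OmegaMagma.{u}} {Z : Bicat.{u}} (F : M ⟶ bicatMagma.obj Z)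

/-- The image of a 0-cell. -/
def evalObj (a : Trunc M) : Z.carrier := F.map (n := 0) a

theorem exists_eval_one {a b : Trunc M} (f : a ⟶ b) :
    ∃ f' : evalObj F a ⟶ evalObj F b, F.map f.1 = OneCell.mk f' :=
  map_one_exists_rep F f.1 (congrArg F.map f.2.1) (congrArg F.map f.2.2)

variable {a b c : Trunc M} {a' b' c' : Z.carrier}

theorem exists_eval_two {f g : a ⟶ b} (x : Trunc.Hom₂ f g) {f' g' : a' ⟶ b'}
    (hf : F.map f.1 = OneCell.mk f') (hg : F.map g.1 = OneCell.mk g') :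
    ∃ x' : f' ⟶ g', F.map x.1 = TwoCell.mk x' :=
  map_two_exists_rep F x.1 ((congrArg F.map x.2.1).trans hf) ((congrArg F.map x.2.2).trans hg)

variable {F}

theorem eval_comp {f : a ⟶ b} {g : b ⟶ c} {f' : a' ⟶ b'} {g' : b' ⟶ c'}
    (hf : F.map f.1 = OneCell.mk f') (hg : F.map g.1 = OneCell.mk g') :
    F.map (f ≫ g).1 = OneCell.mk (f' ≫ g') :=
  map_comp_one F (Trunc.comp_spec f g) hf hg

theorem eval_vcomp {f g h : a ⟶ b} {x : Trunc.Hom₂ f g} {y : Trunc.Hom₂ g h} {f' g' h' : a' ⟶ b'}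
    {x' : f' ⟶ g'} {y' : g' ⟶ h'} (hx : F.map x.1 = TwoCell.mk x')
    (hy : F.map y.1 = TwoCell.mk y') :
    F.map (Trunc.vcomp x y).1 = TwoCell.mk (x' ≫ y') :=
  map_comp_vertical F (Trunc.vcomp_spec x y) hx hy

theorem eval_idTwo {f : a ⟶ b} {f' : a' ⟶ b'} (hf : F.map f.1 = OneCell.mk f') :
    F.map (Trunc.idTwo f).1 = TwoCell.mk (𝟙 f') :=
  map_ide_one F hf

theorem eval_whiskerLeft {f : a ⟶ b} {g h : b ⟶ c} {x : Trunc.Hom₂ g h} {f' : a' ⟶ b'}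
    {g' h' : b' ⟶ c'} {x' : g' ⟶ h'} (hf : F.map f.1 = OneCell.mk f')
    (hx : F.map x.1 = TwoCell.mk x') :
    F.map (Trunc.hcomp (Trunc.idTwo f) x).1 = TwoCell.mk (f' ◁ x') := by
  have := map_comp_horizontal F (Trunc.hcomp_spec (Trunc.idTwo f) x) (eval_idTwo hf) hx
  simpa using this

theorem eval_whiskerRight {f g : a ⟶ b} {h : b ⟶ c} {x : Trunc.Hom₂ f g} {f' g' : a' ⟶ b'}
    {h' : b' ⟶ c'} {x' : f' ⟶ g'} (hx : F.map x.1 = TwoCell.mk x')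
    (hh : F.map h.1 = OneCell.mk h') :
    F.map (Trunc.hcomp x (Trunc.idTwo h)).1 = TwoCell.mk (x' ▷ h') := by
  have := map_comp_horizontal F (Trunc.hcomp_spec x (Trunc.idTwo h)) hx (eval_idTwo hh)
  simpa using this

/-- A right inverse of an isomorphism is its inverse; so only the forward associators and unitors
appear in the definition of coherence of a morphism. -/
theorem eval_inv {f g : a ⟶ b} {x : Trunc.Hom₂ f g} {y : Trunc.Hom₂ g f}
    (hxy : Trunc.vcomp x y = Trunc.idTwo f) {f' g' : a' ⟶ b'} {η : f' ≅ g'}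
    (hf : F.map f.1 = OneCell.mk f') (hg : F.map g.1 = OneCell.mk g')
    (hx : F.map x.1 = TwoCell.mk η.hom) : F.map y.1 = TwoCell.mk η.inv := by
  obtain ⟨θ, hθ⟩ := exists_eval_two F y hg hf
  have h := eval_vcomp hx hθ
  rw [hxy, eval_idTwo hf] at h
  have h' := TwoCell.mk_inj.1 h
  rw [hθ, ← Category.comp_id η.inv, h', Iso.inv_hom_id_assoc]

end Evaluation

/-! ### The bicategory presented by a weak 2-category -/

section Realization

variable {X : Diagram.{u}} (hX : X.IsWeakNCat 2)

/-- Two 2-cells are identified if all coherent morphisms to bicategories identify them. -/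
instance realSetoid {a b : Trunc X.X1} (f g : a ⟶ b) : Setoid (Trunc.Hom₂ f g) where
  -- As for the free bicategory, equality is semantic: an axiom holds in the quotient because it
  -- holds in every bicategory `Z` after evaluation by a coherent `F`. Only 2-cells are identified,
  -- since no axiom equates 1-cells.
  r x y := ∀ (Z : Bicat.{u}) (F : X.X1 ⟶ bicatMagma.obj Z), X.IsCoherent F → F.map x.1 = F.map y.1
  iseqv := ⟨fun _ _ _ _ => rfl, fun h Z F hF => (h Z F hF).symm,
    fun h k Z F hF => (h Z F hF).trans (k Z F hF)⟩

/-- The 2-cells of the bicategory presented by a weak 2-category. -/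
def RealHom {a b : Trunc X.X1} (f g : a ⟶ b) : Type u := Quotient (realSetoid f g)

/-- The class of a 2-cell. -/
def RealHom.mk {a b : Trunc X.X1} {f g : a ⟶ b} (x : Trunc.Hom₂ f g) : RealHom f g := ⟦x⟧

theorem RealHom.exists_rep {a b : Trunc X.X1} {f g : a ⟶ b} (x : RealHom f g) :
    ∃ y, x = RealHom.mk y := by
  obtain ⟨y, rfl⟩ := Quotient.exists_rep x
  exact ⟨y, rfl⟩

theorem RealHom.sound {a b : Trunc X.X1} {f g : a ⟶ b} {x y : Trunc.Hom₂ f g}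
    (h : ∀ (Z : Bicat.{u}) (F : X.X1 ⟶ bicatMagma.obj Z), X.IsCoherent F →
      F.map x.1 = F.map y.1) : RealHom.mk x = RealHom.mk y := Quotient.sound h

/-- The hom categories of the bicategory presented by a weak 2-category. -/
@[reducible]
noncomputable def realHomCategory (a b : Trunc X.X1) : Category.{u} (a ⟶ b) where
  Hom f g := RealHom f g
  id f := RealHom.mk (Trunc.idTwo f)
  comp {f g h} x y := Quotient.map₂ Trunc.vcomp (fun x₁ x₂ hx y₁ y₂ hy Z F hF => by
    obtain ⟨f', hf⟩ := exists_eval_one F f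
    obtain ⟨g', hg⟩ := exists_eval_one F g
    obtain ⟨h', hh⟩ := exists_eval_one F h
    obtain ⟨x', hx'⟩ := exists_eval_two F x₁ hf hg
    obtain ⟨y', hy'⟩ := exists_eval_two F y₁ hg hh
    exact (eval_vcomp hx' hy').trans
      (eval_vcomp ((hx Z F hF).symm.trans hx') ((hy Z F hF).symm.trans hy')).symm) x y
  id_comp {f g} x := by
    obtain ⟨x, rfl⟩ := RealHom.exists_rep x
    refine RealHom.sound fun Z F hF => ?_
    obtain ⟨f', hf⟩ := exists_eval_one F f
    obtain ⟨g', hg⟩ := exists_eval_one F g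
    obtain ⟨x', hx⟩ := exists_eval_two F x hf hg
    exact (eval_vcomp (eval_idTwo hf) hx).trans ((congrArg TwoCell.mk (Category.id_comp x')).trans
      hx.symm)
  comp_id {f g} x := by
    obtain ⟨x, rfl⟩ := RealHom.exists_rep x
    refine RealHom.sound fun Z F hF => ?_
    obtain ⟨f', hf⟩ := exists_eval_one F f
    obtain ⟨g', hg⟩ := exists_eval_one F g
    obtain ⟨x', hx⟩ := exists_eval_two F x hf hg
    exact (eval_vcomp hx (eval_idTwo hg)).trans ((congrArg TwoCell.mk (Category.comp_id x')).trans
      hx.symm)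
  assoc {f g h k} x y z := by
    obtain ⟨x, rfl⟩ := RealHom.exists_rep x
    obtain ⟨y, rfl⟩ := RealHom.exists_rep y
    obtain ⟨z, rfl⟩ := RealHom.exists_rep z
    refine RealHom.sound fun Z F hF => ?_
    obtain ⟨f', hf⟩ := exists_eval_one F f
    obtain ⟨g', hg⟩ := exists_eval_one F g
    obtain ⟨h', hh⟩ := exists_eval_one F h
    obtain ⟨k', hk⟩ := exists_eval_one F k
    obtain ⟨x', hx⟩ := exists_eval_two F x hf hg
    obtain ⟨y', hy⟩ := exists_eval_two F y hg hh
    obtain ⟨z', hz⟩ := exists_eval_two F z hh hk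
    exact (eval_vcomp (eval_vcomp hx hy) hz).trans
      ((congrArg TwoCell.mk (Category.assoc x' y' z')).trans
        (eval_vcomp hx (eval_vcomp hy hz)).symm)

/-- Left whiskering in the bicategory presented by a weak 2-category. -/
noncomputable def realWhiskerLeft {a b c : Trunc X.X1} (f : a ⟶ b) {g h : b ⟶ c}
    (x : RealHom g h) : RealHom (f ≫ g) (f ≫ h) :=
  Quotient.map (fun x => Trunc.hcomp (Trunc.idTwo f) x) (fun x₁ x₂ hx Z F hF => by
    obtain ⟨f', hf⟩ := exists_eval_one F f
    obtain ⟨g', hg⟩ := exists_eval_one F g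
    obtain ⟨h', hh⟩ := exists_eval_one F h
    obtain ⟨x', hx'⟩ := exists_eval_two F x₁ hg hh
    exact (eval_whiskerLeft hf hx').trans
      (eval_whiskerLeft hf ((hx Z F hF).symm.trans hx')).symm) x

/-- Right whiskering in the bicategory presented by a weak 2-category. -/
noncomputable def realWhiskerRight {a b c : Trunc X.X1} {f g : a ⟶ b} (x : RealHom f g)
    (h : b ⟶ c) : RealHom (f ≫ h) (g ≫ h) :=
  Quotient.map (fun x => Trunc.hcomp x (Trunc.idTwo h)) (fun x₁ x₂ hx Z F hF => by
    obtain ⟨f', hf⟩ := exists_eval_one F f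
    obtain ⟨g', hg⟩ := exists_eval_one F g
    obtain ⟨h', hh⟩ := exists_eval_one F h
    obtain ⟨x', hx'⟩ := exists_eval_two F x₁ hf hg
    exact (eval_whiskerRight hx' hh).trans
      (eval_whiskerRight ((hx Z F hF).symm.trans hx') hh).symm) x

/-- The isomorphism given by a pair of inverse 2-cells. -/
@[reducible]
noncomputable def realIso {a b : Trunc X.X1} {f g : a ⟶ b} (x : Trunc.Hom₂ f g)
    (y : Trunc.Hom₂ g f) (hxy : Trunc.vcomp x y = Trunc.idTwo f)
    (hyx : Trunc.vcomp y x = Trunc.idTwo g) : @Iso _ (realHomCategory a b) f g :=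
  @Iso.mk _ (realHomCategory a b) f g (RealHom.mk x) (RealHom.mk y) (congrArg RealHom.mk hxy)
    (congrArg RealHom.mk hyx)

include hX

/-- The associators of a weak 2-category. -/
noncomputable def assocHom {a b c d : Trunc X.X1} (f : a ⟶ b) (g : b ⟶ c) (h : c ⟶ d) :
    Trunc.Hom₂ ((f ≫ g) ≫ h) (f ≫ g ≫ h) := (exists_associator hX f g h).choose

/-- The inverse associators of a weak 2-category. -/
noncomputable def assocInv {a b c d : Trunc X.X1} (f : a ⟶ b) (g : b ⟶ c) (h : c ⟶ d) :
    Trunc.Hom₂ (f ≫ g ≫ h) ((f ≫ g) ≫ h) := (exists_associator hX f g h).choose_spec.choose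

/-- The left unitors of a weak 2-category. -/
noncomputable def leftHom {a b : Trunc X.X1} (f : a ⟶ b) : Trunc.Hom₂ (𝟙 a ≫ f) f :=
  (exists_leftUnitor hX f).choose

/-- The inverse left unitors of a weak 2-category. -/
noncomputable def leftInv {a b : Trunc X.X1} (f : a ⟶ b) : Trunc.Hom₂ f (𝟙 a ≫ f) :=
  (exists_leftUnitor hX f).choose_spec.choose

/-- The right unitors of a weak 2-category. -/
noncomputable def rightHom {a b : Trunc X.X1} (f : a ⟶ b) : Trunc.Hom₂ (f ≫ 𝟙 b) f :=
  (exists_rightUnitor hX f).choose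

/-- The inverse right unitors of a weak 2-category. -/
noncomputable def rightInv {a b : Trunc X.X1} (f : a ⟶ b) : Trunc.Hom₂ f (f ≫ 𝟙 b) :=
  (exists_rightUnitor hX f).choose_spec.choose

section

variable {Z : Bicat.{u}} {F : X.X1 ⟶ bicatMagma.obj Z} (hF : X.IsCoherent F)
  {a b c d : Trunc X.X1} {a' b' c' d' : Z.carrier} {f : a ⟶ b} {g : b ⟶ c} {h : c ⟶ d}
  {f' : a' ⟶ b'} {g' : b' ⟶ c'} {h' : c' ⟶ d'}

omit hX in
theorem eval_id {f : a ⟶ b} {f' : a' ⟶ b'} (hf : F.map f.1 = OneCell.mk f') :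
    F.map (𝟙 a : a ⟶ a).1 = OneCell.mk (𝟙 a') ∧ F.map (𝟙 b : b ⟶ b).1 = OneCell.mk (𝟙 b') := by
  have h1 := F.map_dom f.1
  have h2 := F.map_cod f.1
  rw [hf] at h1 h2
  exact ⟨map_ide_zero F ((congrArg F.map f.2.1).symm.trans h1),
    map_ide_zero F ((congrArg F.map f.2.2).symm.trans h2)⟩

include hF

theorem eval_assocHom (hf : F.map f.1 = OneCell.mk f') (hg : F.map g.1 = OneCell.mk g')
    (hh : F.map h.1 = OneCell.mk h') :
    F.map (assocHom hX f g h).1 = TwoCell.mk (α_ f' g' h').hom := by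
  obtain ⟨fg, gh, l, r, t, h1, h2, h3, h4, ht, hx⟩ :=
    (exists_associator hX f g h).choose_spec.choose_spec.1
  exact (congrArg F.map hx).trans (hF.associator h1 h2 h3 h4 ht hf hg hh)

theorem eval_assocInv (hf : F.map f.1 = OneCell.mk f') (hg : F.map g.1 = OneCell.mk g')
    (hh : F.map h.1 = OneCell.mk h') :
    F.map (assocInv hX f g h).1 = TwoCell.mk (α_ f' g' h').inv :=
  eval_inv (exists_associator hX f g h).choose_spec.choose_spec.2.1
    (eval_comp (eval_comp hf hg) hh) (eval_comp hf (eval_comp hg hh))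
    (eval_assocHom hX hF hf hg hh)

theorem eval_leftHom (hf : F.map f.1 = OneCell.mk f') :
    F.map (leftHom hX f).1 = TwoCell.mk (λ_ f').hom := by
  obtain ⟨l, t, h1, ht, hx⟩ := (exists_leftUnitor hX f).choose_spec.choose_spec.1
  exact (congrArg F.map hx).trans (hF.leftUnitor h1 ht hf)

theorem eval_leftInv (hf : F.map f.1 = OneCell.mk f') :
    F.map (leftInv hX f).1 = TwoCell.mk (λ_ f').inv :=
  eval_inv (exists_leftUnitor hX f).choose_spec.choose_spec.2.1
    (eval_comp (eval_id hf).1 hf) hf (eval_leftHom hX hF hf)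

theorem eval_rightHom (hf : F.map f.1 = OneCell.mk f') :
    F.map (rightHom hX f).1 = TwoCell.mk (ρ_ f').hom := by
  obtain ⟨l, t, h1, ht, hx⟩ := (exists_rightUnitor hX f).choose_spec.choose_spec.1
  exact (congrArg F.map hx).trans (hF.rightUnitor h1 ht hf)

theorem eval_rightInv (hf : F.map f.1 = OneCell.mk f') :
    F.map (rightInv hX f).1 = TwoCell.mk (ρ_ f').inv :=
  eval_inv (exists_rightUnitor hX f).choose_spec.choose_spec.2.1
    (eval_comp hf (eval_id hf).2) hf (eval_rightHom hX hF hf)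

end

/-- The bicategory presented by a weak 2-category. -/
@[reducible]
noncomputable def realBicategory : Bicategory.{u, u} (Trunc X.X1) where
  homCategory := realHomCategory
  whiskerLeft f _ _ x := realWhiskerLeft f x
  whiskerRight x h := realWhiskerRight x h
  associator f g h := realIso (assocHom hX f g h) (assocInv hX f g h)
    (exists_associator hX f g h).choose_spec.choose_spec.2.1
    (exists_associator hX f g h).choose_spec.choose_spec.2.2
  leftUnitor f := realIso (leftHom hX f) (leftInv hX f)
    (exists_leftUnitor hX f).choose_spec.choose_spec.2.1
    (exists_leftUnitor hX f).choose_spec.choose_spec.2.2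
  rightUnitor f := realIso (rightHom hX f) (rightInv hX f)
    (exists_rightUnitor hX f).choose_spec.choose_spec.2.1
    (exists_rightUnitor hX f).choose_spec.choose_spec.2.2
  whiskerLeft_id f g := RealHom.sound fun Z F hF => by
    obtain ⟨f', hf⟩ := exists_eval_one F f
    obtain ⟨g', hg⟩ := exists_eval_one F g
    exact (eval_whiskerLeft hf (eval_idTwo hg)).trans
      ((congrArg TwoCell.mk (Bicategory.whiskerLeft_id f' g')).trans
        (eval_idTwo (eval_comp hf hg)).symm)
  whiskerLeft_comp f g h i x y := by
    obtain ⟨x, rfl⟩ := RealHom.exists_rep x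
    obtain ⟨y, rfl⟩ := RealHom.exists_rep y
    refine RealHom.sound fun Z F hF => ?_
    obtain ⟨f', hf⟩ := exists_eval_one F f
    obtain ⟨g', hg⟩ := exists_eval_one F g
    obtain ⟨h', hh⟩ := exists_eval_one F h
    obtain ⟨i', hi⟩ := exists_eval_one F i
    obtain ⟨x', hx⟩ := exists_eval_two F x hg hh
    obtain ⟨y', hy⟩ := exists_eval_two F y hh hi
    exact (eval_whiskerLeft hf (eval_vcomp hx hy)).trans
      ((congrArg TwoCell.mk (Bicategory.whiskerLeft_comp f' x' y')).trans
        (eval_vcomp (eval_whiskerLeft hf hx) (eval_whiskerLeft hf hy)).symm)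
  id_whiskerLeft {a b f g} x := by
    obtain ⟨x, rfl⟩ := RealHom.exists_rep x
    refine RealHom.sound fun Z F hF => ?_
    obtain ⟨f', hf⟩ := exists_eval_one F f
    obtain ⟨g', hg⟩ := exists_eval_one F g
    obtain ⟨x', hx⟩ := exists_eval_two F x hf hg
    exact (eval_whiskerLeft (eval_id hf).1 hx).trans
      ((congrArg TwoCell.mk (Bicategory.id_whiskerLeft x')).trans
        (eval_vcomp (eval_leftHom hX hF hf) (eval_vcomp hx (eval_leftInv hX hF hg))).symm)
  comp_whiskerLeft f g h i x := by
    obtain ⟨x, rfl⟩ := RealHom.exists_rep x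
    refine RealHom.sound fun Z F hF => ?_
    obtain ⟨f', hf⟩ := exists_eval_one F f
    obtain ⟨g', hg⟩ := exists_eval_one F g
    obtain ⟨h', hh⟩ := exists_eval_one F h
    obtain ⟨i', hi⟩ := exists_eval_one F i
    obtain ⟨x', hx⟩ := exists_eval_two F x hh hi
    exact (eval_whiskerLeft (eval_comp hf hg) hx).trans
      ((congrArg TwoCell.mk (Bicategory.comp_whiskerLeft f' g' x')).trans
        (eval_vcomp (eval_assocHom hX hF hf hg hh)
          (eval_vcomp (eval_whiskerLeft hf (eval_whiskerLeft hg hx))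
            (eval_assocInv hX hF hf hg hi))).symm)
  id_whiskerRight f g := RealHom.sound fun Z F hF => by
    obtain ⟨f', hf⟩ := exists_eval_one F f
    obtain ⟨g', hg⟩ := exists_eval_one F g
    exact (eval_whiskerRight (eval_idTwo hf) hg).trans
      ((congrArg TwoCell.mk (Bicategory.id_whiskerRight f' g')).trans
        (eval_idTwo (eval_comp hf hg)).symm)
  comp_whiskerRight {a b c f g h} x y i := by
    obtain ⟨x, rfl⟩ := RealHom.exists_rep x
    obtain ⟨y, rfl⟩ := RealHom.exists_rep y
    refine RealHom.sound fun Z F hF => ?_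
    obtain ⟨f', hf⟩ := exists_eval_one F f
    obtain ⟨g', hg⟩ := exists_eval_one F g
    obtain ⟨h', hh⟩ := exists_eval_one F h
    obtain ⟨i', hi⟩ := exists_eval_one F i
    obtain ⟨x', hx⟩ := exists_eval_two F x hf hg
    obtain ⟨y', hy⟩ := exists_eval_two F y hg hh
    exact (eval_whiskerRight (eval_vcomp hx hy) hi).trans
      ((congrArg TwoCell.mk (Bicategory.comp_whiskerRight x' y' i')).trans
        (eval_vcomp (eval_whiskerRight hx hi) (eval_whiskerRight hy hi)).symm)
  whiskerRight_id {a b f g} x := by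
    obtain ⟨x, rfl⟩ := RealHom.exists_rep x
    refine RealHom.sound fun Z F hF => ?_
    obtain ⟨f', hf⟩ := exists_eval_one F f
    obtain ⟨g', hg⟩ := exists_eval_one F g
    obtain ⟨x', hx⟩ := exists_eval_two F x hf hg
    exact (eval_whiskerRight hx (eval_id hf).2).trans
      ((congrArg TwoCell.mk (Bicategory.whiskerRight_id x')).trans
        (eval_vcomp (eval_rightHom hX hF hf) (eval_vcomp hx (eval_rightInv hX hF hg))).symm)
  whiskerRight_comp {a b c d f i} x g h := by
    obtain ⟨x, rfl⟩ := RealHom.exists_rep x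
    refine RealHom.sound fun Z F hF => ?_
    obtain ⟨f', hf⟩ := exists_eval_one F f
    obtain ⟨g', hg⟩ := exists_eval_one F g
    obtain ⟨h', hh⟩ := exists_eval_one F h
    obtain ⟨i', hi⟩ := exists_eval_one F i
    obtain ⟨x', hx⟩ := exists_eval_two F x hf hi
    exact (eval_whiskerRight hx (eval_comp hg hh)).trans
      ((congrArg TwoCell.mk (Bicategory.whiskerRight_comp x' g' h')).trans
        (eval_vcomp (eval_assocInv hX hF hf hg hh)
          (eval_vcomp (eval_whiskerRight (eval_whiskerRight hx hg) hh)
            (eval_assocHom hX hF hi hg hh))).symm)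
  whisker_assoc f g i x h := by
    obtain ⟨x, rfl⟩ := RealHom.exists_rep x
    refine RealHom.sound fun Z F hF => ?_
    obtain ⟨f', hf⟩ := exists_eval_one F f
    obtain ⟨g', hg⟩ := exists_eval_one F g
    obtain ⟨h', hh⟩ := exists_eval_one F h
    obtain ⟨i', hi⟩ := exists_eval_one F i
    obtain ⟨x', hx⟩ := exists_eval_two F x hg hi
    exact (eval_whiskerRight (eval_whiskerLeft hf hx) hh).trans
      ((congrArg TwoCell.mk (Bicategory.whisker_assoc f' x' h')).trans
        (eval_vcomp (eval_assocHom hX hF hf hg hh)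
          (eval_vcomp (eval_whiskerLeft hf (eval_whiskerRight hx hh))
            (eval_assocInv hX hF hf hi hh))).symm)
  whisker_exchange {a b c f g h i} x y := by
    obtain ⟨x, rfl⟩ := RealHom.exists_rep x
    obtain ⟨y, rfl⟩ := RealHom.exists_rep y
    refine RealHom.sound fun Z F hF => ?_
    obtain ⟨f', hf⟩ := exists_eval_one F f
    obtain ⟨g', hg⟩ := exists_eval_one F g
    obtain ⟨h', hh⟩ := exists_eval_one F h
    obtain ⟨i', hi⟩ := exists_eval_one F i
    obtain ⟨x', hx⟩ := exists_eval_two F x hf hg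
    obtain ⟨y', hy⟩ := exists_eval_two F y hh hi
    exact (eval_vcomp (eval_whiskerLeft hf hy) (eval_whiskerRight hx hi)).trans
      ((congrArg TwoCell.mk (Bicategory.whisker_exchange x' y')).trans
        (eval_vcomp (eval_whiskerRight hx hh) (eval_whiskerLeft hg hy)).symm)
  pentagon f g h i := RealHom.sound fun Z F hF => by
    obtain ⟨f', hf⟩ := exists_eval_one F f
    obtain ⟨g', hg⟩ := exists_eval_one F g
    obtain ⟨h', hh⟩ := exists_eval_one F h
    obtain ⟨i', hi⟩ := exists_eval_one F i
    exact (eval_vcomp (eval_whiskerRight (eval_assocHom hX hF hf hg hh) hi)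
      (eval_vcomp (eval_assocHom hX hF hf (eval_comp hg hh) hi)
        (eval_whiskerLeft hf (eval_assocHom hX hF hg hh hi)))).trans
      ((congrArg TwoCell.mk (Bicategory.pentagon f' g' h' i')).trans
        -- The associator at `f ≫ g` comes from the lift of that composite, not from the composite
        -- of the lifts. A coherent morphism still sends it to the associator at `f' ≫ g'`, and
        -- there the pentagon is available.
        (eval_vcomp (eval_assocHom hX hF (eval_comp hf hg) hh hi)
          (eval_assocHom hX hF hf hg (eval_comp hh hi))).symm)
  triangle f g := RealHom.sound fun Z F hF => by
    obtain ⟨f', hf⟩ := exists_eval_one F f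
    obtain ⟨g', hg⟩ := exists_eval_one F g
    exact (eval_vcomp (eval_assocHom hX hF hf (eval_id hf).2 hg)
      (eval_whiskerLeft hf (eval_leftHom hX hF hg))).trans
      ((congrArg TwoCell.mk (Bicategory.triangle f' g')).trans
        (eval_whiskerRight (eval_rightHom hX hF hf) hg).symm)

end Realization

/-- The bicategory presented by a weak 2-category. -/
noncomputable def realization {X : Diagram.{u}} (hX : X.IsWeakNCat 2) : Bicat.{u} :=
  @Bicat.mk (Trunc X.X1) (realBicategory hX)

theorem bicatComp_succ {B : Type u} [Bicategory.{u, u} B] {i n : ℕ} {x y z : TwoCell B}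
    (h : BicatComp i (n + 2) x y z) : BicatComp (B := B) i (n + 3) x y z := by
  cases h with
  | horizontal n η θ => exact .horizontal (n + 1) η θ
  | vertical n η θ => exact .vertical (n + 1) η θ
  | identity i n h => exact .identity i (n + 1) (Nat.le_succ_of_le h) x

/-! ### The projection onto the presented bicategory -/

section Unit

variable {X : Diagram.{u}} (hX : X.IsWeakNCat 2)

/-- A 1-cell of the underlying magma as a 1-cell of the bicategory. -/
noncomputable def realOne (f : X.X1.cell 1) : OneCell (realization hX).carrier :=
  @OneCell.mk (Trunc X.X1) (realBicategory hX) (X.X1.dom f) (X.X1.cod f) ⟨f, rfl, rfl⟩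

/-- A 2-cell of the underlying magma as a 2-cell of the bicategory. -/
noncomputable def realTwo (x : X.X1.cell 2) : TwoCell (realization hX).carrier :=
  @TwoCell.mk (Trunc X.X1) (realBicategory hX) (X.X1.dom (X.X1.dom x)) (X.X1.cod (X.X1.dom x))
    ⟨X.X1.dom x, rfl, rfl⟩ ⟨X.X1.cod x, (X.X1.dom_dom x).symm, (X.X1.cod_dom x).symm⟩
    (RealHom.mk ⟨x, rfl, rfl⟩)

/-- The cells of the underlying magma as cells of the bicategory. -/
noncomputable def realCell : ∀ {n : ℕ}, X.X1.cell n → bicatCell (realization hX).carrier n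
  | 0 => fun x => x
  | 1 => fun f => realOne hX f
  | 2 => fun x => realTwo hX x
  -- Above dimension 2 every cell of `X1` is an identity, so passing to the domain loses nothing.
  | n + 3 => fun x => realCell (n := n + 2) (X.X1.dom x)

theorem realOne_val {a b : Trunc X.X1} (f : a ⟶ b) :
    realOne hX f.1 = @OneCell.mk (Trunc X.X1) (realBicategory hX) a b f := by
  obtain ⟨f, rfl, rfl⟩ := f
  rfl

theorem realTwo_val {a b : Trunc X.X1} {f g : a ⟶ b} (x : Trunc.Hom₂ f g) :
    realTwo hX x.1 = @TwoCell.mk (Trunc X.X1) (realBicategory hX) a b f g (RealHom.mk x) := by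
  obtain ⟨f, rfl, rfl⟩ := f
  obtain ⟨g, hg1, hg2⟩ := g
  obtain ⟨x, h1, h2⟩ := x
  dsimp only at h1 h2
  subst h1 h2
  rfl

include hX in
theorem dom_eq_cod {n : ℕ} (hn : 2 ≤ n) (x : X.X1.cell (n + 1)) : X.X1.dom x = X.X1.cod x := by
  obtain ⟨y, rfl⟩ := hX.skeletal n hn x
  rw [X.X1.dom_ide, X.X1.cod_ide]

theorem exists_horizontal {x y z : X.X1.cell 2} (h : X.X1.Comp Nat.zero_lt_two x y z) :
    ∃ (a b c : Trunc X.X1) (f f' : a ⟶ b) (g g' : b ⟶ c) (η : Trunc.Hom₂ f f')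
      (θ : Trunc.Hom₂ g g'), x = η.1 ∧ y = θ.1 ∧ z = (Trunc.hcomp η θ).1 := by
  have hc := X.X1.comp_composable _ h
  rw [X.X1.codTo_two_zero, X.X1.domTo_two_zero] at hc
  let f : Trunc.Hom₁ (X.X1.dom (X.X1.dom x)) (X.X1.cod (X.X1.dom x)) := ⟨X.X1.dom x, rfl, rfl⟩
  let f' : Trunc.Hom₁ (X.X1.dom (X.X1.dom x)) (X.X1.cod (X.X1.dom x)) :=
    ⟨X.X1.cod x, (X.X1.dom_dom x).symm, (X.X1.cod_dom x).symm⟩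
  have h1 : X.X1.dom (X.X1.dom y) = X.X1.cod (X.X1.dom x) := by rw [X.X1.cod_dom, hc]
  let g : Trunc.Hom₁ (X.X1.cod (X.X1.dom x)) (X.X1.cod (X.X1.dom y)) := ⟨X.X1.dom y, h1, rfl⟩
  let g' : Trunc.Hom₁ (X.X1.cod (X.X1.dom x)) (X.X1.cod (X.X1.dom y)) :=
    ⟨X.X1.cod y, (X.X1.dom_dom y).symm.trans h1, (X.X1.cod_dom y).symm⟩
  let η : Trunc.Hom₂ f f' := ⟨x, rfl, rfl⟩
  let θ : Trunc.Hom₂ g g' := ⟨y, rfl, rfl⟩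
  exact ⟨_, _, _, f, f', g, g', η, θ, rfl, rfl,
    X.X1.comp_unique _ h (Trunc.hcomp_spec (M := X.X1) η θ)⟩

theorem exists_vertical {x y z : X.X1.cell 2} (h : X.X1.Comp Nat.one_lt_two x y z) :
    ∃ (a b : Trunc X.X1) (f g k : a ⟶ b) (η : Trunc.Hom₂ f g)
      (θ : Trunc.Hom₂ g k), x = η.1 ∧ y = θ.1 ∧ z = (Trunc.vcomp η θ).1 := by
  have hc := X.X1.comp_composable _ h
  rw [X.X1.codTo_two_one, X.X1.domTo_two_one] at hc
  let f : Trunc.Hom₁ (X.X1.dom (X.X1.dom x)) (X.X1.cod (X.X1.dom x)) := ⟨X.X1.dom x, rfl, rfl⟩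
  let g : Trunc.Hom₁ (X.X1.dom (X.X1.dom x)) (X.X1.cod (X.X1.dom x)) :=
    ⟨X.X1.cod x, (X.X1.dom_dom x).symm, (X.X1.cod_dom x).symm⟩
  let k : Trunc.Hom₁ (X.X1.dom (X.X1.dom x)) (X.X1.cod (X.X1.dom x)) :=
    ⟨X.X1.cod y, by rw [← X.X1.dom_dom, ← hc, ← X.X1.dom_dom],
      by rw [← X.X1.cod_dom, ← hc, ← X.X1.cod_dom]⟩
  let η : Trunc.Hom₂ f g := ⟨x, rfl, rfl⟩
  let θ : Trunc.Hom₂ g k := ⟨y, hc.symm, rfl⟩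
  exact ⟨_, _, f, g, k, η, θ, rfl, rfl, X.X1.comp_unique _ h (Trunc.vcomp_spec (M := X.X1) η θ)⟩

/-- `X1` is a magma with no interchange law among its axioms, so a horizontal composite is compared
with the composite of its whiskerings only after evaluation in bicategories. -/
theorem mk_hcomp {a b c : Trunc X.X1} {f f' : a ⟶ b} {g g' : b ⟶ c} (η : Trunc.Hom₂ f f')
    (θ : Trunc.Hom₂ g g') : RealHom.mk (Trunc.hcomp η θ) = RealHom.mk (Trunc.vcomp
      (Trunc.hcomp η (Trunc.idTwo g)) (Trunc.hcomp (Trunc.idTwo f') θ)) := by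
  refine RealHom.sound fun Z F hF => ?_
  obtain ⟨p, hp⟩ := exists_eval_one F f
  obtain ⟨p', hp'⟩ := exists_eval_one F f'
  obtain ⟨q, hq⟩ := exists_eval_one F g
  obtain ⟨q', hq'⟩ := exists_eval_one F g'
  obtain ⟨x, hx⟩ := exists_eval_two F η hp hp'
  obtain ⟨y, hy⟩ := exists_eval_two F θ hq hq'
  exact (map_comp_horizontal F (Trunc.hcomp_spec η θ) hx hy).trans
    (eval_vcomp (eval_whiskerRight hx hq) (eval_whiskerLeft hp' hy)).symm

theorem realCell_comp : ∀ {i j : ℕ} (h : i < j) {x y z : X.X1.cell j}, X.X1.Comp h x y z →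
    BicatComp i j (realCell hX x) (realCell hX y) (realCell hX z)
  | i, 0, h, _, _, _, _ => absurd h (Nat.not_lt_zero i)
  | 0, 1, _, x, y, z, hc => by
    have h := X.X1.comp_composable _ hc
    rw [X.X1.codTo_one_zero, X.X1.domTo_one_zero] at h
    let f : Trunc.Hom₁ (X.X1.dom x) (X.X1.cod x) := ⟨x, rfl, rfl⟩
    let g : Trunc.Hom₁ (X.X1.cod x) (X.X1.cod y) := ⟨y, h.symm, rfl⟩
    have e := X.X1.comp_unique _ hc (Trunc.comp_spec (M := X.X1) f g)
    have h1 := realOne_val hX f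
    have h2 := realOne_val hX g
    have h3 := realOne_val hX (CategoryStruct.comp (obj := Trunc X.X1) f g)
    rw [← e] at h3
    change BicatComp 0 1 (realOne hX f.1) (realOne hX g.1) (realOne hX z)
    rw [h1, h2, h3]
    exact @BicatComp.one (Trunc X.X1) (realBicategory hX) _ _ _ f g
  | 0, 2, _, x, y, z, hc => by
    obtain ⟨a, b, c, f, f', g, g', η, θ, rfl, rfl, rfl⟩ := exists_horizontal hc
    change BicatComp 0 2 (realTwo hX η.1) (realTwo hX θ.1) (realTwo hX (Trunc.hcomp η θ).1)
    rw [realTwo_val, realTwo_val, realTwo_val, mk_hcomp]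
    exact @BicatComp.horizontal (Trunc X.X1) (realBicategory hX) 0 _ _ _ _ _ _ _ (RealHom.mk η)
      (RealHom.mk θ)
  | 1, 2, _, x, y, z, hc => by
    obtain ⟨a, b, f, g, k, η, θ, rfl, rfl, rfl⟩ := exists_vertical hc
    change BicatComp 1 2 (realTwo hX η.1) (realTwo hX θ.1) (realTwo hX (Trunc.vcomp η θ).1)
    rw [realTwo_val, realTwo_val, realTwo_val]
    exact @BicatComp.vertical (Trunc X.X1) (realBicategory hX) 0 _ _ _ _ _ (RealHom.mk η)
      (RealHom.mk θ)
  | i, n + 3, h, x, y, z, hc => by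
    -- Composition over cells of dimension below `n + 2` is compatible with domains, which lowers
    -- the dimension. Over dimension `n + 2` the composable cells are identities on one common cell,
    -- and so is their composite.
    rcases Nat.lt_or_ge i (n + 2) with h' | h'
    · exact bicatComp_succ (realCell_comp h' (X.X1.comp_dom_cod h' h hc).1)
    · obtain rfl : i = n + 2 := by omega
      have h1 := X.X1.comp_composable _ hc
      rw [X.X1.codTo_succ le_rfl, X.X1.codTo_self, X.X1.domTo_succ le_rfl, X.X1.domTo_self,
        ← dom_eq_cod hX (by omega)] at h1
      have h2 := (X.X1.comp_boundary hc).1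
      change BicatComp (n + 2) (n + 3) (realCell hX (n := n + 2) (X.X1.dom x))
        (realCell hX (n := n + 2) (X.X1.dom y)) (realCell hX (n := n + 2) (X.X1.dom z))
      rw [h2, ← h1]
      exact .identity n n le_rfl _

/-- The projection from the underlying magma of a weak 2-category to the bicategory that it
presents. -/
noncomputable def toRealization : X.X1 ⟶ bicatMagma.obj (realization hX) where
  map x := realCell hX x
  map_dom {n} x := match n, x with
    | 0, _ => rfl
    | 1, _ => rfl
    | _ + 2, _ => rfl
  map_cod {n} x := match n, x with
    | 0, _ => rfl
    | 1, x => realOne_val hX (⟨X.X1.cod x, (X.X1.dom_dom x).symm, (X.X1.cod_dom x).symm⟩ :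
        Trunc.Hom₁ (X.X1.dom (X.X1.dom x)) (X.X1.cod (X.X1.dom x)))
    | n + 2, x => congrArg (realCell hX (n := n + 2)) (dom_eq_cod hX (by omega) x).symm
  map_ide {n} x := match n, x with
    | 0, a => realOne_val hX (CategoryStruct.id (obj := Trunc X.X1) a)
    | 1, f => by
      have := realTwo_val hX
        (Trunc.idTwo (⟨f, rfl, rfl⟩ : Trunc.Hom₁ (M := X.X1) (X.X1.dom f) (X.X1.cod f)))
      exact this
    | n + 2, x => congrArg (realCell hX (n := n + 2)) (X.X1.dom_ide x)
  map_comp {_ _} h {_ _ _} hc := realCell_comp hX h hc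

end Unit

/-! ### Universal property of the presented bicategory -/

section Universal

variable {X : Diagram.{u}} (hX : X.IsWeakNCat 2)

theorem eq_val_of_realOne_eq {f : X.X1.cell 1} {a b : Trunc X.X1} {f' : a ⟶ b}
    (h : realOne hX f = @OneCell.mk (Trunc X.X1) (realBicategory hX) a b f') : f = f'.1 :=
  congrArg (fun c : @OneCell (Trunc X.X1) (realBicategory hX) =>
    (@OneCell.hom (Trunc X.X1) (realBicategory hX) c).1) h

/-- Composites and bridges are unique, so the given data coincide with those chosen in the
construction of the associators and unitors. -/
theorem toRealization_isCoherent : X.IsCoherent (toRealization hX) where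
  associator {f g h fg gh l r t} h1 h2 h3 h4 ht {a b c d f' g' h'} hf hg hh := by
    obtain rfl := eq_val_of_realOne_eq hX hf
    obtain rfl := eq_val_of_realOne_eq hX hg
    obtain rfl := eq_val_of_realOne_eq hX hh
    obtain ⟨fg', gh', l', r', t', h1', h2', h3', h4', ht', hx⟩ :=
      (exists_associator hX f' g' h').choose_spec.choose_spec.1
    obtain rfl := X.X2.comp_unique _ h1 h1'
    obtain rfl := X.X2.comp_unique _ h3 h3'
    obtain rfl := X.X2.comp_unique _ h2 h2'
    obtain rfl := X.X2.comp_unique _ h4 h4'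
    obtain rfl := hX.bridge.unique ht ht'
    rw [← hx]
    exact realTwo_val hX (assocHom hX f' g' h')
  leftUnitor {f l t} h1 ht {a b f'} hf := by
    obtain rfl := eq_val_of_realOne_eq hX hf
    obtain ⟨l', t', h1', ht', hx⟩ := (exists_leftUnitor hX f').choose_spec.choose_spec.1
    obtain rfl := X.X2.comp_unique _ h1 h1'
    obtain rfl := hX.bridge.unique ht ht'
    rw [← hx]
    exact realTwo_val hX (leftHom hX f')
  rightUnitor {f l t} h1 ht {a b f'} hf := by
    obtain rfl := eq_val_of_realOne_eq hX hf
    obtain ⟨l', t', h1', ht', hx⟩ := (exists_rightUnitor hX f').choose_spec.choose_spec.1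
    obtain rfl := X.X2.comp_unique _ h1 h1'
    obtain rfl := hX.bridge.unique ht ht'
    rw [← hx]
    exact realTwo_val hX (rightHom hX f')

theorem exists_realOne (x : OneCell (realization hX).carrier) : ∃ f, realOne hX f = x := by
  obtain ⟨f⟩ := x
  exact ⟨f.1, realOne_val hX f⟩

theorem exists_realTwo (x : TwoCell (realization hX).carrier) : ∃ y, realTwo hX y = x := by
  obtain ⟨x⟩ := x
  obtain ⟨x, rfl⟩ := RealHom.exists_rep x
  exact ⟨x.1, realTwo_val hX x⟩

/-- The projection is surjective on cells of dimension at most 2, and these determine a strict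
homomorphism. -/
theorem realization_hom_ext {Z : Bicat.{u}} {G G' : realization hX ⟶ Z}
    (h : toRealization hX ≫ bicatMagma.map G = toRealization hX ≫ bicatMagma.map G') : G = G' := by
  have e : ∀ {n : ℕ} (x : X.X1.cell n), (bicatMagma.map G).map (realCell hX x) =
      (bicatMagma.map G').map (realCell hX x) := fun x =>
    congrArg (fun K : X.X1 ⟶ bicatMagma.obj Z => K.map x) h
  refine bicatHom_ext (magmaHom_ext (fun a => e (n := 0) a) (fun x => ?_) (fun x => ?_))
  · obtain ⟨f, rfl⟩ := exists_realOne hX x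
    exact e (n := 1) f
  · obtain ⟨y, rfl⟩ := exists_realTwo hX x
    exact e (n := 2) y

section Lift

variable {Z : Bicat.{u}} {F : X.X1 ⟶ bicatMagma.obj Z} (hF : X.IsCoherent F)

/-- The action on cells of the extension of a coherent morphism. -/
def liftCell : ∀ {n : ℕ}, bicatCell (realization hX).carrier n → bicatCell Z.carrier n
  | 0 => fun a => F.map (n := 0) a
  | 1 => fun x => F.map (n := 1) (@OneCell.hom (Trunc X.X1) (realBicategory hX) x).1
  | _ + 2 => fun x => Quotient.lift (fun y => F.map (n := 2) y.1) 
      (fun x y (h : (realSetoid _ _).r x y) => h Z F hF)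
      (@TwoCell.hom (Trunc X.X1) (realBicategory hX) x)

/-- The extension of a coherent morphism, as a morphism of omega magmas. -/
def liftMagmaHom : bicatMagma.obj (realization hX) ⟶ bicatMagma.obj Z where
  map x := liftCell hX hF x
  map_dom {n} x := match n, x with
    | 0, ⟨f⟩ => (congrArg F.map f.2.1).symm.trans (F.map_dom f.1)
    | 1, ⟨x⟩ => by
      obtain ⟨x, rfl⟩ := RealHom.exists_rep x
      exact (congrArg F.map x.2.1).symm.trans (F.map_dom x.1)
    | _ + 2, _ => rfl
  map_cod {n} x := match n, x with
    | 0, ⟨f⟩ => (congrArg F.map f.2.2).symm.trans (F.map_cod f.1)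
    | 1, ⟨x⟩ => by
      obtain ⟨x, rfl⟩ := RealHom.exists_rep x
      exact (congrArg F.map x.2.2).symm.trans (F.map_cod x.1)
    | _ + 2, _ => rfl
  map_ide {n} x := match n, x with
    | 0, a => F.map_ide (n := 0) a
    | 1, ⟨f⟩ => F.map_ide (n := 1) f.1
    | _ + 2, _ => rfl
  map_comp {i j} hij {x y z} hc := by
    change BicatComp i j _ _ _ at hc
    change BicatComp i j (liftCell hX hF x) (liftCell hX hF y) (liftCell hX hF z)
    cases hc with
    | one f g => exact F.map_comp _ (Trunc.comp_spec f g)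
    | @horizontal n a b c f f' g g' η θ =>
      obtain ⟨x, rfl⟩ := RealHom.exists_rep η
      obtain ⟨y, rfl⟩ := RealHom.exists_rep θ
      obtain ⟨p, hp⟩ := exists_eval_one F f
      obtain ⟨p', hp'⟩ := exists_eval_one F f'
      obtain ⟨q, hq⟩ := exists_eval_one F g
      obtain ⟨q', hq'⟩ := exists_eval_one F g'
      obtain ⟨x', hx⟩ := exists_eval_two F x hp hp'
      obtain ⟨y', hy⟩ := exists_eval_two F y hq hq'
      have e := eval_vcomp (eval_whiskerRight hx hq) (eval_whiskerLeft hp' hy)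
      change BicatComp 0 (n + 2) (F.map (n := 2) x.1) (F.map (n := 2) y.1)
        (F.map (n := 2) (Trunc.vcomp (Trunc.hcomp x (Trunc.idTwo g))
          (Trunc.hcomp (Trunc.idTwo f') y)).1)
      rw [hx, hy, e]
      exact .horizontal n x' y'
    | @vertical n a b f g k η θ =>
      obtain ⟨x, rfl⟩ := RealHom.exists_rep η
      obtain ⟨y, rfl⟩ := RealHom.exists_rep θ
      obtain ⟨p, hp⟩ := exists_eval_one F f
      obtain ⟨q, hq⟩ := exists_eval_one F g
      obtain ⟨r, hr⟩ := exists_eval_one F k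
      obtain ⟨x', hx⟩ := exists_eval_two F x hp hq
      obtain ⟨y', hy⟩ := exists_eval_two F y hq hr
      change BicatComp 1 (n + 2) (F.map (n := 2) x.1) (F.map (n := 2) y.1)
        (F.map (n := 2) (Trunc.vcomp x y).1)
      rw [hx, hy, eval_vcomp hx hy]
      exact .vertical n x' y'
    | identity i n h x => exact .identity i n h _

theorem liftMagmaHom_preservesCoherence : PreservesCoherence (liftMagmaHom hX hF) where
  associator _ _ _ _ _ _ _ _ _ _ hf hg hh := eval_assocHom hX hF hf hg hh
  leftUnitor _ _ _ _ hf := eval_leftHom hX hF hf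
  rightUnitor _ _ _ _ hf := eval_rightHom hX hF hf

theorem liftCell_realCell : ∀ {n : ℕ} (x : X.X1.cell n), liftCell hX hF (realCell hX x) = F.map x
  | 0, _ => rfl
  | 1, _ => rfl
  | 2, _ => rfl
  | n + 3, x => by
    -- A higher cell is an identity, and `F` preserves identities, so the claim descends one
    -- dimension.
    obtain ⟨y, rfl⟩ := hX.skeletal (n + 2) (by omega) x
    refine Eq.trans ?_ (F.map_ide y).symm
    refine Eq.trans ?_ (liftCell_realCell (n := n + 2) y)
    change liftCell hX hF (n := n + 2) (realCell hX (n := n + 2) (X.X1.dom (X.X1.ide y))) = _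
    rw [X.X1.dom_ide]

include hF in
theorem exists_realization_lift :
    ∃ G : realization hX ⟶ Z, toRealization hX ≫ bicatMagma.map G = F := by
  obtain ⟨G, hG⟩ := exists_bicatHom _ (liftMagmaHom_preservesCoherence hX hF)
  refine ⟨G, ?_⟩
  rw [hG]
  exact OmegaMagma.Hom.ext (by funext n x; exact liftCell_realCell hX hF x)

end Lift

/-- The strict homomorphism extending a coherent morphism. -/
noncomputable def realizationLift {Z : Bicat.{u}} {F : X.X1 ⟶ bicatMagma.obj Z}
    (hF : X.IsCoherent F) : realization hX ⟶ Z :=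
  (exists_realization_lift hX hF).choose

theorem toRealization_lift {Z : Bicat.{u}} {F : X.X1 ⟶ bicatMagma.obj Z} (hF : X.IsCoherent F) :
    toRealization hX ≫ bicatMagma.map (realizationLift hX hF) = F :=
  (exists_realization_lift hX hF).choose_spec

end Universal

/-! ### Functoriality in the weak 2-category -/

section RealizationFunctor

/-- An omega functor carries lifts, composites and bridges of `X` to those of `X'` and commutes with
`lam`. This makes the universal property functorial. -/
theorem Diagram.IsCoherent.comp {X X' : Diagram.{u}} (G : X ⟶ X') {Z : Bicat.{u}}
    {F : X'.X1 ⟶ bicatMagma.obj Z} (hF : X'.IsCoherent F) : X.IsCoherent (G.F1 ≫ F) := by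
  have hr : ∀ {n : ℕ} (x : X.X1.cell n), G.F2.map (X.rho.map x) = X'.rho.map (G.F1.map x) :=
    fun x => congrArg (fun K : magmaGraph.obj X.X1 ⟶ magmaGraph.obj X'.X2 => K.map x) G.rho_comm
  have hl : ∀ {n : ℕ} (x : X.X2.cell n), G.F1.map (X.lam.map x) = X'.lam.map (G.F2.map x) :=
    fun x => congrArg (fun K : X.X2 ⟶ X'.X1 => K.map x) G.lam_comm
  have hi : ∀ x : X.X1.cell 0, G.F2.map (X.X2.ide (X.rho.map x)) =
      X'.X2.ide (X'.rho.map (G.F1.map x)) := fun x =>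
    (G.F2.map_ide (X.rho.map x)).trans (congrArg X'.X2.ide (hr x))
  constructor
  · intro f g h fg gh l r t h1 h2 h3 h4 ht a b c d f' g' h' hf hg hh
    replace h1 := G.F2.map_comp _ h1
    replace h2 := G.F2.map_comp _ h2
    replace h3 := G.F2.map_comp _ h3
    replace h4 := G.F2.map_comp _ h4
    simp only [hr] at h1 h2 h3 h4
    exact (congrArg F.map (hl t)).trans
      (hF.associator h1 h2 h3 h4 (G.bridge ht) hf hg hh)
  · intro f l t h1 ht a b f' hf
    replace h1 := G.F2.map_comp _ h1
    replace ht := G.bridge ht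
    rw [hi, hr, G.F1.map_dom] at h1
    rw [hr] at ht
    exact (congrArg F.map (hl t)).trans (hF.leftUnitor h1 ht hf)
  · intro f l t h1 ht a b f' hf
    replace h1 := G.F2.map_comp _ h1
    replace ht := G.bridge ht
    rw [hi, hr, G.F1.map_cod] at h1
    rw [hr] at ht
    exact (congrArg F.map (hl t)).trans (hF.rightUnitor h1 ht hf)

/-- The projection to the presented bicategory, for a weak 2-category. -/
noncomputable def weakProj (X : WeakTwoCat.{u}) :
    X.obj.X1 ⟶ bicatMagma.obj (realization X.property) :=
  toRealization X.property

/-- The strict homomorphism induced by an omega functor. -/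
noncomputable def realizationMap {X X' : WeakTwoCat.{u}} (G : X ⟶ X') :
    realization X.property ⟶ realization X'.property :=
  realizationLift X.property ((toRealization_isCoherent X'.property).comp G.hom)

theorem weakProj_realizationMap {X X' : WeakTwoCat.{u}} (G : X ⟶ X') :
    weakProj X ≫ bicatMagma.map (realizationMap G) = G.hom.F1 ≫ weakProj X' :=
  toRealization_lift _ _

/-- The functor from weak 2-categories to bicategories. -/
noncomputable def realizationFunctor : WeakTwoCat.{u} ⥤ Bicat.{u} where
  obj X := realization X.property
  map G := realizationMap G
  map_id X := realization_hom_ext _ (by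
    refine (weakProj_realizationMap (𝟙 X)).trans ?_
    rw [CategoryTheory.Functor.map_id]
    exact (Category.id_comp (weakProj X)).trans (Category.comp_id (weakProj X)).symm)
  map_comp {X X' X''} G H := realization_hom_ext _ (by
    refine (weakProj_realizationMap (G ≫ H)).trans ?_
    rw [Functor.map_comp]
    refine Eq.trans ?_ (Category.assoc (weakProj X) _ _)
    rw [weakProj_realizationMap, Category.assoc, weakProj_realizationMap, ← Category.assoc]
    rfl)

variable {X : Diagram.{u}} {Z : Bicat.{u}}

/-- The hypothesis supplies some bridge with the right image, while coherence is about every bridge;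
the two coincide since a bridge is determined by its boundary. -/
theorem CoherenceFromBridges.isCoherent (hX : X.IsWeakNCat 2) {e : bicatMagma.obj Z ≅ X.X1}
    (h : CoherenceFromBridges X Z e.hom) : X.IsCoherent e.inv := by
  have he : ∀ {n : ℕ} (x : X.X1.cell n), e.hom.map (e.inv.map x) = x := fun x =>
    congrArg (fun K : X.X1 ⟶ X.X1 => K.map x) e.inv_hom_id
  have he' : ∀ {n : ℕ} (x : (bicatMagma.obj Z).cell n), e.inv.map (e.hom.map x) = x := fun x =>
    congrArg (fun K : bicatMagma.obj Z ⟶ bicatMagma.obj Z => K.map x) e.hom_inv_id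
  have hm : ∀ {f : X.X1.cell 1} {a b : Z.carrier} {f' : a ⟶ b}, e.inv.map f = OneCell.mk f' →
      f = e.hom.map (n := 1) (OneCell.mk f') := fun hf => by rw [← hf, he]
  constructor
  · intro f g k fg gh l r t h1 h2 h3 h4 ht a b c d f' g' k' hf hg hk
    rw [hm hf, hm hg] at h1
    rw [hm hk] at h2
    rw [hm hg, hm hk] at h3
    rw [hm hf] at h4
    obtain ⟨t', ht', h'⟩ := h.associator f' g' k' h1 h2 h3 h4
    rw [hX.bridge.unique ht ht', h']
    exact he' (n := 2) _
  · intro f l t h1 ht a b f' hf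
    rw [hm hf] at h1 ht
    rw [← show e.hom.map (n := 0) a = X.X1.dom (e.hom.map (n := 1) (OneCell.mk f')) from
      e.hom.map_dom (n := 0) (OneCell.mk f')] at h1
    obtain ⟨t', ht', h'⟩ := h.leftUnitor f' h1
    rw [hX.bridge.unique ht ht', h']
    exact he' (n := 2) _
  · intro f l t h1 ht a b f' hf
    rw [hm hf] at h1 ht
    rw [← show e.hom.map (n := 0) b = X.X1.cod (e.hom.map (n := 1) (OneCell.mk f')) from
      e.hom.map_cod (n := 0) (OneCell.mk f')] at h1
    obtain ⟨t', ht', h'⟩ := h.rightUnitor f' h1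
    rw [hX.bridge.unique ht ht', h']
    exact he' (n := 2) _

end RealizationFunctor

/-! ### Recovering a bicategory from its coherence data -/

section Comparison

variable {X : Diagram.{u}} (hX : X.IsWeakNCat 2) {Z : Bicat.{u}}

/-- The image of a 1-cell as a 1-cell with prescribed boundary. -/
def imageOne (e : bicatMagma.obj Z ⟶ X.X1) {a b : Z.carrier} (f : a ⟶ b) :
    Trunc.Hom₁ (M := X.X1) (e.map (n := 0) a) (e.map (n := 0) b) :=
  ⟨e.map (n := 1) (OneCell.mk f), (e.map_dom (n := 0) (OneCell.mk f)).symm,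
    (e.map_cod (n := 0) (OneCell.mk f)).symm⟩

include hX

theorem CoherenceFromBridges.preservesCoherence {e : bicatMagma.obj Z ⟶ X.X1}
    (h : CoherenceFromBridges X Z e) {Z' : Bicat.{u}} {F : X.X1 ⟶ bicatMagma.obj Z'}
    (hF : X.IsCoherent F) : PreservesCoherence (e ≫ F) where
  associator f g k _ _ _ _ _ _ _ hf hg hk := by
    -- Only the composites of the lifts are taken from here; the bridge between them is the one
    -- given by the hypothesis on `e`, which knows its image under `lam`.
    obtain ⟨x, y, ⟨fg, gh, l, r, -, h1, h2, h3, h4, -, -⟩, -, -⟩ :=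
      exists_associator hX (imageOne e f) (imageOne e g) (imageOne e k)
    obtain ⟨t, ht, h'⟩ := h.associator f g k h1 h2 h3 h4
    exact (congrArg F.map h').symm.trans (hF.associator h1 h2 h3 h4 ht hf hg hk)
  leftUnitor {a b} f _ _ _ hf := by
    obtain ⟨l, h1, -, -⟩ := exists_ide_comp hX
      (X.rho.map_dom (e.map (n := 1) (OneCell.mk f))).symm
    have h2 :
        X.X2.Comp Nat.zero_lt_one (X.X2.ide (X.rho.map (X.X1.dom (e.map (n := 1) (OneCell.mk f)))))
        (X.rho.map (e.map (n := 1) (OneCell.mk f))) l := h1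
    rw [← show e.map (n := 0) a = X.X1.dom (e.map (n := 1) (OneCell.mk f)) from
      e.map_dom (n := 0) (OneCell.mk f)] at h2
    obtain ⟨t, ht, h'⟩ := h.leftUnitor f h2
    exact (congrArg F.map h').symm.trans (hF.leftUnitor h1 ht hf)
  rightUnitor {a b} f _ _ _ hf := by
    obtain ⟨l, h1, -, -⟩ := exists_comp_ide hX
      (X.rho.map_cod (e.map (n := 1) (OneCell.mk f))).symm
    have h2 :
        X.X2.Comp Nat.zero_lt_one (X.rho.map (e.map (n := 1) (OneCell.mk f)))
        (X.X2.ide (X.rho.map (X.X1.cod (e.map (n := 1) (OneCell.mk f))))) l := h1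
    rw [← show e.map (n := 0) b = X.X1.cod (e.map (n := 1) (OneCell.mk f)) from
      e.map_cod (n := 0) (OneCell.mk f)] at h2
    obtain ⟨t, ht, h'⟩ := h.rightUnitor f h2
    exact (congrArg F.map h').symm.trans (hF.rightUnitor h1 ht hf)

/-- The inverse identification is coherent, so it extends to the presented bicategory; `e` followed
by the projection preserves associators and unitors, so it is a strict homomorphism. They are
mutually inverse by uniqueness of extensions and by faithfulness. -/
theorem exists_realization_iso {e : bicatMagma.obj Z ≅ X.X1}
    (h : CoherenceFromBridges X Z e.hom) :
    ∃ θ : realization hX ≅ Z, toRealization hX ≫ bicatMagma.map θ.hom = e.inv := by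
  obtain ⟨G, hG⟩ := exists_bicatHom _ (h.preservesCoherence hX (toRealization_isCoherent hX))
  obtain ⟨H, hH⟩ := exists_realization_lift hX (h.isCoherent hX)
  refine ⟨⟨H, G, realization_hom_ext hX ?_, bicatMagma.map_injective ?_⟩, hH⟩
  · rw [Functor.map_comp, ← Category.assoc, hH, hG, e.inv_hom_id_assoc,
      CategoryTheory.Functor.map_id, Category.comp_id]
  · rw [Functor.map_comp, hG, Category.assoc, hH, e.hom_inv_id, CategoryTheory.Functor.map_id]

end Comparison

/-! ### Bicategories as a retract of weak 2-categories -/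

section Retract

variable (P : ∀ Y : Bicat.{u}, FreeBicat Y) (Q : ∀ Y : Bicat.{u}, FreeStrict Y)
  (h : ∀ Y : Bicat.{u}, (standardDiagram (P Y) (Q Y)).IsWeakNCat 2)

theorem exists_standard_iso (Y : Bicat.{u}) : ∃ θ : realization (h Y) ≅ Y,
    toRealization (h Y) ≫ bicatMagma.map θ.hom = 𝟙 (bicatMagma.obj Y) :=
  exists_realization_iso (h Y) (e := Iso.refl (bicatMagma.obj Y))
    (standardDiagram_coherenceFromBridges (P Y) (Q Y))

/-- The realization of the diagram associated with a bicategory is the bicategory. -/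
noncomputable def standardIso (Y : Bicat.{u}) : realization (h Y) ≅ Y :=
  (exists_standard_iso P Q h Y).choose

theorem toRealization_standardIso (Y : Bicat.{u}) :
    toRealization (h Y) ≫ bicatMagma.map (standardIso P Q h Y).hom = 𝟙 (bicatMagma.obj Y) :=
  (exists_standard_iso P Q h Y).choose_spec

/-- Bicategories are a retract of weak 2-categories. -/
noncomputable def retractIso : standardFunctor P Q h ⋙ realizationFunctor ≅ 𝟭 Bicat.{u} :=
  NatIso.ofComponents (fun Y => standardIso P Q h Y) (fun {Y Y'} F => by
    -- Naturality is tested after the projection, where `standardIso` becomes the identity of the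
    -- magma and both sides reduce to `bicatMagma.map F`.
    apply realization_hom_ext (h Y)
    have h1 : toRealization (h Y) ≫ bicatMagma.map
        (realizationMap ((standardFunctor P Q h).map F)) =
        bicatMagma.map F ≫ toRealization (h Y') :=
      weakProj_realizationMap ((standardFunctor P Q h).map F)
    refine (congrArg (toRealization (h Y) ≫ ·) (bicatMagma.map_comp _ _)).trans ?_
    refine ((Category.assoc _ _ _).symm.trans ((congrArg (· ≫ _) h1).trans
      (Category.assoc _ _ _))).trans ?_
    refine (congrArg (bicatMagma.map F ≫ ·) (toRealization_standardIso P Q h Y')).trans ?_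
    refine Eq.trans ?_ (congrArg (toRealization (h Y) ≫ ·) (bicatMagma.map_comp _ _)).symm
    refine Eq.trans ?_ (Category.assoc _ _ _)
    refine Eq.trans ?_ (congrArg (· ≫ bicatMagma.map F) (toRealization_standardIso P Q h Y)).symm
    exact (Category.comp_id _).trans (Category.id_comp _).symm)

end Retract

end WeakOmega

theorem theorem20 :
    -- free bicategories and free strict 2-categories on underlying omega graphs exist
    (∀ Y : Bicat.{u}, Nonempty (FreeBicat Y) ∧ Nonempty (FreeStrict Y)) ∧
    -- a free strict 2-category on the omega graph of `Y` is also a free strict omega category on it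
    (∀ (Y : Bicat.{u}) (Q : FreeStrict Y),
      (bicatMagma.obj Q.obj.obj).IsStrict ∧
      ∀ (T : StrictOmegaCat.{u}) (φ : bicatGraph.obj Y ⟶ strictOmegaGraph.obj T),
        ∃! ψ : bicatMagma.obj Q.obj.obj ⟶ T.obj, Q.unit ≫ magmaGraph.map ψ = φ) ∧
    (∀ (Y : Bicat.{u}) (P : FreeBicat Y) (Q : FreeStrict Y),
      -- the diagram is a weak 2-category
      (standardDiagram P Q).IsWeakNCat 2 ∧
      -- `kap` is locally faithful
      (∀ x y : (standardDiagram P Q).X2.cell 2, (standardDiagram P Q).X2.Parallel x y →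
        (standardDiagram P Q).kap.map x = (standardDiagram P Q).kap.map y → x = y) ∧
      -- the associators and unitors of `Y` are the images under `lam` of bridge cells
      CoherenceFromBridges (standardDiagram P Q) Y (𝟙 (bicatMagma.obj Y)) ∧
      -- the images under `lam` of the bridge 2-cells are coherence isomorphisms of `Y`
      (∀ (x y : (standardDiagram P Q).X2.cell 1) (c : (standardDiagram P Q).X2.cell 2),
        (standardDiagram P Q).R 1 x y c →
          ∃ (a b : Y.carrier) (f g : a ⟶ b) (η : f ⟶ g),
            IsCoherence η ∧ (standardDiagram P Q).lam.map c = TwoCell.mk η)) ∧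
    -- bicategories are a retract of weak 2-categories
    (∀ (P : ∀ Y : Bicat.{u}, FreeBicat Y) (Q : ∀ Y : Bicat.{u}, FreeStrict Y)
      (h : ∀ Y : Bicat.{u}, (standardDiagram (P Y) (Q Y)).IsWeakNCat 2),
      ∃ U : WeakTwoCat.{u} ⥤ Bicat.{u},
        Nonempty (standardFunctor P Q h ⋙ U ≅ 𝟭 Bicat.{u}) ∧
        ∀ (X : WeakTwoCat.{u}) (Z : Bicat.{u}) (e : bicatMagma.obj Z ≅ X.obj.X1),
          CoherenceFromBridges X.obj Z e.hom → Nonempty (U.obj X ≅ Z)) := by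
  exact ⟨fun Y => ⟨⟨freeBicatObject Y⟩, ⟨freeStrictObject Y⟩⟩,
    fun Y Q => ⟨isStrict_of_freeStrict Q, fun T φ => freeStrict_existsUnique Y Q T φ⟩,
    fun Y P Q => ⟨standardDiagram_isWeakNCat P Q, fun x y hp h => comparison_faithful P Q hp h,
      standardDiagram_coherenceFromBridges P Q, fun x y c h => exists_isCoherence_of_bridge P h⟩,
    fun P Q h => ⟨realizationFunctor, ⟨retractIso P Q h⟩, fun X Z e he =>
      (exists_realization_iso X.property he).elim fun θ _ => ⟨θ⟩⟩⟩
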